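/- Let $d\in\{2,3\}$, let $\Omega(t)\subset\mathbb{R}^d$, $t\in[0,T]$, be a time-dependent polygonal/polyhedral domain (bounded, connected, open, equal to the interior of its closure, with boundary contained in finitely many hyperplanes), and let $0=t^0<\dots<t^N=T$, $\Omega^n:=\Omega(t^n)$. Each closed space–time slab $\{(t,\boldsymbol x): t\in[t^n,t^{n+1}],\ \boldsymbol x\in\overline{\Omega(t)}\}$ is exactly covered by a conforming mesh $\mathcal{T}^n$ of nondegenerate closed $(d+1)$-simplices $\mathcal K$ with diameter $h_{\mathcal K}$ and outward unit normal $(n_t,\boldsymbol n)$; facets with $|n_t|=1$ lie on $\{t=t^n\}$ or $\{t=t^{n+1}\}$ only, and $K^n$, $K^{n+1}$ denote the facets of $\mathcal K$ there, if any. The remaining facets of $\mathcal K$ make up $\mathcal Q_{\mathcal K}$. Of these remaining facets, those belonging to only one cell are the boundary facets; they are divided into Dirichlet facets and Neumann facets, the set of the latter being $\mathcal F_N^n$. The mesh is shape regular with constant $\sigma$: each $\mathcal K$ contains a ball of radius $r>0$ with $h_{\mathcal K}\le\sigma r$. For $k\ge1$ let $\boldsymbol V_h^{n,\star}$ be the space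 of pairs $\boldsymbol v^\star=(\boldsymbol v,\bar{\boldsymbol v})$ where $\boldsymbol v$ is $\mathbb{R}^d$-valued and polynomial of degree at most $k$ on each cell, $\bar{\boldsymbol v}$ is $\mathbb{R}^d$-valued and polynomial of degree at most $k$ on each facet with $|n_t|\neq1$, and $\bar{\boldsymbol v}=0$ on Dirichlet facets. Let $Q_h^{n,\star}$ be the space of pairs $q^\star=(q,\bar q)$ of scalar functions which are polynomial of degree at most $k-1$ on cells and at most $k$ on these facets. With $\nabla$ the spatial gradient, put $$a_h^n(\boldsymbol u^\star,\boldsymbol v^\star)=\sum_{\mathcal K}\int_{\mathcal K}\nu\nabla\boldsymbol u:\nabla\boldsymbol v+\sum_{\mathcal K}\int_{\mathcal Q_{\mathcal K}}\Big(\tfrac{\nu\alpha}{h_{\mathcal K}}(\boldsymbol u-\bar{\boldsymbol u})\cdot(\boldsymbol v-\bar{\boldsymbol v})-\nu\big[(\boldsymbol u-\bar{\boldsymbol u})\cdot\partial_{\boldsymbol n}\boldsymbol v+\partial_{\boldsymbol n}\boldsymbol u\cdot(\boldsymbol v-\bar{\boldsymbol v})\big]\Big)ds,$$ $$b_h^n(p^\star,\boldsymbol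 v^\star)=-\sum_{\mathcal K}\int_{\mathcal K}p\,\nabla\cdot\boldsymbol v+\sum_{\mathcal K}\int_{\mathcal Q_{\mathcal K}}(\boldsymbol v-\bar{\boldsymbol v})\cdot\boldsymbol n\,\bar p\,ds,$$ $$t_h^n(\boldsymbol u^\star,\boldsymbol w^\star,\boldsymbol v^\star)=-\sum_{\mathcal K}\int_{\mathcal K}(\boldsymbol u\cdot\partial_t\boldsymbol v+\boldsymbol u\otimes\boldsymbol w:\nabla\boldsymbol v)+\sum_{\mathcal K}\int_{K^{n+1}}\boldsymbol u\cdot\boldsymbol v\,d\boldsymbol x+\sum_{\mathcal K}\int_{\mathcal Q_{\mathcal K}}H\cdot(\boldsymbol v-\bar{\boldsymbol v})\,ds+\sum_{\mathcal S\in\mathcal F_N^n}\int_{\mathcal S}\max(n_t+\bar{\boldsymbol w}\cdot\boldsymbol n,0)\,\bar{\boldsymbol u}\cdot\bar{\boldsymbol v}\,ds,$$ where $H=(n_t+\boldsymbol w\cdot\boldsymbol n)(\boldsymbol u+\lambda(\bar{\boldsymbol u}-\boldsymbol u))$, with $\lambda=1$ where $n_t+\boldsymbol w\cdot\boldsymbol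 n<0$ and $\lambda=0$ elsewhere. Picard iteration in slab $n$, with zero forcing and homogeneous boundary data: start from some $\boldsymbol u_h^{\star,0}\in\boldsymbol V_h^{n,\star}$; given $\boldsymbol u_h^{\star,i}$, the next iterate $(\boldsymbol u_h^{\star,i+1},p_h^{\star,i+1})\in\boldsymbol V_h^{n,\star}\times Q_h^{n,\star}$ is a solution of $$t_h^n(\boldsymbol u_h^{\star,i+1},\boldsymbol u_h^{\star,i},\boldsymbol v^\star)+a_h^n(\boldsymbol u_h^{\star,i+1},\boldsymbol v^\star)+b_h^n(p_h^{\star,i+1},\boldsymbol v^\star)-b_h^n(q^\star,\boldsymbol u_h^{\star,i+1})=\sum_{\mathcal K}\int_{K^n}\boldsymbol u_h^-\cdot\boldsymbol v\,d\boldsymbol x\quad\text{for all }(\boldsymbol v^\star,q^\star)\in\boldsymbol V_h^{n,\star}\times Q_h^{n,\star}.$$ The iteration is stopped after $m_n\ge1$ steps and the last iterate is the discrete solution $\boldsymbol u_h$ in the slab. For $n=0$, $\boldsymbol u_h^-$ is the discrete initial datum, an arbitrary field in $L^2(\Omega^0)^d$ (for instance a divergence-free $H(\mathrm{div})$-conforming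 projection of the initial velocity); for $n\ge1$, $\boldsymbol u_h^-=\lim_{\varepsilon\to0+}\boldsymbol u_h(t^n-\varepsilon,\cdot)$ is the trace from the previous slab. Call $\boldsymbol w^\star\in\boldsymbol V_h^{n,\star}$ admissible if $\nabla\cdot\boldsymbol w=0$ on every cell, $\boldsymbol w\cdot\boldsymbol n$ is single-valued on interior facets, and $\boldsymbol w\cdot\boldsymbol n=\bar{\boldsymbol w}\cdot\boldsymbol n$ on boundary facets. Then there is $\alpha_0>0$ depending only on $d$, $k$ and $\sigma$ such that for all $\alpha\ge\alpha_0$, all $\nu>0$ and all data as above the following holds. (i) For every slab $n=0,\dots,N-1$ and every $0\le i<m_n$ such that $i\ge1$ or the initial guess $\boldsymbol u_h^{\star,0}$ in this slab is admissible, the Picard iterate $i+1$ satisfies $$\int_{\Omega^{n+1}}|\boldsymbol u_h^{i+1}|^2\,d\boldsymbol x\le\int_{\Omega^n}|\boldsymbol u_h^-|^2\,d\boldsymbol x,$$ where $\boldsymbol u_h^{i+1}$ on $\Omega^{n+1}$ is the trace from within the slab. (ii) If in every slab $m_n\ge2$ or the initial guess is admissible, the discrete kinetic energy is non-increasing over time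 levels: with $\boldsymbol u_h^-$ at level $N$ again denoting the trace of the discrete solution from below, $\int_{\Omega^{n'}}|\boldsymbol u_h^-|^2\le\int_{\Omega^n}|\boldsymbol u_h^-|^2$ for all $0\le n\le n'\le N$. -/

import Mathlib

open MeasureTheory Filter Topology
open scoped MeasureTheory

noncomputable section

/-! ### Space-time coordinates -/

/-- Space `ℝ^d` with the Euclidean structure. -/
abbrev Space (d : ℕ) := EuclideanSpace ℝ (Fin d)

/-- Space-time `ℝ × ℝ^d` with the Euclidean structure; coordinate `0` is time. -/
abbrev SpaceTime (d : ℕ) := EuclideanSpace ℝ (Fin (d + 1))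

/-- The space-time point (or vector) with temporal part `t` and spatial part `x`. -/
def stPoint {d : ℕ} (t : ℝ) (x : Space d) : SpaceTime d :=
  WithLp.toLp 2 (Fin.cons t (fun i => x i) : Fin (d + 1) → ℝ)

/-- The spatial part of a space-time point (or vector). -/
def spacePart {d : ℕ} (y : SpaceTime d) : Space d :=
  WithLp.toLp 2 (fun i : Fin d => y i.succ)

/-! ### Geometry of simplices given by their vertex sets -/

/-- The closed simplex with vertex set `K`. -/
def hull {d : ℕ} (K : Finset (SpaceTime d)) : Set (SpaceTime d) :=
  convexHull ℝ (K : Set (SpaceTime d))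

/-- The centroid of a vertex set. -/
def vertexCentroid {d : ℕ} (S : Finset (SpaceTime d)) : SpaceTime d :=
  (S.card : ℝ)⁻¹ • ∑ y ∈ S, y

/-- The outward unit space-time normal `(n_t, n)` of the cell `K` on its facet `S`: the vector from
the centroid of `K` to the centroid of `S`, projected onto the orthogonal complement of the
directions of `S`, and normalised. -/
def outwardNormal {d : ℕ} (K S : Finset (SpaceTime d)) : SpaceTime d :=
  NormedSpace.normalize
    ((vectorSpan ℝ (S : Set (SpaceTime d)))ᗮ.starProjection (vertexCentroid S - vertexCentroid K))

/-- Temporal component `n_t` of the outward unit normal. -/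
def normalT {d : ℕ} (K S : Finset (SpaceTime d)) : ℝ := outwardNormal K S 0

/-- Spatial component `n` of the outward unit normal. -/
def normalX {d : ℕ} (K S : Finset (SpaceTime d)) : Space d := spacePart (outwardNormal K S)

/-- All facets of a cell with `d + 2` vertices. -/
def allFacets {d : ℕ} (K : Finset (SpaceTime d)) : Finset (Finset (SpaceTime d)) :=
  K.powersetCard (d + 1)

open Classical in
/-- The facets of `K` with `|n_t| ≠ 1`; their union is `𝒬_K`. -/
def lateralFacets {d : ℕ} (K : Finset (SpaceTime d)) : Finset (Finset (SpaceTime d)) :=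
  (allFacets K).filter (fun S => |normalT K S| ≠ 1)

/-- Surface measure on the facet `S`. -/
def facetMeasure {d : ℕ} (S : Finset (SpaceTime d)) : Measure (SpaceTime d) :=
  (μHE[d] : Measure (SpaceTime d)).restrict (hull S)

/-- The mesh size `h_K`. -/
def cellSize {d : ℕ} (K : Finset (SpaceTime d)) : ℝ := Metric.diam (hull K)

/-- The spatial section of the closed cell `K` at time `t`. If all points of `K` have time
coordinate at most `t` (or at least `t`), this is the facet `K^{n+1}` (or `K^n`) of `K` on
`{time = t}` if there is one, and a Lebesgue null set otherwise. -/
def cellSection {d : ℕ} (K : Finset (SpaceTime d)) (t : ℝ) : Set (Space d) :=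
  {x | stPoint t x ∈ hull K}

/-! ### Time-dependent domains and space-time meshes -/

/-- A polygonal (`d = 2`) or polyhedral (`d = 3`) domain: a bounded connected open set which lies
on one side of its boundary, the latter being contained in finitely many hyperplanes. -/
structure IsPolyhedralDomain {d : ℕ} (Ω : Set (Space d)) : Prop where
  isOpen : IsOpen Ω
  isConnected : IsConnected Ω
  isBounded : Bornology.IsBounded Ω
  interior_closure : interior (closure Ω) = Ω
  frontier_subset : ∃ H : Finset (AffineSubspace ℝ (Space d)),
    (∀ P ∈ H, P ≠ ⊤) ∧ frontier Ω ⊆ ⋃ P ∈ H, (P : Set (Space d))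

/-- A conforming mesh of nondegenerate space-time `(d+1)`-simplices, each given by its vertices,
together with the set of those boundary facets on which the Neumann condition is imposed. -/
structure SlabMesh (d : ℕ) where
  cells : Finset (Finset (SpaceTime d))
  card_cell : ∀ K ∈ cells, K.card = d + 2
  affineIndependent : ∀ K ∈ cells, AffineIndependent ℝ (fun y : K => (y : SpaceTime d))
  conforming : ∀ K ∈ cells, ∀ K' ∈ cells,
    hull K ∩ hull K' = convexHull ℝ ((K : Set (SpaceTime d)) ∩ (K' : Set (SpaceTime d)))
  neumann : Finset (Finset (SpaceTime d))
  neumann_subset : ∀ S ∈ neumann, ∃ K ∈ cells, S ∈ lateralFacets K ∧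
    ∀ K' ∈ cells, S ⊆ K' → K' = K

namespace SlabMesh

variable {d : ℕ}

/-- `S` is a facet in `𝓕_B`: a facet with `|n_t| ≠ 1` belonging to exactly one cell, `K`. -/
def IsBoundaryFacet (M : SlabMesh d) (K S : Finset (SpaceTime d)) : Prop :=
  K ∈ M.cells ∧ S ∈ lateralFacets K ∧ ∀ K' ∈ M.cells, S ⊆ K' → K' = K

/-- The mesh triangulates the closed space-time slab between the times `t₀` and `t₁` of the
time-dependent domain `Ω`; facets with `|n_t| = 1` occur on the bottom and the top only. -/
structure Triangulates (M : SlabMesh d) (Ω : ℝ → Set (Space d)) (t₀ t₁ : ℝ) : Prop where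
  cover : ⋃ K ∈ M.cells, hull K =
    {y : SpaceTime d | y 0 ∈ Set.Icc t₀ t₁ ∧ spacePart y ∈ closure (Ω (y 0))}
  horizontal : ∀ K ∈ M.cells, ∀ S ∈ allFacets K, |normalT K S| = 1 →
    (∀ y ∈ S, y 0 = t₀) ∨ (∀ y ∈ S, y 0 = t₁)

/-- Shape regularity with constant `σ`: every cell contains a ball whose radius is at least
`1 / σ` times the diameter of the cell. -/
def ShapeRegular (M : SlabMesh d) (σ : ℝ) : Prop :=
  ∀ K ∈ M.cells, ∃ (c : SpaceTime d) (r : ℝ), 0 < r ∧ Metric.closedBall c r ⊆ hull K ∧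
    cellSize K ≤ σ * r

end SlabMesh

/-- A time-dependent polyhedral domain `Ω(t)`, `0 ≤ t ≤ T`, time levels
`0 = t^0 < t^1 < ⋯ < t^N = T`, and a triangulation of each space-time slab. Meshes of different
slabs are not required to match. -/
structure SpaceTimeMesh (d : ℕ) where
  T : ℝ
  Ω : ℝ → Set (Space d)
  polyhedral : ∀ t ∈ Set.Icc 0 T, IsPolyhedralDomain (Ω t)
  N : ℕ
  N_pos : 0 < N
  level : ℕ → ℝ
  level_zero : level 0 = 0
  level_last : level N = T
  level_lt : ∀ n < N, level n < level (n + 1)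
  slab : ℕ → SlabMesh d
  triangulates : ∀ n < N, (slab n).Triangulates Ω (level n) (level (n + 1))

/-! ### Finite element spaces

A function on the mesh is given by its restrictions to the cells and to the facets with
`|n_t| ≠ 1`; polynomials on a cell or on a facet are represented by polynomials on all of
space-time. The values at indices other than cells and facets of the mesh are irrelevant. -/

/-- Polynomial functions on space-time of total degree at most `l`. -/
def IsPolyFun {d : ℕ} (l : ℕ) (q : SpaceTime d → ℝ) : Prop :=
  ∃ P : MvPolynomial (Fin (d + 1)) ℝ, P.totalDegree ≤ l ∧
    ∀ y, q y = MvPolynomial.eval (fun i => y i) P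

/-- Vector-valued polynomial functions of total degree at most `l`. -/
def IsVecPoly {d : ℕ} (l : ℕ) (v : SpaceTime d → Space d) : Prop :=
  ∀ i, IsPolyFun l (fun y => v y i)

/-- A pair `(v_h, v̄_h)`. -/
structure VelocityPair (d : ℕ) where
  cell : Finset (SpaceTime d) → SpaceTime d → Space d
  facet : Finset (SpaceTime d) → SpaceTime d → Space d

/-- A pair `(q_h, q̄_h)`. -/
structure PressurePair (d : ℕ) where
  cell : Finset (SpaceTime d) → SpaceTime d → ℝ
  facet : Finset (SpaceTime d) → SpaceTime d → ℝ

namespace SlabMesh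

variable {d : ℕ}

/-- `V_h^⋆ = V_h × V̄_h`; the facet functions vanish on the Dirichlet part of the boundary. -/
structure MemV (M : SlabMesh d) (k : ℕ) (v : VelocityPair d) : Prop where
  cell : ∀ K ∈ M.cells, IsVecPoly k (v.cell K)
  facet : ∀ K ∈ M.cells, ∀ S ∈ lateralFacets K, IsVecPoly k (v.facet S)
  dirichlet : ∀ K S, M.IsBoundaryFacet K S → S ∉ M.neumann → ∀ y ∈ hull S, v.facet S y = 0

/-- `Q_h^⋆ = Q_h × Q̄_h`. -/
structure MemQ (M : SlabMesh d) (k : ℕ) (q : PressurePair d) : Prop where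
  cell : ∀ K ∈ M.cells, IsPolyFun (k - 1) (q.cell K)
  facet : ∀ K ∈ M.cells, ∀ S ∈ lateralFacets K, IsPolyFun k (q.facet S)

end SlabMesh

/-! ### Differential operators -/

/-- `∂_t v`. -/
def timeDeriv {d : ℕ} (v : SpaceTime d → Space d) (y : SpaceTime d) : Space d :=
  fderiv ℝ v y (stPoint 1 0)

/-- The spatial directional derivative `(ξ · ∇) v`. -/
def spaceDeriv {d : ℕ} (v : SpaceTime d → Space d) (y : SpaceTime d) (ξ : Space d) : Space d :=
  fderiv ℝ v y (stPoint 0 ξ)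

/-- `∇u : ∇v`, with spatial gradients. -/
def gradDot {d : ℕ} (u v : SpaceTime d → Space d) (y : SpaceTime d) : ℝ :=
  ∑ j : Fin d, inner ℝ (spaceDeriv u y (EuclideanSpace.single j 1))
    (spaceDeriv v y (EuclideanSpace.single j 1))

/-- `∇ · v`, the spatial divergence. -/
def spaceDiv {d : ℕ} (v : SpaceTime d → Space d) (y : SpaceTime d) : ℝ :=
  ∑ j : Fin d, spaceDeriv v y (EuclideanSpace.single j 1) j

/-! ### The forms of the method -/

/-- The space-time upwind flux on `𝒬_K`, for the traces `u`, `ū` and `w` and the normal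
`(nt, n)`. -/
def upwindFlux {d : ℕ} (u ubar w : Space d) (nt : ℝ) (n : Space d) : Space d :=
  (nt + inner ℝ w n) • (u + (if nt + inner ℝ w n < 0 then (1 : ℝ) else 0) • (ubar - u))

namespace SlabMesh

variable {d : ℕ}

/-- The diffusive form `a_h(u, v)` with viscosity `ν` and penalty parameter `α`. -/
def aForm (M : SlabMesh d) (ν α : ℝ) (u v : VelocityPair d) : ℝ :=
  (∑ K ∈ M.cells, ∫ y in hull K, ν * gradDot (u.cell K) (v.cell K) y)
  + (∑ K ∈ M.cells, ∑ S ∈ lateralFacets K, ∫ y, ν * α / cellSize K *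
      inner ℝ (u.cell K y - u.facet S y) (v.cell K y - v.facet S y) ∂(facetMeasure S))
  - (∑ K ∈ M.cells, ∑ S ∈ lateralFacets K, ∫ y, ν *
      (inner ℝ (u.cell K y - u.facet S y) (spaceDeriv (v.cell K) y (normalX K S))
        + inner ℝ (spaceDeriv (u.cell K) y (normalX K S)) (v.cell K y - v.facet S y))
      ∂(facetMeasure S))

/-- The pressure-velocity form `b_h(p, v)`. -/
def bForm (M : SlabMesh d) (p : PressurePair d) (v : VelocityPair d) : ℝ :=
  -(∑ K ∈ M.cells, ∫ y in hull K, p.cell K y * spaceDiv (v.cell K) y)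
  + ∑ K ∈ M.cells, ∑ S ∈ lateralFacets K,
      ∫ y, inner ℝ (v.cell K y - v.facet S y) (normalX K S) * p.facet S y ∂(facetMeasure S)

open Classical in
/-- The convective form `t_h(u, w, v)` on a slab ending at time `t₁`. The outflow part of a Neumann
facet is the set of its points with `n_t + w̄ · n ≥ 0`. -/
def tForm (M : SlabMesh d) (t₁ : ℝ) (u w v : VelocityPair d) : ℝ :=
  -(∑ K ∈ M.cells, ∫ y in hull K,
      (inner ℝ (u.cell K y) (timeDeriv (v.cell K) y)
        + inner ℝ (u.cell K y) (spaceDeriv (v.cell K) y (w.cell K y))))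
  + (∑ K ∈ M.cells, ∫ x in cellSection K t₁,
      inner ℝ (u.cell K (stPoint t₁ x)) (v.cell K (stPoint t₁ x)))
  + (∑ K ∈ M.cells, ∑ S ∈ lateralFacets K, ∫ y,
      inner ℝ (upwindFlux (u.cell K y) (u.facet S y) (w.cell K y) (normalT K S) (normalX K S))
        (v.cell K y - v.facet S y) ∂(facetMeasure S))
  + ∑ K ∈ M.cells, ∑ S ∈ (lateralFacets K).filter (fun S => S ∈ M.neumann),
      ∫ y in {y | 0 ≤ normalT K S + inner ℝ (w.facet S y) (normalX K S)},
        (normalT K S + inner ℝ (w.facet S y) (normalX K S)) *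
          inner ℝ (u.facet S y) (v.facet S y) ∂(facetMeasure S)

/-- The right-hand side on a slab starting at time `t₀`, with forcing `f`, Neumann data `g` and
incoming velocity `um` at time `t₀`. -/
def rhsForm (M : SlabMesh d) (t₀ : ℝ) (f g : SpaceTime d → Space d) (um : Space d → Space d)
    (v : VelocityPair d) : ℝ :=
  (∑ K ∈ M.cells, ∫ y in hull K, inner ℝ (f y) (v.cell K y))
  - (∑ S ∈ M.neumann, ∫ y, inner ℝ (g y) (v.facet S y) ∂(facetMeasure S))
  + ∑ K ∈ M.cells, ∫ x in cellSection K t₀, inner ℝ (um x) (v.cell K (stPoint t₀ x))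

/-- `(u, p)` solves the Picard-linearised problem on the slab between `t₀` and `t₁`, with
convecting velocity `w`. -/
structure SolvesPicardStep (M : SlabMesh d) (k : ℕ) (ν α t₀ t₁ : ℝ) (f g : SpaceTime d → Space d)
    (um : Space d → Space d) (w u : VelocityPair d) (p : PressurePair d) : Prop where
  memV : M.MemV k u
  memQ : M.MemQ k p
  equation : ∀ v q, M.MemV k v → M.MemQ k q →
    M.tForm t₁ u w v + M.aForm ν α u v + M.bForm p v - M.bForm q u = M.rhsForm t₀ f g um v

/-- `u` is pointwise divergence-free on each cell, and `H(div)`-conforming: the normal component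
`u · n` is single-valued on interior facets and equals `ū · n` on boundary facets. -/
structure DivFreeConforming (M : SlabMesh d) (u : VelocityPair d) : Prop where
  divFree : ∀ K ∈ M.cells, ∀ y ∈ hull K, spaceDiv (u.cell K) y = 0
  interior : ∀ K ∈ M.cells, ∀ K' ∈ M.cells, K ≠ K' → ∀ S ∈ lateralFacets K,
    S ∈ lateralFacets K' → ∀ y ∈ hull S,
      inner ℝ (u.cell K y) (normalX K S) + inner ℝ (u.cell K' y) (normalX K' S) = 0
  boundary : ∀ K S, M.IsBoundaryFacet K S → ∀ y ∈ hull S,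
    inner ℝ (u.cell K y) (normalX K S) = inner ℝ (u.facet S y) (normalX K S)

open Classical in
/-- The piecewise polynomial velocity as a function on space-time. -/
def velocity (M : SlabMesh d) (u : VelocityPair d) (y : SpaceTime d) : Space d :=
  if h : ∃ K ∈ M.cells, y ∈ interior (hull K) then u.cell h.choose y else 0

/-- The trace `u_h^-(x) = lim_{ε → 0+} u_h(t - ε, x)` at the time level `t`. -/
def traceBelow (M : SlabMesh d) (t : ℝ) (u : VelocityPair d) (x : Space d) : Space d :=
  limUnder (𝓝[>] (0 : ℝ)) (fun ε => M.velocity u (stPoint (t - ε) x))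

end SlabMesh

/-! ### Time stepping with Picard iterations -/

namespace SpaceTimeMesh

variable {d : ℕ}

/-- The incoming velocity `u_h^-` at the time level `n`: the discrete initial datum if `n = 0`,
otherwise the trace of the final Picard iterate (the one with index `m (n-1)`) of the previous
slab. -/
def incoming (𝒯 : SpaceTimeMesh d) (u₀ : Space d → Space d) (m : ℕ → ℕ)
    (u : ℕ → ℕ → VelocityPair d) : ℕ → Space d → Space d
  | 0 => u₀
  | n + 1 => (𝒯.slab n).traceBelow (𝒯.level (n + 1)) (u n (m n))

/-- A run of the method: in slab `n`, starting from a guess `u n 0`, the Picard iterates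
`(u n i, p n i)`, `i = 1, …, m n`, have been computed; the last one is the discrete solution
there. -/
structure IsPicardRun (𝒯 : SpaceTimeMesh d) (k : ℕ) (ν α : ℝ) (f g : SpaceTime d → Space d)
    (u₀ : Space d → Space d) (m : ℕ → ℕ) (u : ℕ → ℕ → VelocityPair d)
    (p : ℕ → ℕ → PressurePair d) : Prop where
  pos : ∀ n < 𝒯.N, 0 < m n
  guess : ∀ n < 𝒯.N, (𝒯.slab n).MemV k (u n 0)
  step : ∀ n < 𝒯.N, ∀ i < m n,
    (𝒯.slab n).SolvesPicardStep k ν α (𝒯.level n) (𝒯.level (n + 1)) f g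
      (𝒯.incoming u₀ m u n) (u n i) (u n (i + 1)) (p n (i + 1))

/-- The kinetic energy integral `∫_{Ω(t)} |v|² dx` at the time level `n`. -/
def energy (𝒯 : SpaceTimeMesh d) (n : ℕ) (v : Space d → Space d) : ℝ :=
  ∫ x in 𝒯.Ω (𝒯.level n), ‖v x‖ ^ 2

end SpaceTimeMesh

end

/-!
Testing the scheme with the Picard iterate `u` and its pressure cancels the two pressure terms and
leaves `t_h(u, w, u) + a_h(u, u) = ∑_K ∫_{K^n} u⁻ · u`, where `w` is the previous iterate.

*Convective form.* If `w` is divergence-free, the divergence theorem for the space-time field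
`(1, w) |u|² / 2` turns the volume terms into facet terms (`IsCell.integral_convection`). On the
facets at the two ends of the slab they combine to half the energies there. On a facet in `𝒬_K`,
with `β = n_t + w · n`, the upwind flux yields `|β| |u - ū|² / 2 - β |ū|² / 2`. As `β` changes sign
between two neighbours, the last terms cancel on interior facets; they vanish on Dirichlet facets
and are controlled by the outflow term on Neumann facets (`facet_energy_nonneg`). So `t_h(u, w, u)`
is at least half the sum of the two energies (`tForm_self_ge`), and Young's inequality on the right
hand side finishes the estimate (`SolvesPicardStep.energy_le`), provided `a_h(u, u) ≥ 0`.

*Admissibility.* An iterate that solves the linearised problem satisfies `b_h(q, u) = 0` for all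
`q`. Its divergence and the jumps of its normal component are themselves admissible pressures, and
testing with them shows that they vanish (`SolvesPicardStep.divFreeConforming`).

*Coercivity.* `a_h(u, u) ≥ 0` for a large penalty follows from the discrete trace inequality
`h_K ∫_S g² ≤ C ∫_K g²` for polynomials (`IsCell.trace_inequality`).

*Analysis on a simplex.* Both the divergence theorem and the trace inequality come from Fubini's
theorem on the lines parallel to an edge of the simplex, in oblique coordinates based on a facet
(`integral_baryCell_eq_fibre`). Along an edge from `b j` to `b i` only the facets opposite to these
two vertices are crossed, and the fundamental theorem of calculus on each line gives the divergence
theorem in the direction of the edge; the edges span all directions. For the trace inequality, the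
line through the point `y` of the facet opposite to `b i` has a length proportional to the `j`-th
barycentric coordinate of `y`. A one-dimensional inequality on these lines, summed over `j`, gives
the result because the barycentric coordinates add up to one; the ratio of diameter and height is
bounded by shape regularity.

*Traces.* By convexity, almost every point of the section of a cell at an end of the slab is a limit
of interior points of this cell only. Hence the sections tile the domain up to null sets, and the
trace from below is the polynomial of the cell (`Triangulates.integral_traceBelow`).
-/

/-! ### Space-time coordinates and hyperplanes -/

section Coordinates

variable {d : ℕ}

@[simp] lemma stPoint_apply_zero (t : ℝ) (x : Space d) : stPoint t x 0 = t := rfl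

@[simp] lemma stPoint_apply_succ (t : ℝ) (x : Space d) (i : Fin d) :
    stPoint t x i.succ = x i := rfl

@[simp] lemma spacePart_apply (y : SpaceTime d) (i : Fin d) : spacePart y i = y i.succ := rfl

@[simp] lemma spacePart_stPoint (t : ℝ) (x : Space d) : spacePart (stPoint t x) = x := by
  ext i; simp

lemma stPoint_eta (y : SpaceTime d) : stPoint (y 0) (spacePart y) = y := by
  ext i
  refine Fin.cases ?_ (fun i => ?_) i <;> simp

lemma stPoint_add (s t : ℝ) (x z : Space d) :
    stPoint (s + t) (x + z) = stPoint s x + stPoint t z := by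
  ext i
  refine Fin.cases ?_ (fun i => ?_) i <;> simp

lemma stPoint_smul (c t : ℝ) (x : Space d) : stPoint (c * t) (c • x) = c • stPoint t x := by
  ext i
  refine Fin.cases ?_ (fun i => ?_) i <;> simp

lemma inner_stPoint (s t : ℝ) (x z : Space d) :
    inner ℝ (stPoint s x) (stPoint t z) = s * t + inner ℝ x z := by
  simp [PiLp.inner_apply, Fin.sum_univ_succ, mul_comm]

lemma inner_spaceTime (y z : SpaceTime d) :
    inner ℝ y z = y 0 * z 0 + inner ℝ (spacePart y) (spacePart z) := by
  rw [← stPoint_eta y, ← stPoint_eta z, inner_stPoint]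
  simp

lemma isometry_stPoint (t : ℝ) : Isometry (stPoint t : Space d → SpaceTime d) := by
  refine Isometry.of_dist_eq fun x z => ?_
  simp [EuclideanSpace.dist_eq, Fin.sum_univ_succ]

lemma measurePreserving_stPoint :
    MeasurePreserving (fun p : ℝ × Space d => stPoint p.1 p.2) := by
  have h1 := (volume_preserving_piFinSuccAbove (fun _ : Fin (d + 1) => ℝ) 0).symm
  have h2 := (EuclideanSpace.volume_preserving_symm_measurableEquiv_toLp (Fin (d + 1))).symm
  have h3 := (MeasurePreserving.id (volume : Measure ℝ)).prod
    (EuclideanSpace.volume_preserving_symm_measurableEquiv_toLp (Fin d))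
  have h4 := h2.comp (h1.comp h3)
  have h5 : (fun p : ℝ × Space d => stPoint p.1 p.2) =
    ⇑(MeasurableEquiv.toLp 2 (Fin (d + 1) → ℝ)).symm.symm ∘
      ⇑(MeasurableEquiv.piFinSuccAbove (fun x => ℝ) 0).symm ∘
        Prod.map id ⇑(MeasurableEquiv.toLp 2 (Fin d → ℝ)).symm := by
    funext p
    ext i
    refine Fin.cases ?_ (fun i => ?_) i <;>
    simp [stPoint, MeasurableEquiv.piFinSuccAbove, Fin.insertNthEquiv]
  rw [h5]
  exact h4

lemma continuous_stPoint : Continuous (fun p : ℝ × Space d => stPoint p.1 p.2) := by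
  unfold stPoint
  refine (PiLp.continuous_toLp 2 _).comp (continuous_pi fun i => ?_)
  refine Fin.cases ?_ (fun i => ?_) i
  · exact continuous_fst
  · simp only [Fin.cons_succ]; fun_prop

/-- Every unit vector is the image of the time direction under a linear isometry. -/
lemma exists_linearIsometryEquiv_timeDir (ν : SpaceTime d) (hν : ‖ν‖ = 1) :
    ∃ R : SpaceTime d ≃ₗᵢ[ℝ] SpaceTime d, R (stPoint 1 0) = ν := by
  refine ⟨(ℝ ∙ (stPoint 1 0 - ν))ᗮ.reflection, Submodule.reflection_sub ?_⟩
  rw [hν, ← sq_eq_sq₀ (norm_nonneg _) zero_le_one, ← real_inner_self_eq_norm_sq, inner_stPoint]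
  simp

/-- The hyperplane with unit normal `ν` and offset `c`. -/
def hyperplane (ν : SpaceTime d) (c : ℝ) : Set (SpaceTime d) := {y | inner ℝ ν y = c}

section Chart

variable {ν : SpaceTime d} {R : SpaceTime d ≃ₗᵢ[ℝ] SpaceTime d}

lemma range_chart (hR : R (stPoint 1 0) = ν) (c : ℝ) :
    Set.range (fun z : Space d => R (stPoint c z)) = hyperplane ν c := by
  ext y
  simp only [Set.mem_range, hyperplane, Set.mem_ofPred_eq]
  constructor
  · rintro ⟨z, rfl⟩
    rw [← hR, LinearIsometryEquiv.inner_map_map, inner_stPoint]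
    simp
  · intro h
    refine ⟨spacePart (R.symm y), ?_⟩
    have : (R.symm y) 0 = c := by
      have h1 : inner ℝ (R (stPoint 1 0)) (R (R.symm y)) = (R.symm y) 0 := by
        rw [LinearIsometryEquiv.inner_map_map, inner_spaceTime]
        simp
      rw [← h1, hR, R.apply_symm_apply, h]
    rw [← this, stPoint_eta, R.apply_symm_apply]

lemma isometry_chart (R : SpaceTime d ≃ₗᵢ[ℝ] SpaceTime d) (c : ℝ) :
    Isometry (fun z : Space d => R (stPoint c z)) :=
  R.isometry.comp (isometry_stPoint c)

lemma map_chart (hR : R (stPoint 1 0) = ν) (c : ℝ) :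
    (volume : Measure (Space d)).map (fun z : Space d => R (stPoint c z)) =
      (μHE[d] : Measure (SpaceTime d)).restrict (hyperplane ν c) := by
  rw [← range_chart hR, ← (isometry_chart R c).map_euclideanHausdorffMeasure,
    EuclideanSpace.euclideanHausdorffMeasure_eq_volume]

lemma lintegral_hyperplane (hR : R (stPoint 1 0) = ν) (c : ℝ) (F : SpaceTime d → ENNReal) :
    ∫⁻ y in hyperplane ν c, F y ∂μHE[d] = ∫⁻ z : Space d, F (R (stPoint c z)) := by
  rw [← map_chart hR]
  exact (isometry_chart R c).isClosedEmbedding.measurableEmbedding.lintegral_map F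

end Chart

lemma measure_hyperplane_inter_lt_top {ν : SpaceTime d} (hν : ‖ν‖ = 1) (c : ℝ)
    {A : Set (SpaceTime d)} (hA : IsCompact A) :
    (μHE[d] : Measure (SpaceTime d)).restrict (hyperplane ν c) A < ⊤ := by
  obtain ⟨R, hR⟩ := exists_linearIsometryEquiv_timeDir ν hν
  have he := (isometry_chart R c).isClosedEmbedding
  rw [← map_chart hR, he.measurableEmbedding.map_apply]
  exact (he.isCompact_preimage hA).measure_lt_top

lemma sFinite_hyperplane {ν : SpaceTime d} (hν : ‖ν‖ = 1) (c : ℝ) :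
    SFinite ((μHE[d] : Measure (SpaceTime d)).restrict (hyperplane ν c)) := by
  obtain ⟨R, hR⟩ := exists_linearIsometryEquiv_timeDir ν hν
  rw [← map_chart hR]
  infer_instance

/-- Fubini's theorem for the lines of direction `e` through the points of a hyperplane, which `e`
need not meet at a right angle. -/
lemma lintegral_eq_lintegral_hyperplane {ν : SpaceTime d} (hν : ‖ν‖ = 1) (c : ℝ)
    {e : SpaceTime d} (he : inner ℝ ν e ≠ 0) {g : SpaceTime d → ENNReal} (hg : Measurable g) :
    ∫⁻ y, g y = ENNReal.ofReal |inner ℝ ν e| *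
      ∫⁻ y in hyperplane ν c, (∫⁻ t : ℝ, g (y + t • e)) ∂μHE[d] := by
  obtain ⟨R, hR⟩ := exists_linearIsometryEquiv_timeDir ν hν
  set η : ℝ := inner ℝ ν e with hη
  set w : Space d := spacePart (R.symm e)
  have hRe : e = R (stPoint η w) := by
    have : (R.symm e) 0 = η := by
      have h1 : inner ℝ (R (stPoint 1 0)) (R (R.symm e)) = (R.symm e) 0 := by
        rw [LinearIsometryEquiv.inner_map_map, inner_spaceTime]
        simp
      rw [← h1, hR, R.apply_symm_apply]
    rw [← this, stPoint_eta, R.apply_symm_apply]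
  have hgm : Measurable fun p : ℝ × Space d => g (R (stPoint p.1 p.2)) :=
    hg.comp (R.continuous.comp continuous_stPoint).measurable
  have hL : ∫⁻ y, g y = ∫⁻ s : ℝ, ∫⁻ z : Space d, g (R (stPoint s z)) := by
    rw [← R.measurePreserving.lintegral_comp hg,
      ← measurePreserving_stPoint.lintegral_comp
        (f := fun y => g (R y)) (hg.comp R.continuous.measurable)]
    exact lintegral_prod _ hgm.aemeasurable
  have hstep (z : Space d) (t : ℝ) :
      R (stPoint c z) + t • e = R (stPoint (c + t * η) (z + t • w)) := by
    rw [hRe, stPoint_add, stPoint_smul, map_add, map_smul]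
  have hin : Measurable fun p : Space d × ℝ => g (R (stPoint c p.1) + p.2 • e) := by
    simp only [hstep]
    refine hg.comp (R.continuous.comp (continuous_stPoint.comp
      (f := fun p : Space d × ℝ => (c + p.2 * η, p.1 + p.2 • w)) ?_)).measurable
    fun_prop
  rw [lintegral_hyperplane hR, lintegral_lintegral_swap hin.aemeasurable, hL]
  simp only [hstep]
  have h2 (t : ℝ) : ∫⁻ z : Space d, g (R (stPoint (c + t * η) (z + t • w))) =
      ∫⁻ z : Space d, g (R (stPoint (c + t * η) z)) :=
    lintegral_add_right_eq_self (fun z => g (R (stPoint (c + t * η) z))) (t • w)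
  simp only [h2]
  set Φ : ℝ → ENNReal := fun s => ∫⁻ z : Space d, g (R (stPoint s z)) with hΦ
  have hΦm : Measurable Φ := hgm.lintegral_prod_right'
  have h3 : ∫⁻ t : ℝ, Φ (c + t * η) = ENNReal.ofReal |η⁻¹| * ∫⁻ s, Φ s := by
    have h4 : ∫⁻ t : ℝ, Φ (c + t * η) = ∫⁻ s, Φ (c + s) ∂(volume.map fun t : ℝ => t * η) := by
      rw [lintegral_map (by fun_prop) (by fun_prop)]
    rw [h4, Real.map_volume_mul_right he, lintegral_smul_measure,
      lintegral_add_left_eq_self Φ c, smul_eq_mul]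
  change _ = _ * ∫⁻ t : ℝ, Φ (c + t * η)
  rw [h3, ← mul_assoc, ← ENNReal.ofReal_mul (abs_nonneg _), ← abs_mul, mul_inv_cancel₀ he]
  simp

/-- Lebesgue measure in the oblique coordinates `(y, t) ↦ y + t e`, with `y` in a hyperplane. -/
lemma volume_eq_map_hyperplane_prod {ν : SpaceTime d} (hν : ‖ν‖ = 1) (c : ℝ)
    {e : SpaceTime d} (he : inner ℝ ν e ≠ 0) :
    (volume : Measure (SpaceTime d)) = ENNReal.ofReal |inner ℝ ν e| •
      ((((μHE[d] : Measure (SpaceTime d)).restrict (hyperplane ν c)).prod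
        (volume : Measure ℝ)).map fun p => p.1 + p.2 • e) := by
  have := sFinite_hyperplane hν c
  refine Measure.ext_of_lintegral _ fun g hg => ?_
  rw [lintegral_smul_measure, lintegral_map hg (by fun_prop), smul_eq_mul,
    lintegral_eq_lintegral_hyperplane hν c he hg, lintegral_prod]
  exact (hg.comp (by fun_prop : Measurable fun p : SpaceTime d × ℝ => p.1 + p.2 • e)).aemeasurable

lemma integral_eq_integral_hyperplane {ν : SpaceTime d} (hν : ‖ν‖ = 1) (c : ℝ)
    {e : SpaceTime d} (he : inner ℝ ν e ≠ 0) {g : SpaceTime d → ℝ} (hg : Integrable g) :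
    ∫ y, g y = |inner ℝ ν e| * ∫ y in hyperplane ν c, (∫ t : ℝ, g (y + t • e)) ∂μHE[d] := by
  have := sFinite_hyperplane hν c
  have hη : ENNReal.ofReal |inner ℝ ν e| ≠ 0 := by simpa using he
  have hm : Measurable fun p : SpaceTime d × ℝ => p.1 + p.2 • e := by fun_prop
  have hg' := hg
  rw [volume_eq_map_hyperplane_prod hν c he, integrable_smul_measure hη ENNReal.ofReal_ne_top,
    integrable_map_measure] at hg'
  · conv_lhs => rw [volume_eq_map_hyperplane_prod hν c he]
    rw [integral_smul_measure, integral_map hm.aemeasurable, integral_prod (fun p : SpaceTime d × ℝ => g (p.1 + p.2 • e)) hg',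
      ENNReal.toReal_ofReal (abs_nonneg _), smul_eq_mul]
    exact ((integrable_smul_measure hη ENNReal.ofReal_ne_top).1
      ((volume_eq_map_hyperplane_prod hν c he) ▸ hg)).aestronglyMeasurable
  · exact ((integrable_smul_measure hη ENNReal.ofReal_ne_top).1
      ((volume_eq_map_hyperplane_prod hν c he) ▸ hg)).aestronglyMeasurable
  · exact hm.aemeasurable

end Coordinates

/-! ### Barycentric coordinates, facets and the fibres of a simplex -/

section Simplex

set_option linter.unusedSectionVars false

variable {d : ℕ} {ι : Type*} [Fintype ι] (b : AffineBasis ι ℝ (SpaceTime d))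

/-- The gradient of the `i`-th barycentric coordinate. -/
noncomputable def baryGrad (i : ι) : SpaceTime d :=
  (InnerProductSpace.toDual ℝ (SpaceTime d)).symm (b.coord i).linear.toContinuousLinearMap

/-- The unit normal of the facet opposite to the vertex `i`, pointing out of the simplex. -/
noncomputable def baryNormal (i : ι) : SpaceTime d := -((‖baryGrad b i‖)⁻¹ • baryGrad b i)

/-- The closed simplex spanned by an affine basis. -/
noncomputable def baryCell : Set (SpaceTime d) := {y | ∀ j, 0 ≤ b.coord j y}

/-- The closed facet opposite to the vertex `i`. -/
noncomputable def baryFacet (i : ι) : Set (SpaceTime d) := {y | b.coord i y = 0 ∧ ∀ j, 0 ≤ b.coord j y}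

lemma inner_baryGrad (i : ι) (w : SpaceTime d) :
    inner ℝ (baryGrad b i) w = (b.coord i).linear w := by
  simp [baryGrad]

lemma coord_add (i : ι) (y w : SpaceTime d) :
    b.coord i (y + w) = b.coord i y + (b.coord i).linear w := by
  have := (b.coord i).map_vadd y w
  simp only [vadd_eq_add] at this
  rw [add_comm y w, this, add_comm]

lemma coord_linear_sub (i : ι) (y z : SpaceTime d) :
    (b.coord i).linear (y - z) = b.coord i y - b.coord i z := by
  simpa using (b.coord i).linearMap_vsub y z

lemma coord_edge [DecidableEq ι] (i j k : ι) (y : SpaceTime d) (t : ℝ) :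
    b.coord k (y + t • (b i - b j)) =
      b.coord k y + t * ((if k = i then 1 else 0) - (if k = j then 1 else 0)) := by
  rw [coord_add, map_smul, coord_linear_sub, b.coord_apply, b.coord_apply, smul_eq_mul]

@[fun_prop]
lemma continuous_coord (i : ι) : Continuous (b.coord i) :=
  continuous_barycentric_coord b i

lemma baryGrad_ne_zero [Nontrivial ι] (i : ι) : baryGrad b i ≠ 0 := by
  classical
  intro h
  obtain ⟨j, hj⟩ := exists_ne i
  have := inner_baryGrad b i (b i - b j)
  rw [h, coord_linear_sub, b.coord_apply_eq, b.coord_apply_ne hj.symm] at this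
  simp at this

lemma norm_baryGrad_pos [Nontrivial ι] (i : ι) : 0 < ‖baryGrad b i‖ :=
  norm_pos_iff.2 (baryGrad_ne_zero b i)

lemma norm_baryNormal [Nontrivial ι] (i : ι) : ‖baryNormal b i‖ = 1 := by
  rw [baryNormal, norm_neg, norm_smul, norm_inv, norm_norm,
    inv_mul_cancel₀ (norm_baryGrad_pos b i).ne']

lemma inner_baryNormal [Nontrivial ι] (i : ι) (w : SpaceTime d) :
    inner ℝ (baryNormal b i) w = -(‖baryGrad b i‖⁻¹ * (b.coord i).linear w) := by
  rw [baryNormal, inner_neg_left, inner_smul_left, inner_baryGrad]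
  simp

lemma hyperplane_baryNormal [Nontrivial ι] (i : ι) :
    hyperplane (baryNormal b i) (‖baryGrad b i‖⁻¹ * b.coord i 0) = {y | b.coord i y = 0} := by
  have hκ := norm_baryGrad_pos b i
  ext y
  have h := coord_add b i 0 y
  rw [zero_add] at h
  simp only [hyperplane, Set.mem_ofPred_eq, inner_baryNormal, h]
  rw [← mul_neg, mul_right_inj' (inv_ne_zero hκ.ne')]
  constructor <;> intro h <;> linarith

lemma baryCell_eq : baryCell b = convexHull ℝ (Set.range b) :=
  b.convexHull_eq_nonneg_coord.symm

lemma interior_baryCell : interior (baryCell b) = {y | ∀ j, 0 < b.coord j y} := by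
  rw [baryCell_eq, b.interior_convexHull]

lemma isCompact_baryCell : IsCompact (baryCell b) := by
  rw [baryCell_eq]; exact (Set.finite_range b).isCompact_convexHull ℝ

lemma isCompact_baryFacet (i : ι) : IsCompact (baryFacet b i) := by
  exact (isCompact_baryCell b).inter_left
    (isClosed_eq (f := b.coord i) (by fun_prop) continuous_const)

lemma baryFacet_subset (i : ι) : baryFacet b i ⊆ {y | b.coord i y = 0} := fun _ hy => hy.1

lemma coord_le_one (i : ι) {y : SpaceTime d} (hy : y ∈ baryCell b) : b.coord i y ≤ 1 := by
  rw [← b.sum_coord_apply_eq_one y]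
  exact Finset.single_le_sum (f := fun j => b.coord j y) (fun j _ => hy j) (Finset.mem_univ i)

lemma measure_baryFacet_lt_top [Nontrivial ι] (i : ι) :
    (μHE[d] : Measure (SpaceTime d)) (baryFacet b i) < ⊤ := by
  have h := measure_hyperplane_inter_lt_top (norm_baryNormal b i)
    (‖baryGrad b i‖⁻¹ * b.coord i 0) (isCompact_baryFacet b i)
  rwa [Measure.restrict_apply (isCompact_baryFacet b i).measurableSet, hyperplane_baryNormal,
    Set.inter_eq_left.2 (baryFacet_subset b i)] at h

lemma integrableOn_baryFacet [Nontrivial ι] (i : ι) {f : SpaceTime d → ℝ} (hf : Continuous f) :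
    IntegrableOn f (baryFacet b i) (μHE[d] : Measure (SpaceTime d)) := by
  obtain ⟨C, hC⟩ := (isCompact_baryFacet b i).exists_bound_of_continuousOn hf.continuousOn
  exact IntegrableOn.of_bound (measure_baryFacet_lt_top b i)
    hf.aestronglyMeasurable C
    (ae_restrict_of_forall_mem (isCompact_baryFacet b i).measurableSet hC)

variable [Nontrivial ι]

lemma abs_inner_edge {i j : ι} (hij : i ≠ j) :
    |inner ℝ (baryNormal b i) (b i - b j)| = ‖baryGrad b i‖⁻¹ := by
  rw [inner_baryNormal, coord_linear_sub, b.coord_apply_eq, b.coord_apply_ne hij, sub_zero,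
    mul_one, abs_neg, abs_of_pos (inv_pos.2 (norm_baryGrad_pos b i))]

lemma inner_edge_ne_zero {i j : ι} (hij : i ≠ j) :
    inner ℝ (baryNormal b i) (b i - b j) ≠ 0 := by
  rw [← abs_pos, abs_inner_edge b hij]
  exact inv_pos.2 (norm_baryGrad_pos b i)

/-- The lines parallel to the edge from `b j` to `b i` which start on the facet opposite to `b i`
leave the simplex after the time given by the `j`-th barycentric coordinate. -/
lemma integral_baryCell_eq_fibre {i j : ι} (hij : i ≠ j) {G : SpaceTime d → ℝ}
    (hG : Continuous G) :
    ∫ y in baryCell b, G y = ‖baryGrad b i‖⁻¹ *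
      ∫ y in baryFacet b i, (∫ t in (0 : ℝ)..b.coord j y, G (y + t • (b i - b j))) ∂μHE[d] := by
  classical
  have hT := (isCompact_baryCell b).measurableSet
  rw [← integral_indicator hT, integral_eq_integral_hyperplane (norm_baryNormal b i)
    (‖baryGrad b i‖⁻¹ * b.coord i 0) (inner_edge_ne_zero b hij), abs_inner_edge b hij,
    hyperplane_baryNormal]
  · congr 1
    have hF := (isCompact_baryFacet b i).measurableSet
    have hH : MeasurableSet {y | b.coord i y = 0} :=
      (isClosed_eq (by fun_prop) continuous_const).measurableSet
    rw [setIntegral_eq_of_subset_of_forall_sdiff_eq_zero hH (baryFacet_subset b i)]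
    · refine setIntegral_congr_fun hF fun y hy => ?_
      have hl : ∀ t : ℝ, (baryCell b).indicator G (y + t • (b i - b j)) =
          (Set.Icc 0 (b.coord j y)).indicator (fun t => G (y + t • (b i - b j))) t := by
        intro t
        have hiff : y + t • (b i - b j) ∈ baryCell b ↔ t ∈ Set.Icc 0 (b.coord j y) := by
          simp only [baryCell, Set.mem_ofPred_eq, coord_edge, Set.mem_Icc]
          constructor
          · intro h
            have h1 := h i
            have h2 := h j
            rw [hy.1] at h1
            simp only [hij, hij.symm, if_true, if_false] at h1 h2
            constructor <;> linarith
          · rintro ⟨h1, h2⟩ k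
            have := hy.2 k
            split_ifs with hk hk' hk'
            · simpa using this
            · linarith
            · subst hk'; linarith
            · simpa using this
        by_cases h : t ∈ Set.Icc 0 (b.coord j y)
        · rw [Set.indicator_of_mem h, Set.indicator_of_mem (hiff.2 h)]
        · rw [Set.indicator_of_notMem h, Set.indicator_of_notMem (mt hiff.1 h)]
      simp only [hl]
      rw [integral_indicator measurableSet_Icc, integral_Icc_eq_integral_Ioc,
        intervalIntegral.integral_of_le (hy.2 j)]
    · rintro y ⟨hy0, hy⟩
      have hy0 : b.coord i y = 0 := hy0
      have hz : ∀ t : ℝ, (baryCell b).indicator G (y + t • (b i - b j)) = 0 := by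
        intro t
        refine Set.indicator_of_notMem (fun h => hy ⟨hy0, fun k => ?_⟩) _
        have hk := h k
        have hi := h i
        rw [coord_edge] at hk hi
        simp only [hij, if_true, if_false, hy0] at hi
        split_ifs at hk with h1 h2 h2
        · simpa using hk
        · subst h1; linarith
        · linarith
        · simpa using hk
      simp [hz]
  · exact (hG.continuousOn.integrableOn_compact (isCompact_baryCell b)).integrable_indicator hT

lemma coord_proj_edge [DecidableEq ι] {i j : ι} (hij : i ≠ j) {y : SpaceTime d}
    (hy : b.coord i y = 0) (k : ι) :
    b.coord k (y + b.coord j y • (b i - b j)) = b.coord (Equiv.swap i j k) y := by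
  rw [coord_edge]
  rcases eq_or_ne k i with rfl | hki
  · simp [hij, hy]
  rcases eq_or_ne k j with rfl | hkj
  · simp [hij.symm, hy]
  · simp [Equiv.swap_apply_of_ne_of_ne hki hkj, hki, hkj]

/-- The lines parallel to an edge meet the hyperplanes of the two facets opposite to its ends in
points which correspond to each other with constant Jacobian. Both sides are the integral over
the strip between two translates of the first hyperplane of the function that is constant on
these lines. -/
lemma lintegral_hyperplane_edge {i j : ι} (hij : i ≠ j) {F : SpaceTime d → ENNReal}
    (hF : Measurable F) :
    ENNReal.ofReal ‖baryGrad b i‖⁻¹ *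
      ∫⁻ y in {y | b.coord i y = 0}, F (y + b.coord j y • (b i - b j)) ∂μHE[d] =
    ENNReal.ofReal ‖baryGrad b j‖⁻¹ * ∫⁻ y in {y | b.coord j y = 0}, F y ∂μHE[d] := by
  classical
  set g : SpaceTime d → ENNReal := fun y =>
    {y | b.coord i y ∈ Set.Icc (0 : ℝ) 1}.indicator
      (fun y => F (y + b.coord j y • (b i - b j))) y with hg
  have hgm : Measurable g := by
    refine Measurable.indicator (hF.comp ?_) ?_
    · exact Continuous.measurable (by fun_prop)
    · exact measurableSet_Icc.preimage (continuous_coord b i).measurable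
  have h1 := lintegral_eq_lintegral_hyperplane (norm_baryNormal b i)
    (‖baryGrad b i‖⁻¹ * b.coord i 0) (inner_edge_ne_zero b hij) hgm
  have hneg : |inner ℝ (baryNormal b j) (b i - b j)| = ‖baryGrad b j‖⁻¹ := by
    rw [← neg_sub, inner_neg_right, abs_neg, abs_inner_edge b hij.symm]
  have hne : inner ℝ (baryNormal b j) (b i - b j) ≠ 0 := by
    rw [← abs_pos, hneg]
    exact inv_pos.2 (norm_baryGrad_pos b j)
  have h2 := lintegral_eq_lintegral_hyperplane (norm_baryNormal b j)
    (‖baryGrad b j‖⁻¹ * b.coord j 0) hne hgm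
  rw [abs_inner_edge b hij, hyperplane_baryNormal] at h1
  rw [hneg, hyperplane_baryNormal] at h2
  have hH (k : ι) : MeasurableSet {y | b.coord k y = 0} :=
    (isClosed_eq (f := b.coord k) (by fun_prop) continuous_const).measurableSet
  have e1 : ∀ y ∈ {y | b.coord i y = 0}, ∫⁻ t : ℝ, g (y + t • (b i - b j)) =
      F (y + b.coord j y • (b i - b j)) := by
    intro y hy
    have hy : b.coord i y = 0 := hy
    have : ∀ t : ℝ, g (y + t • (b i - b j)) = (Set.Icc (0 : ℝ) 1).indicator
        (fun _ => F (y + b.coord j y • (b i - b j))) t := by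
      intro t
      have hc : b.coord i (y + t • (b i - b j)) = t := by
        rw [coord_edge, hy]; simp [hij]
      have hc' : b.coord j (y + t • (b i - b j)) = b.coord j y - t := by
        rw [coord_edge]; simp [hij.symm, sub_eq_add_neg]
      by_cases ht : t ∈ Set.Icc (0 : ℝ) 1
      · rw [Set.indicator_of_mem ht, hg]
        simp only
        rw [Set.indicator_of_mem (by simpa only [Set.mem_ofPred_eq, hc] using ht), hc',
          add_assoc, ← add_smul]
        congr 3
        ring
      · rw [Set.indicator_of_notMem ht, hg]
        simp only
        rw [Set.indicator_of_notMem (by simpa only [Set.mem_ofPred_eq, hc] using ht)]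
    simp only [this]
    rw [lintegral_indicator measurableSet_Icc]
    simp
  have e2 : ∀ y ∈ {y | b.coord j y = 0}, ∫⁻ t : ℝ, g (y + t • (b i - b j)) = F y := by
    intro y hy
    have hy : b.coord j y = 0 := hy
    have : ∀ t : ℝ, g (y + t • (b i - b j)) =
        (Set.Icc (-b.coord i y) (1 - b.coord i y)).indicator (fun _ => F y) t := by
      intro t
      have hc : b.coord i (y + t • (b i - b j)) = b.coord i y + t := by
        rw [coord_edge]; simp [hij]
      have hc' : b.coord j (y + t • (b i - b j)) = - t := by
        rw [coord_edge, hy]; simp [hij.symm]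
      have hiff : y + t • (b i - b j) ∈ {y | b.coord i y ∈ Set.Icc (0 : ℝ) 1} ↔
          t ∈ Set.Icc (-b.coord i y) (1 - b.coord i y) := by
        simp only [Set.mem_ofPred_eq, hc, Set.mem_Icc]
        constructor <;> rintro ⟨h1, h2⟩ <;> constructor <;> linarith
      by_cases ht : t ∈ Set.Icc (-b.coord i y) (1 - b.coord i y)
      · rw [Set.indicator_of_mem ht, hg]
        simp only
        rw [Set.indicator_of_mem (hiff.2 ht), hc', add_assoc, ← add_smul]
        simp
      · rw [Set.indicator_of_notMem ht, hg]
        simp only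
        rw [Set.indicator_of_notMem (mt hiff.1 ht)]
    simp only [this]
    rw [lintegral_indicator measurableSet_Icc]
    simp
  rw [setLIntegral_congr_fun (hH i) e1] at h1
  rw [setLIntegral_congr_fun (hH j) e2] at h2
  rw [← h1, ← h2]

/-- Projection along the edge from `b i` to `b j`, from the facet opposite to `b i` to the facet
opposite to `b j`: the surface integrals correspond up to the ratio of the heights. -/
lemma integral_facet_edge {i j : ι} (hij : i ≠ j) {f : SpaceTime d → ℝ} (hf : Continuous f) :
    ‖baryGrad b i‖⁻¹ * ∫ y in baryFacet b i, f (y + b.coord j y • (b i - b j)) ∂μHE[d] =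
      ‖baryGrad b j‖⁻¹ * ∫ y in baryFacet b j, f y ∂μHE[d] := by
  classical
  set π : SpaceTime d → SpaceTime d := fun y => y + b.coord j y • (b i - b j) with hπ
  have hπc : Continuous π := by fun_prop
  have key : ENNReal.ofReal ‖baryGrad b i‖⁻¹ •
      ((μHE[d] : Measure (SpaceTime d)).restrict (baryFacet b i)).map π =
      ENNReal.ofReal ‖baryGrad b j‖⁻¹ •
        (μHE[d] : Measure (SpaceTime d)).restrict (baryFacet b j) := by
    refine Measure.ext fun A hA => ?_
    have hj := (isCompact_baryFacet b j).measurableSet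
    have hi := (isCompact_baryFacet b i).measurableSet
    have h := lintegral_hyperplane_edge b hij
      (F := (A ∩ baryFacet b j).indicator 1) (measurable_one.indicator (hA.inter hj))
    rw [Measure.smul_apply, Measure.smul_apply, Measure.map_apply hπc.measurable hA,
      Measure.restrict_apply (hπc.measurable hA), Measure.restrict_apply hA,
      smul_eq_mul, smul_eq_mul]
    have hcomp : (fun y => (A ∩ baryFacet b j).indicator (1 : SpaceTime d → ENNReal) (π y)) =
        (π ⁻¹' (A ∩ baryFacet b j)).indicator 1 := rfl
    rw [hcomp, lintegral_indicator_one (hπc.measurable (hA.inter hj)),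
      lintegral_indicator_one (hA.inter hj),
      Measure.restrict_apply (hπc.measurable (hA.inter hj)),
      Measure.restrict_apply (hA.inter hj)] at h
    have hs : π ⁻¹' (A ∩ baryFacet b j) ∩ {y | b.coord i y = 0} = π ⁻¹' A ∩ baryFacet b i := by
      ext y
      simp only [Set.mem_inter_iff, Set.mem_preimage, Set.mem_ofPred_eq, baryFacet, and_assoc]
      refine and_congr_right fun _ => ?_
      constructor
      · rintro ⟨h1, h2, h3⟩
        refine ⟨h3, fun k => ?_⟩
        have := h2 (Equiv.swap i j k)
        rwa [hπ, coord_proj_edge b hij h3, Equiv.swap_apply_self] at this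
      · rintro ⟨h3, h2⟩
        refine ⟨?_, fun k => ?_, h3⟩
        · rw [hπ, coord_proj_edge b hij h3, Equiv.swap_apply_right, h3]
        · rw [hπ, coord_proj_edge b hij h3]
          exact h2 _
    rw [hs] at h
    rw [h, Set.inter_assoc, Set.inter_eq_left.2 (baryFacet_subset b j)]
  have h := congrArg (fun μ : Measure (SpaceTime d) => ∫ y, f y ∂μ) key
  simp only [integral_smul_measure] at h
  rw [integral_map hπc.aemeasurable hf.aestronglyMeasurable,
    ENNReal.toReal_ofReal (inv_nonneg.2 (norm_nonneg _)),
    ENNReal.toReal_ofReal (inv_nonneg.2 (norm_nonneg _))] at h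
  exact h

end Simplex

/-! ### The divergence theorem on a simplex -/

section Divergence

set_option linter.unusedSectionVars false

variable {d : ℕ} {ι : Type*} [Fintype ι] (b : AffineBasis ι ℝ (SpaceTime d)) [Nontrivial ι]

lemma integral_fderiv_edge {i j : ι} (hij : i ≠ j) {f : SpaceTime d → ℝ} (hf : ContDiff ℝ 1 f) :
    ∫ y in baryCell b, fderiv ℝ f y (b i - b j) =
      ‖baryGrad b j‖⁻¹ * ∫ y in baryFacet b j, f y ∂μHE[d] -
        ‖baryGrad b i‖⁻¹ * ∫ y in baryFacet b i, f y ∂μHE[d] := by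
  have hc : Continuous fun y => fderiv ℝ f y (b i - b j) :=
    (hf.continuous_fderiv one_ne_zero).clm_apply continuous_const
  rw [integral_baryCell_eq_fibre b hij hc, ← integral_facet_edge b hij hf.continuous, ← mul_sub,
    ← integral_sub]
  · congr 1
    refine integral_congr_ae (Eventually.of_forall fun y => ?_)
    have hd (t : ℝ) : HasDerivAt (fun t : ℝ => f (y + t • (b i - b j)))
        (fderiv ℝ f (y + t • (b i - b j)) (b i - b j)) t := by
      have h1 : HasDerivAt (fun t : ℝ => y + t • (b i - b j)) (b i - b j) t := by
        simpa using ((hasDerivAt_id t).smul_const (b i - b j)).const_add y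
      exact ((hf.differentiable one_ne_zero _).hasFDerivAt).comp_hasDerivAt t h1
    simp only
    rw [intervalIntegral.integral_eq_sub_of_hasDerivAt (fun t _ => hd t)]
    · simp
    · exact (hc.comp (by fun_prop : Continuous fun t : ℝ =>
        y + t • (b i - b j))).intervalIntegrable _ _
  · exact integrableOn_baryFacet b i (hf.continuous.comp (by fun_prop))
  · exact integrableOn_baryFacet b i hf.continuous

lemma sum_coord_linear (w : SpaceTime d) : ∑ i, (b.coord i).linear w = 0 := by
  have h1 := b.sum_coord_apply_eq_one (0 + w)
  simp only [coord_add, Finset.sum_add_distrib, b.sum_coord_apply_eq_one] at h1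
  linarith

lemma sum_coord_linear_smul_edge (j : ι) (w : SpaceTime d) :
    ∑ i, (b.coord i).linear w • (b i - b j) = w := by
  have h2 := b.linear_combination_coord_eq_self (0 : SpaceTime d)
  have h1 : ∑ i, (b.coord i).linear w • b i = w := by
    have h := b.linear_combination_coord_eq_self (0 + w)
    simp only [coord_add] at h
    simpa only [add_smul, Finset.sum_add_distrib, h2, zero_add] using h
  simp only [smul_sub, Finset.sum_sub_distrib, h1, ← Finset.sum_smul, sum_coord_linear]
  simp

/-- The divergence theorem on a simplex for the field `f w` with a constant vector `w`. -/
theorem integral_fderiv_baryCell {f : SpaceTime d → ℝ} (hf : ContDiff ℝ 1 f) (w : SpaceTime d) :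
    ∫ y in baryCell b, fderiv ℝ f y w =
      ∑ k, inner ℝ (baryNormal b k) w * ∫ y in baryFacet b k, f y ∂μHE[d] := by
  classical
  obtain ⟨j⟩ : Nonempty ι := inferInstance
  have hedge (i : ι) : ∫ y in baryCell b, fderiv ℝ f y (b i - b j) =
      ∑ k, inner ℝ (baryNormal b k) (b i - b j) * ∫ y in baryFacet b k, f y ∂μHE[d] := by
    rcases eq_or_ne i j with rfl | hij
    · simp
    rw [integral_fderiv_edge b hij hf]
    have : ∀ k, inner ℝ (baryNormal b k) (b i - b j) * ∫ y in baryFacet b k, f y ∂μHE[d] =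
        (if k = j then ‖baryGrad b k‖⁻¹ * ∫ y in baryFacet b k, f y ∂μHE[d] else 0) -
        (if k = i then ‖baryGrad b k‖⁻¹ * ∫ y in baryFacet b k, f y ∂μHE[d] else 0) := by
      intro k
      rw [inner_baryNormal, coord_linear_sub, b.coord_apply, b.coord_apply]
      split_ifs <;> ring
    simp only [this, Finset.sum_sub_distrib, Finset.sum_ite_eq', Finset.mem_univ, if_true]
  have hint (v : SpaceTime d) : IntegrableOn (fun y => fderiv ℝ f y v) (baryCell b) :=
    ((hf.continuous_fderiv one_ne_zero).clm_apply continuous_const).continuousOn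
      |>.integrableOn_compact (isCompact_baryCell b)
  have hw := sum_coord_linear_smul_edge b j w
  conv_lhs => rw [← hw]
  simp only [map_sum, map_smul, smul_eq_mul]
  rw [integral_finsetSum _ fun i _ => (hint _).const_mul _]
  simp only [integral_const_mul, hedge, Finset.mul_sum]
  rw [Finset.sum_comm]
  refine Finset.sum_congr rfl fun k _ => ?_
  conv_rhs => rw [← hw]
  rw [inner_sum, Finset.sum_mul]
  refine Finset.sum_congr rfl fun i _ => ?_
  rw [inner_smul_right]
  ring

end Divergence

/-! ### The discrete trace inequality -/

section Trace

/-- The value of a polynomial at an end of the unit interval is controlled by its `L²` norm: by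
vanishing finite differences, `p 0` is a fixed linear combination of `p (t), …, p ((k + 1) t)`
for every `t`. -/
lemma exists_sq_eval_zero_le (k : ℕ) : ∃ C : ℝ, 0 < C ∧ ∀ p : Polynomial ℝ, p.natDegree ≤ k →
    p.eval 0 ^ 2 ≤ C * ∫ t in (0 : ℝ)..1, p.eval t ^ 2 := by
  set c : ℕ → ℝ := fun i => (-1) ^ (k + 1 - (i + 1)) * ((k + 1).choose (i + 1)) with hc
  set A : ℝ := ∑ i ∈ Finset.range (k + 1), c i ^ 2 with hA
  have hA0 : 0 ≤ A := Finset.sum_nonneg fun i _ => sq_nonneg _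
  refine ⟨(A + 1) * (k + 1) ^ 2, by positivity, fun p hp => ?_⟩
  set I : ℝ := ∫ t in (0 : ℝ)..1, p.eval t ^ 2 with hI
  have hI0 : 0 ≤ I := intervalIntegral.integral_nonneg zero_le_one fun t _ => sq_nonneg _
  have hrep (t : ℝ) : (-1) ^ (k + 1) * p.eval 0 =
      - ∑ i ∈ Finset.range (k + 1), c i * p.eval ((i + 1) * t) := by
    have h1 : (p.comp (Polynomial.C t * Polynomial.X)).natDegree < k + 1 := by
      refine lt_of_le_of_lt (Polynomial.natDegree_comp_le) ?_
      have : (Polynomial.C t * Polynomial.X).natDegree ≤ 1 :=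
        (Polynomial.natDegree_C_mul_le _ _).trans Polynomial.natDegree_X_le
      nlinarith
    have h2 := congrFun (Polynomial.fwdDiff_iter_eq_zero_of_degree_lt h1) 0
    rw [fwdDiff_iter_eq_sum_shift, Finset.sum_range_succ'] at h2
    simp only [Polynomial.eval_comp, zsmul_eq_mul] at h2
    push_cast at h2
    simp at h2
    rw [eq_neg_iff_add_eq_zero, add_comm]
    refine Eq.trans ?_ h2
    congr 1
    refine Finset.sum_congr rfl fun i _ => ?_
    rw [hc]
    simp [mul_comm]
  have hpt (t : ℝ) : p.eval 0 ^ 2 ≤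
      A * ∑ i ∈ Finset.range (k + 1), p.eval ((i + 1) * t) ^ 2 := by
    have h1 : p.eval 0 ^ 2 = (∑ i ∈ Finset.range (k + 1), c i * p.eval ((i + 1) * t)) ^ 2 := by
      rw [← neg_sq (∑ i ∈ Finset.range (k + 1), _), ← hrep t, mul_pow, ← pow_mul, mul_comm (k + 1),
        pow_mul]
      simp
    rw [h1]
    exact Finset.sum_mul_sq_le_sq_mul_sq _ _ _
  have hcont : Continuous fun t : ℝ => p.eval t ^ 2 := by fun_prop
  set δ : ℝ := ((k : ℝ) + 1)⁻¹ with hδ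
  have hδ0 : 0 < δ := by positivity
  have hscale (i : ℕ) (hi : i ∈ Finset.range (k + 1)) :
      ∫ t in (0 : ℝ)..δ, p.eval ((i + 1) * t) ^ 2 ≤ I := by
    have hi' : ((i : ℝ) + 1) ≤ k + 1 := by
      have := Finset.mem_range.1 hi
      exact_mod_cast this
    rw [intervalIntegral.integral_comp_mul_left (fun t => p.eval t ^ 2) (by positivity), mul_zero,
      smul_eq_mul]
    have h1 : ∫ t in (0 : ℝ)..(i + 1) * δ, p.eval t ^ 2 ≤ I := by
      refine intervalIntegral.integral_mono_interval le_rfl (by positivity) ?_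
        (Eventually.of_forall fun t => sq_nonneg _) (hcont.intervalIntegrable _ _)
      rw [hδ, ← div_eq_mul_inv, div_le_one (by positivity)]
      exact hi'
    have h0 : 0 ≤ ∫ t in (0 : ℝ)..(i + 1) * δ, p.eval t ^ 2 :=
      intervalIntegral.integral_nonneg (by positivity) fun t _ => sq_nonneg _
    calc _ ≤ 1 * ∫ t in (0 : ℝ)..(i + 1) * δ, p.eval t ^ 2 := by
          refine mul_le_mul_of_nonneg_right ?_ h0
          exact inv_le_one_of_one_le₀ (by linarith [Nat.cast_nonneg (α := ℝ) i])
      _ ≤ I := by rw [one_mul]; exact h1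
  have hint := intervalIntegral.integral_mono_on (μ := volume) (a := 0) (b := δ) hδ0.le
    (f := fun _ => p.eval 0 ^ 2)
    (g := fun t => A * ∑ i ∈ Finset.range (k + 1), p.eval ((i + 1) * t) ^ 2)
    (by simp) (Continuous.intervalIntegrable (by fun_prop) _ _) fun t _ => hpt t
  rw [intervalIntegral.integral_const, intervalIntegral.integral_const_mul,
    intervalIntegral.integral_finsetSum
      (fun i _ => Continuous.intervalIntegrable (by fun_prop) _ _)] at hint
  have hsum : ∑ i ∈ Finset.range (k + 1), ∫ t in (0 : ℝ)..δ, p.eval ((i + 1) * t) ^ 2 ≤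
      (k + 1) * I := by
    refine (Finset.sum_le_sum hscale).trans ?_
    simp
  have h3 : δ * p.eval 0 ^ 2 ≤ A * ((k + 1) * I) := by
    have := mul_le_mul_of_nonneg_left hsum hA0
    simp only [sub_zero, smul_eq_mul] at hint
    linarith
  have h4 : p.eval 0 ^ 2 = (k + 1) * (δ * p.eval 0 ^ 2) := by
    rw [hδ]; field_simp
  rw [h4]
  calc _ ≤ ((k : ℝ) + 1) * (A * ((k + 1) * I)) := mul_le_mul_of_nonneg_left h3 (by positivity)
    _ ≤ (A + 1) * (k + 1) ^ 2 * I := by nlinarith [mul_nonneg (sq_nonneg ((k : ℝ) + 1)) hI0]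

variable {d : ℕ} {ι : Type*} [Fintype ι] (b : AffineBasis ι ℝ (SpaceTime d)) [Nontrivial ι]

/-- The discrete trace inequality on a simplex, up to the factor `‖baryGrad b i‖`, the inverse of
the height over the facet. The one-dimensional inequality on the fibre through `y` in the direction
of the `j`-th vertex gives the weight `b.coord j y`, and these weights add up to one. -/
lemma trace_inequality {k : ℕ} {C : ℝ} (hC0 : 0 < C)
    (hC : ∀ p : Polynomial ℝ, p.natDegree ≤ k →
      p.eval 0 ^ 2 ≤ C * ∫ t in (0 : ℝ)..1, p.eval t ^ 2)
    {g : SpaceTime d → ℝ} (hg : Continuous g)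
    (hpoly : ∀ y e, ∃ p : Polynomial ℝ, p.natDegree ≤ k ∧ ∀ t : ℝ, g (y + t • e) = p.eval t)
    (i : ι) :
    ∫ y in baryFacet b i, g y ^ 2 ∂μHE[d] ≤
      C * Fintype.card ι * ‖baryGrad b i‖ * ∫ y in baryCell b, g y ^ 2 := by
  classical
  have hκ := norm_baryGrad_pos b i
  have hF := (isCompact_baryFacet b i).measurableSet
  set I : ℝ := ∫ y in baryCell b, g y ^ 2 with hI
  have hI0 : 0 ≤ I := integral_nonneg fun y => sq_nonneg _
  have hg2 : Continuous fun y => g y ^ 2 := hg.pow 2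
  have hcoord (j : ι) : ∫ y in baryFacet b i, b.coord j y * g y ^ 2 ∂μHE[d] ≤
      C * ‖baryGrad b i‖ * I := by
    rcases eq_or_ne i j with rfl | hij
    · rw [setIntegral_congr_fun (g := fun _ => (0 : ℝ)) hF fun y hy => by
        simp only; rw [hy.1, zero_mul]]
      simp only [integral_zero]
      positivity
    have hfib := integral_baryCell_eq_fibre b hij hg2
    have hpt : ∀ y ∈ baryFacet b i, b.coord j y * g y ^ 2 ≤
        C * ∫ t in (0 : ℝ)..b.coord j y, g (y + t • (b i - b j)) ^ 2 := by
      intro y hy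
      set s := b.coord j y with hs
      have hs0 : 0 ≤ s := hy.2 j
      obtain ⟨p, hp, hpe⟩ := hpoly y (s • (b i - b j))
      have h1 := hC p hp
      have h0 : p.eval 0 = g y := by rw [← hpe]; simp
      have h2 : s * ∫ t in (0 : ℝ)..1, p.eval t ^ 2 =
          ∫ t in (0 : ℝ)..s, g (y + t • (b i - b j)) ^ 2 := by
        have := intervalIntegral.smul_integral_comp_mul_right
          (a := 0) (b := 1) (fun t => g (y + t • (b i - b j)) ^ 2) s
        rw [zero_mul, one_mul, smul_eq_mul] at this
        rw [← this]
        congr 1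
        refine intervalIntegral.integral_congr fun t _ => ?_
        simp only [← hpe, smul_smul]
      rw [h0] at h1
      have := mul_le_mul_of_nonneg_left h1 hs0
      rw [← h2]
      linarith
    have hint1 : IntegrableOn (fun y => b.coord j y * g y ^ 2) (baryFacet b i)
        (μHE[d] : Measure (SpaceTime d)) := integrableOn_baryFacet b i (by fun_prop)
    have hint2 : IntegrableOn (fun y => C * ∫ t in (0 : ℝ)..b.coord j y,
        g (y + t • (b i - b j)) ^ 2) (baryFacet b i) (μHE[d] : Measure (SpaceTime d)) := by
      refine integrableOn_baryFacet b i (continuous_const.mul ?_)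
      exact intervalIntegral.continuous_parametric_intervalIntegral_of_continuous
        (by fun_prop) (continuous_coord b j)
    have := setIntegral_mono_on hint1 hint2 hF hpt
    rw [integral_const_mul] at this
    refine this.trans (le_of_eq ?_)
    rw [hI, hfib]
    field_simp
  have hsum : ∫ y in baryFacet b i, g y ^ 2 ∂μHE[d] =
      ∑ j, ∫ y in baryFacet b i, b.coord j y * g y ^ 2 ∂μHE[d] := by
    rw [← integral_finsetSum _ fun j _ => integrableOn_baryFacet b i (by fun_prop)]
    simp only [← Finset.sum_mul, b.sum_coord_apply_eq_one, one_mul]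
  rw [hsum]
  refine (Finset.sum_le_sum fun j _ => hcoord j).trans (le_of_eq ?_)
  rw [Finset.sum_const, Finset.card_univ, nsmul_eq_mul]
  ring

/-- A simplex that contains a ball is at least as high as the radius of the ball. -/
lemma norm_baryGrad_mul_radius_le {c : SpaceTime d} {r : ℝ} (hr : 0 ≤ r)
    (hball : Metric.closedBall c r ⊆ baryCell b) (i : ι) : ‖baryGrad b i‖ * r ≤ 1 := by
  have hκ := norm_baryGrad_pos b i
  have h1 : c + r • baryNormal b i ∈ baryCell b := by
    apply hball
    rw [Metric.mem_closedBall, dist_eq_norm, add_sub_cancel_left, norm_smul, norm_baryNormal,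
      mul_one, Real.norm_of_nonneg hr]
  have h2 := h1 i
  have h3 := coord_le_one b i (hball (Metric.mem_closedBall_self hr))
  have h4 : (b.coord i).linear (baryNormal b i) = -‖baryGrad b i‖ := by
    have h := inner_baryNormal b i (baryNormal b i)
    rw [real_inner_self_eq_norm_sq, norm_baryNormal] at h
    field_simp at h
    linarith
  rw [coord_add, map_smul, h4, smul_eq_mul] at h2
  linarith

end Trace

/-! ### Cells and facets given by vertex sets -/

section Cells

variable {d : ℕ}

/-- The vertex set of a nondegenerate space-time simplex. -/
structure IsCell (K : Finset (SpaceTime d)) : Prop where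
  card_eq : K.card = d + 2
  indep : AffineIndependent ℝ (fun y : K => (y : SpaceTime d))

open Classical in
/-- The vertex set of the facet of `K` opposite to the vertex `a`. -/
noncomputable def oppFacet (K : Finset (SpaceTime d)) (a : SpaceTime d) : Finset (SpaceTime d) :=
  K.erase a

lemma mem_oppFacet {K : Finset (SpaceTime d)} {a y : SpaceTime d} :
    y ∈ oppFacet K a ↔ y ≠ a ∧ y ∈ K := by
  simp [oppFacet]

lemma hull_mono {S K : Finset (SpaceTime d)} (h : S ⊆ K) : hull S ⊆ hull K :=
  convexHull_mono (by exact_mod_cast h)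

lemma isCompact_hull (K : Finset (SpaceTime d)) : IsCompact (hull K) :=
  K.finite_toSet.isCompact_convexHull ℝ

lemma convex_hull (K : Finset (SpaceTime d)) : Convex ℝ (hull K) := convex_convexHull ℝ _

lemma subset_hull {K : Finset (SpaceTime d)} {y : SpaceTime d} (hy : y ∈ K) : y ∈ hull K :=
  subset_convexHull ℝ _ hy

namespace IsCell

variable {K : Finset (SpaceTime d)}

/-- The vertices of a nondegenerate simplex as an affine basis of space-time. -/
noncomputable def basis (hK : IsCell K) : AffineBasis K ℝ (SpaceTime d) where
  toFun y := y
  ind' := hK.indep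
  tot' := by
    rw [hK.indep.affineSpan_eq_top_iff_card_eq_finrank_add_one]
    simp [hK.card_eq]

@[simp] lemma basis_apply (hK : IsCell K) (a : K) : hK.basis a = (a : SpaceTime d) := rfl

lemma nontrivial (hK : IsCell K) : Nontrivial K := by
  rw [← Fintype.one_lt_card_iff_nontrivial, Fintype.card_coe, hK.card_eq]
  omega

lemma hull_eq (hK : IsCell K) : hull K = baryCell hK.basis := by
  rw [baryCell_eq, hull]
  congr 1
  ext y
  simp

lemma card_oppFacet (hK : IsCell K) (a : K) : (oppFacet K a).card = d + 1 := by
  classical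
  rw [oppFacet, Finset.card_erase_of_mem a.2, hK.card_eq]
  rfl

lemma oppFacet_mem (hK : IsCell K) (a : K) : oppFacet K a ∈ allFacets K :=
  Finset.mem_powersetCard.2 ⟨Finset.erase_subset _ _, hK.card_oppFacet a⟩

lemma oppFacet_injective : Function.Injective fun a : K => oppFacet K a := by
  classical
  intro a c h
  by_contra hne
  have : (a : SpaceTime d) ∈ oppFacet K c := mem_oppFacet.2 ⟨fun h => hne (Subtype.ext h), a.2⟩
  rw [← show oppFacet K a = oppFacet K c from h] at this
  exact (mem_oppFacet.1 this).1 rfl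

lemma exists_eq_oppFacet (hK : IsCell K) {S : Finset (SpaceTime d)} (hS : S ∈ allFacets K) :
    ∃ a : K, S = oppFacet K a := by
  classical
  obtain ⟨hSK, hcard⟩ := Finset.mem_powersetCard.1 hS
  have h1 : (K \ S).card = 1 := by
    rw [Finset.card_sdiff_of_subset hSK, hK.card_eq, hcard]; omega
  obtain ⟨a, ha⟩ := Finset.card_eq_one.1 h1
  have haK : a ∈ K := (Finset.mem_sdiff.1 (ha ▸ Finset.mem_singleton_self a)).1
  refine ⟨⟨a, haK⟩, ?_⟩
  rw [oppFacet, ← Finset.sdiff_singleton_eq_erase, ← ha, Finset.sdiff_sdiff_eq_self hSK]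

lemma sum_allFacets (hK : IsCell K) (F : Finset (SpaceTime d) → ℝ) :
    ∑ S ∈ allFacets K, F S = ∑ a : K, F (oppFacet K a) := by
  symm
  refine Finset.sum_nbij (fun a => oppFacet K a) (fun a _ => hK.oppFacet_mem a)
    (fun a _ c _ h => oppFacet_injective h) (fun S hS => ?_) fun a _ => rfl
  obtain ⟨a, rfl⟩ := hK.exists_eq_oppFacet hS
  exact ⟨a, by simp, rfl⟩

lemma coord_vertex (hK : IsCell K) (a : K) {y : SpaceTime d} (hy : y ∈ oppFacet K a) :
    hK.basis.coord a y = 0 := by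
  obtain ⟨hne, hyK⟩ := mem_oppFacet.1 hy
  exact hK.basis.coord_apply_ne (i := a) (j := ⟨y, hyK⟩) fun h => hne (by rw [h])

lemma hull_oppFacet (hK : IsCell K) (a : K) : hull (oppFacet K a) = baryFacet hK.basis a := by
  classical
  refine Set.Subset.antisymm (fun y hy => ⟨?_, ?_⟩) fun y hy => ?_
  · have hconv : Convex ℝ {y | hK.basis.coord a y = 0} :=
      (convex_singleton (0 : ℝ)).affine_preimage (hK.basis.coord a)
    exact convexHull_min (fun z hz => hK.coord_vertex a hz) hconv hy
  · have := hull_mono (Finset.erase_subset _ _ : oppFacet K a ⊆ K) hy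
    rwa [hK.hull_eq] at this
  · rw [← hK.basis.linear_combination_coord_eq_self y,
      ← Finset.sum_erase (s := Finset.univ) (a := a) (f := fun i => _ • hK.basis i)
        (by simp [hy.1])]
    refine (convex_hull _).sum_mem (fun i _ => hy.2 i) ?_ fun i hi => subset_hull ?_
    · rw [Finset.sum_erase (f := fun i => hK.basis.coord i y) _ hy.1]
      exact hK.basis.sum_coord_apply_eq_one y
    · exact mem_oppFacet.2 ⟨fun h => (Finset.mem_erase.1 hi).1 (Subtype.ext h), i.2⟩

lemma coord_centroid (hK : IsCell K) (a : K) {S : Finset (SpaceTime d)} (hS : S.card ≠ 0) :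
    hK.basis.coord a (vertexCentroid S) = (S.card : ℝ)⁻¹ * ∑ y ∈ S, hK.basis.coord a y := by
  have h0 : (S.card : ℝ) ≠ 0 := Nat.cast_ne_zero.2 hS
  have h (y : SpaceTime d) : hK.basis.coord a y =
      hK.basis.coord a 0 + (hK.basis.coord a).linear y := by
    rw [← coord_add, zero_add]
  rw [h, vertexCentroid, map_smul, map_sum, Finset.sum_congr rfl fun y _ => h y,
    Finset.sum_add_distrib, Finset.sum_const, nsmul_eq_mul, smul_eq_mul, mul_add, ← mul_assoc,
    inv_mul_cancel₀ h0, one_mul]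

lemma orthogonal_vectorSpan_oppFacet (hK : IsCell K) (a : K) :
    (vectorSpan ℝ (oppFacet K a : Set (SpaceTime d)))ᗮ = ℝ ∙ baryGrad hK.basis a := by
  have := hK.nontrivial
  obtain ⟨c, hca⟩ := exists_ne a
  have hmem : ∀ {k : K}, k ≠ a → (k : SpaceTime d) ∈ (oppFacet K a : Set (SpaceTime d)) :=
    fun {k} hk => mem_oppFacet.2 ⟨fun h => hk (Subtype.ext h), k.2⟩
  refine le_antisymm (fun x hx => ?_) ?_
  · rw [Submodule.mem_orthogonal] at hx
    rw [Submodule.mem_span_singleton]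
    refine ⟨inner ℝ x (hK.basis a - hK.basis c), ?_⟩
    have hedge (k : K) : inner ℝ ((inner ℝ x (hK.basis a - hK.basis c)) •
        baryGrad hK.basis a - x) (hK.basis k - hK.basis c) = 0 := by
      rw [inner_sub_left, real_inner_smul_left, inner_baryGrad, coord_linear_sub,
        hK.basis.coord_apply_ne hca.symm]
      rcases eq_or_ne k a with rfl | hka
      · rw [hK.basis.coord_apply_eq]; ring
      · rw [hK.basis.coord_apply_ne hka.symm]
        have := hx _ (vsub_mem_vectorSpan ℝ (hmem hka) (hmem hca))
        rw [vsub_eq_sub, real_inner_comm] at this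
        rw [show inner ℝ x (hK.basis k - hK.basis c) = 0 from this]
        ring
    have hz : ∀ w, inner ℝ ((inner ℝ x (hK.basis a - hK.basis c)) •
        baryGrad hK.basis a - x) w = 0 := by
      intro w
      rw [← sum_coord_linear_smul_edge hK.basis c w, inner_sum]
      refine Finset.sum_eq_zero fun k _ => ?_
      rw [real_inner_smul_right, hedge, mul_zero]
    exact sub_eq_zero.1 (inner_self_eq_zero.1 (hz _))
  · rw [Submodule.span_singleton_le_iff_mem, Submodule.mem_orthogonal]
    intro v hv
    have hle : vectorSpan ℝ (oppFacet K a : Set (SpaceTime d)) ≤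
        LinearMap.ker (hK.basis.coord a).linear := by
      rw [vectorSpan_def, Submodule.span_le]
      rintro _ ⟨y, hy, z, hz, rfl⟩
      simp only [vsub_eq_sub, SetLike.mem_coe, LinearMap.mem_ker, coord_linear_sub]
      rw [hK.coord_vertex a hy, hK.coord_vertex a hz, sub_zero]
    rw [real_inner_comm, inner_baryGrad]
    exact hle hv

lemma coord_centroid_oppFacet (hK : IsCell K) (a : K) :
    hK.basis.coord a (vertexCentroid (oppFacet K a)) = 0 := by
  rw [coord_centroid, Finset.sum_eq_zero fun y hy => hK.coord_vertex a hy, mul_zero]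
  rw [hK.card_oppFacet]
  omega

lemma coord_centroid_pos (hK : IsCell K) (a : K) :
    0 < hK.basis.coord a (vertexCentroid K) := by
  classical
  rw [coord_centroid _ _ (by rw [hK.card_eq]; omega)]
  have h1 : ∑ y ∈ K, hK.basis.coord a y = 1 := by
    rw [← Finset.sum_coe_sort K fun y => hK.basis.coord a y]
    have : ∀ i : K, hK.basis.coord a i = if a = i then 1 else 0 := fun i => by
      rw [← hK.basis_apply i, hK.basis.coord_apply]
    simp [this]
  rw [h1, hK.card_eq]
  positivity

/-- The outward normal is minus the normalised gradient of the barycentric coordinate of the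
opposite vertex. -/
lemma outwardNormal_eq (hK : IsCell K) (a : K) :
    outwardNormal K (oppFacet K a) = baryNormal hK.basis a := by
  have := hK.nontrivial
  have hneg : inner ℝ (baryGrad hK.basis a) (vertexCentroid (oppFacet K a) - vertexCentroid K) /
      ‖baryGrad hK.basis a‖ ^ 2 < 0 := by
    rw [inner_baryGrad, coord_linear_sub, hK.coord_centroid_oppFacet, zero_sub]
    have := norm_baryGrad_pos hK.basis a
    exact div_neg_of_neg_of_pos (neg_neg_of_pos (hK.coord_centroid_pos a)) (by positivity)
  have hproj : (vectorSpan ℝ (oppFacet K a : Set (SpaceTime d)))ᗮ.starProjection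
      (vertexCentroid (oppFacet K a) - vertexCentroid K) =
      (inner ℝ (baryGrad hK.basis a) (vertexCentroid (oppFacet K a) - vertexCentroid K) /
        ‖baryGrad hK.basis a‖ ^ 2) • baryGrad hK.basis a := by
    simp only [hK.orthogonal_vectorSpan_oppFacet a]
    exact Submodule.starProjection_singleton ℝ _
  rw [outwardNormal, hproj, NormedSpace.normalize_smul_of_neg hneg, baryNormal]
  rfl

end IsCell

end Cells

/-! ### Divergence theorem and trace inequality on the cells of a mesh -/

section CellIntegrals

variable {d : ℕ}

lemma normalT_eq (K S : Finset (SpaceTime d)) (t : ℝ) (x : Space d) :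
    inner ℝ (outwardNormal K S) (stPoint t x) = normalT K S * t + inner ℝ (normalX K S) x := by
  rw [inner_spaceTime]
  simp [normalT, normalX]

namespace IsCell

variable {K : Finset (SpaceTime d)}

lemma norm_outwardNormal (hK : IsCell K) {S : Finset (SpaceTime d)} (hS : S ∈ allFacets K) :
    ‖outwardNormal K S‖ = 1 := by
  have := hK.nontrivial
  obtain ⟨a, rfl⟩ := hK.exists_eq_oppFacet hS
  rw [hK.outwardNormal_eq, norm_baryNormal]

lemma normalT_sq_add (hK : IsCell K) {S : Finset (SpaceTime d)} (hS : S ∈ allFacets K) :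
    normalT K S ^ 2 + ‖normalX K S‖ ^ 2 = 1 := by
  have h := real_inner_self_eq_norm_sq (outwardNormal K S)
  rw [hK.norm_outwardNormal hS, inner_spaceTime, real_inner_self_eq_norm_sq] at h
  rw [normalT, normalX]
  linarith

lemma norm_normalX_le (hK : IsCell K) {S : Finset (SpaceTime d)} (hS : S ∈ allFacets K) :
    ‖normalX K S‖ ≤ 1 := by
  have h := hK.normalT_sq_add hS
  nlinarith [sq_nonneg (normalT K S), norm_nonneg (normalX K S)]

lemma integrable_facetMeasure (hK : IsCell K) {S : Finset (SpaceTime d)} (hS : S ∈ allFacets K)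
    {f : SpaceTime d → ℝ} (hf : Continuous f) : Integrable f (facetMeasure S) := by
  have := hK.nontrivial
  obtain ⟨a, rfl⟩ := hK.exists_eq_oppFacet hS
  rw [facetMeasure, hK.hull_oppFacet]
  exact integrableOn_baryFacet _ a hf

theorem integral_fderiv (hK : IsCell K) {f : SpaceTime d → ℝ} (hf : ContDiff ℝ 1 f)
    (w : SpaceTime d) :
    ∫ y in hull K, fderiv ℝ f y w =
      ∑ S ∈ allFacets K, inner ℝ (outwardNormal K S) w * ∫ y, f y ∂(facetMeasure S) := by
  have := hK.nontrivial
  rw [hK.hull_eq, integral_fderiv_baryCell _ hf, hK.sum_allFacets]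
  refine Finset.sum_congr rfl fun a _ => ?_
  rw [hK.outwardNormal_eq, facetMeasure, hK.hull_oppFacet]

lemma cellSize_pos (hK : IsCell K) : 0 < cellSize K := by
  have := hK.nontrivial
  obtain ⟨a, c, hac⟩ := exists_pair_ne K
  have h : dist (a : SpaceTime d) c ≤ cellSize K :=
    Metric.dist_le_diam_of_mem (isCompact_hull K).isBounded (subset_hull a.2) (subset_hull c.2)
  exact lt_of_lt_of_le (dist_pos.2 fun h => hac (Subtype.ext h)) h

/-- The discrete trace inequality on a shape regular cell. -/
lemma trace_inequality (hK : IsCell K) {k : ℕ} {C : ℝ} (hC0 : 0 < C)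
    (hC : ∀ p : Polynomial ℝ, p.natDegree ≤ k →
      p.eval 0 ^ 2 ≤ C * ∫ t in (0 : ℝ)..1, p.eval t ^ 2)
    {c : SpaceTime d} {r σ : ℝ} (hr : 0 < r) (hball : Metric.closedBall c r ⊆ hull K)
    (hσ : cellSize K ≤ σ * r) {g : SpaceTime d → ℝ} (hg : Continuous g)
    (hpoly : ∀ y e, ∃ p : Polynomial ℝ, p.natDegree ≤ k ∧ ∀ t : ℝ, g (y + t • e) = p.eval t)
    {S : Finset (SpaceTime d)} (hS : S ∈ allFacets K) :
    cellSize K * ∫ y, g y ^ 2 ∂(facetMeasure S) ≤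
      C * (d + 2) * σ * ∫ y in hull K, g y ^ 2 := by
  have := hK.nontrivial
  obtain ⟨a, rfl⟩ := hK.exists_eq_oppFacet hS
  have h1 := _root_.trace_inequality hK.basis hC0 hC hg hpoly a
  have h2 := norm_baryGrad_mul_radius_le hK.basis hr.le (hK.hull_eq ▸ hball) a
  rw [← hK.hull_eq, ← hK.hull_oppFacet] at h1
  have hcard : (Fintype.card K : ℝ) = d + 2 := by
    rw [Fintype.card_coe, hK.card_eq]; push_cast; ring
  rw [hcard] at h1
  set I := ∫ y in hull K, g y ^ 2
  have hI : 0 ≤ I := integral_nonneg fun y => sq_nonneg _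
  have hσ0 : 0 < σ := by
    have := hK.cellSize_pos
    by_contra h
    push Not at h
    nlinarith
  rw [facetMeasure]
  calc cellSize K * ∫ y in hull (oppFacet K a), g y ^ 2 ∂μHE[d]
      ≤ (σ * r) * (C * (d + 2) * ‖baryGrad hK.basis a‖ * I) :=
        mul_le_mul hσ h1 (integral_nonneg fun y => sq_nonneg _) (by positivity)
    _ = (C * (d + 2) * σ * I) * (‖baryGrad hK.basis a‖ * r) := by ring
    _ ≤ (C * (d + 2) * σ * I) * 1 := mul_le_mul_of_nonneg_left h2 (by positivity)
    _ = _ := by ring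

/-- Moving inwards from a point in the relative interior of a facet. -/
lemma eventually_mem_interior (hK : IsCell K) (a : K) {p w : SpaceTime d}
    (hp : hK.basis.coord a p = 0) (hp' : ∀ k, k ≠ a → 0 < hK.basis.coord k p)
    (hw : 0 < inner ℝ (baryGrad hK.basis a) w) :
    ∀ᶠ ε : ℝ in 𝓝[>] 0, p + ε • w ∈ interior (hull K) := by
  simp only [hK.hull_eq, interior_baryCell, Set.mem_ofPred_eq]
  refine eventually_all.2 fun k => ?_
  rcases eq_or_ne k a with rfl | hk
  · filter_upwards [self_mem_nhdsWithin] with ε (hε : 0 < ε)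
    rw [coord_add, hp, map_smul, ← inner_baryGrad, zero_add, smul_eq_mul]
    exact mul_pos hε hw
  · refine Filter.Eventually.filter_mono nhdsWithin_le_nhds ?_
    have hcont : Continuous fun ε : ℝ => hK.basis.coord k (p + ε • w) :=
      (continuous_coord hK.basis k).comp (by fun_prop)
    refine (isOpen_lt continuous_const hcont).mem_nhds ?_
    simpa using hp' k hk

lemma coord_centroid_oppFacet_pos (hK : IsCell K) {a k : K} (hk : k ≠ a) :
    0 < hK.basis.coord k (vertexCentroid (oppFacet K a)) := by
  classical
  rw [coord_centroid _ _ (by rw [hK.card_oppFacet]; omega)]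
  refine mul_pos (inv_pos.2 (by rw [hK.card_oppFacet]; positivity)) ?_
  have hv : ∀ y ∈ oppFacet K a, 0 ≤ hK.basis.coord k y := fun y hy => by
    have := subset_hull (mem_oppFacet.1 hy).2
    rw [hK.hull_eq] at this
    exact this k
  refine lt_of_lt_of_le zero_lt_one ?_
  have hmem : (k : SpaceTime d) ∈ oppFacet K a :=
    mem_oppFacet.2 ⟨fun h => hk (Subtype.ext h), k.2⟩
  have h1 : hK.basis.coord k k = 1 := hK.basis.coord_apply_eq k
  rw [← h1]
  exact Finset.single_le_sum (f := fun y => hK.basis.coord k y) hv hmem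

/-- A continuous function whose square has vanishing integral over a facet vanishes there. -/
lemma eq_zero_of_integral_sq_facet (hK : IsCell K) {S : Finset (SpaceTime d)}
    (hS : S ∈ allFacets K) {f : SpaceTime d → ℝ} (hf : Continuous f)
    (h : ∫ y, f y ^ 2 ∂(facetMeasure S) = 0) : ∀ y ∈ hull S, f y = 0 := by
  have := hK.nontrivial
  have hint := hK.integrable_facetMeasure hS (hf.pow 2)
  rw [integral_eq_zero_iff_of_nonneg (fun y => sq_nonneg _) hint] at h
  obtain ⟨a, rfl⟩ := hK.exists_eq_oppFacet hS
  obtain ⟨R, hR⟩ := exists_linearIsometryEquiv_timeDir _ (norm_baryNormal hK.basis a)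
  set c := ‖baryGrad hK.basis a‖⁻¹ * hK.basis.coord a 0
  set φ : Space d → SpaceTime d := fun z => R (stPoint c z) with hφ
  have hφc : Continuous φ := (isometry_chart R c).continuous
  have hrange : Set.range φ = {y | hK.basis.coord a y = 0} := by
    rw [hφ, range_chart hR, hyperplane_baryNormal]
  have hnull : (μHE[d] : Measure (SpaceTime d)).restrict {y | hK.basis.coord a y = 0}
      {y | y ∈ hull (oppFacet K a) ∧ f y ≠ 0} = 0 := by
    refine le_antisymm ((Measure.restrict_apply_le _ _).trans ?_) zero_le
    rw [facetMeasure, EventuallyEq,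
      ae_restrict_iff' (isCompact_hull _).measurableSet, ae_iff] at h
    refine (measure_mono fun y hy => ?_).trans h.le
    simpa using hy
  have hD : ∀ y, hK.basis.coord a y = 0 → (∀ k, k ≠ a → 0 < hK.basis.coord k y) → f y = 0 := by
    intro y hy hpos
    by_contra hne
    obtain ⟨z, rfl⟩ : y ∈ Set.range φ := by rw [hrange]; exact hy
    set U : Set (Space d) := {z | f (φ z) ≠ 0 ∧ ∀ k, k ≠ a → 0 < hK.basis.coord k (φ z)} with hU
    have hUo : IsOpen U := by
      have h1 : IsOpen {z | f (φ z) ≠ 0} := isOpen_ne_fun (hf.comp hφc) continuous_const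
      have h2 : IsOpen (⋂ k, ⋂ (_ : k ≠ a), {z | 0 < hK.basis.coord k (φ z)}) :=
        isOpen_iInter_of_finite fun k => isOpen_iInter_of_finite fun _ =>
          isOpen_lt continuous_const ((continuous_coord _ k).comp hφc)
      convert h1.inter h2 using 1
      ext z
      simp [hU]
    have hpos' : 0 < (volume : Measure (Space d)) U := hUo.measure_pos _ ⟨z, hne, hpos⟩
    rw [← hyperplane_baryNormal, ← map_chart hR,
      (isometry_chart R c).isClosedEmbedding.measurableEmbedding.map_apply] at hnull
    have hsub : U ⊆ φ ⁻¹' {y | y ∈ hull (oppFacet K a) ∧ f y ≠ 0} := by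
      refine fun z hz => ⟨?_, hz.1⟩
      rw [hK.hull_oppFacet]
      have h0 : hK.basis.coord a (φ z) = 0 := by
        have : φ z ∈ Set.range φ := ⟨z, rfl⟩
        rwa [hrange] at this
      refine ⟨h0, fun k => ?_⟩
      rcases eq_or_ne k a with rfl | hk
      · exact h0.ge
      · exact (hz.2 k hk).le
    exact hpos'.ne' (measure_mono_null hsub hnull)
  intro y hy
  rw [hK.hull_oppFacet] at hy
  set p := vertexCentroid (oppFacet K a)
  have hlim : Tendsto (fun ε : ℝ => f (y + ε • (p - y))) (𝓝[>] 0) (𝓝 (f y)) := by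
    have hcont : Continuous fun ε : ℝ => f (y + ε • (p - y)) := hf.comp (by fun_prop)
    have := hcont.tendsto 0
    simp only [zero_smul, add_zero] at this
    exact this.mono_left nhdsWithin_le_nhds
  refine tendsto_nhds_unique hlim (tendsto_const_nhds.congr' ?_)
  filter_upwards [Ioo_mem_nhdsGT (zero_lt_one (α := ℝ))] with ε hε
  symm
  refine hD _ ?_ fun k hk => ?_
  · rw [coord_add, map_smul, coord_linear_sub, hy.1, hK.coord_centroid_oppFacet]
    simp
  · rw [coord_add, map_smul, coord_linear_sub, smul_eq_mul]
    have h1 := hy.2 k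
    have h2 := hK.coord_centroid_oppFacet_pos hk
    nlinarith [mul_pos hε.1 h2, mul_nonneg (sub_nonneg.2 hε.2.le) h1]

/-- A continuous function whose square has vanishing integral over a cell vanishes there. -/
lemma eq_zero_of_integral_sq (hK : IsCell K) {f : SpaceTime d → ℝ} (hf : Continuous f)
    (h : ∫ y in hull K, f y ^ 2 = 0) : ∀ y ∈ hull K, f y = 0 := by
  have hint : IntegrableOn (fun y => f y ^ 2) (hull K) :=
    (hf.pow 2).continuousOn.integrableOn_compact (isCompact_hull K)
  rw [integral_eq_zero_iff_of_nonneg (fun y => sq_nonneg _) hint] at h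
  have h1 : ∀ y ∈ interior (hull K), f y = 0 := by
    have h2 : f =ᵐ[volume.restrict (interior (hull K))] fun _ => 0 := by
      have := ae_mono (Measure.restrict_mono_set volume (interior_subset (s := hull K))) h
      filter_upwards [this] with y hy
      simpa using hy
    exact Measure.eqOn_open_of_ae_eq h2 isOpen_interior hf.continuousOn continuousOn_const
  intro y hy
  have hne : (interior (hull K)).Nonempty := by
    rw [hK.hull_eq, interior_baryCell]
    exact ⟨vertexCentroid K, fun a => hK.coord_centroid_pos a⟩
  have hcl : y ∈ closure (interior (hull K)) := by
    rw [(convex_hull K).closure_interior_eq_closure_of_nonempty_interior hne]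
    exact subset_closure hy
  exact (isClosed_eq hf continuous_const).closure_subset_iff.2 h1 hcl

end IsCell

end CellIntegrals

/-! ### Neighbouring cells of a conforming mesh -/

namespace SlabMesh

variable {d : ℕ} {M : SlabMesh d}

lemma isCell (M : SlabMesh d) {K : Finset (SpaceTime d)} (hK : K ∈ M.cells) : IsCell K :=
  ⟨M.card_cell K hK, M.affineIndependent K hK⟩

/-- Distinct cells meet in the hull of their common vertices, and some vertex of the first cell is
not common to both. -/
lemma interior_inter_hull {K K' : Finset (SpaceTime d)} (hK : K ∈ M.cells) (hK' : K' ∈ M.cells)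
    (hne : K ≠ K') : Disjoint (interior (hull K)) (hull K') := by
  have hc := M.isCell hK
  rw [Set.disjoint_left]
  intro y hy hy'
  have hsub : ¬ K ⊆ K' := fun h => hne (Finset.eq_of_subset_of_card_le h (by
    rw [hc.card_eq, (M.isCell hK').card_eq]))
  obtain ⟨a, haK, haK'⟩ := Finset.not_subset.1 hsub
  have hmem : y ∈ convexHull ℝ ((K : Set (SpaceTime d)) ∩ K') := by
    rw [← M.conforming K hK K' hK']
    exact ⟨interior_subset hy, hy'⟩
  have h1 : y ∈ hull (oppFacet K a) := by
    refine convexHull_mono (fun z hz => ?_) hmem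
    exact mem_oppFacet.2 ⟨fun h => haK' (h ▸ hz.2), hz.1⟩
  rw [hc.hull_oppFacet ⟨a, haK⟩] at h1
  rw [hc.hull_eq, interior_baryCell] at hy
  exact (hy ⟨a, haK⟩).ne' h1.1

/-- The outward normals of two cells on a common facet are opposite, as otherwise both cells would
contain the points close to the centroid of the facet on one of its sides. -/
lemma outwardNormal_eq_neg {K K' S : Finset (SpaceTime d)} (hK : K ∈ M.cells)
    (hK' : K' ∈ M.cells) (hne : K ≠ K') (hS : S ∈ allFacets K) (hS' : S ∈ allFacets K') :
    outwardNormal K' S = -outwardNormal K S := by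
  have hc := M.isCell hK
  have hc' := M.isCell hK'
  have := hc.nontrivial
  have := hc'.nontrivial
  obtain ⟨a, rfl⟩ := hc.exists_eq_oppFacet hS
  obtain ⟨a', ha'⟩ := hc'.exists_eq_oppFacet hS'
  have hspan : baryGrad hc'.basis a' ∈ ℝ ∙ baryGrad hc.basis a := by
    rw [← hc.orthogonal_vectorSpan_oppFacet, ha', hc'.orthogonal_vectorSpan_oppFacet]
    exact Submodule.mem_span_singleton_self _
  obtain ⟨s, hs⟩ := Submodule.mem_span_singleton.1 hspan
  have hs0 : s < 0 := by
    by_contra hs0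
    push Not at hs0
    have hs1 : 0 < s := lt_of_le_of_ne hs0 fun h => baryGrad_ne_zero hc'.basis a' (by
      rw [← hs, ← h, zero_smul])
    have hg := norm_baryGrad_pos hc.basis a
    have e1 := hc.eventually_mem_interior a (hc.coord_centroid_oppFacet a)
      (fun k hk => hc.coord_centroid_oppFacet_pos hk) (w := baryGrad hc.basis a) (by
        rw [real_inner_self_eq_norm_sq]; positivity)
    have e2 := hc'.eventually_mem_interior a' (hc'.coord_centroid_oppFacet a')
      (fun k hk => hc'.coord_centroid_oppFacet_pos hk) (w := baryGrad hc.basis a) (by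
        rw [← hs, real_inner_smul_left, real_inner_self_eq_norm_sq]; positivity)
    rw [← ha'] at e2
    obtain ⟨ε, h1, h2⟩ := (e1.and e2).exists
    exact Set.disjoint_left.1 (interior_inter_hull hK hK' hne) h1 (interior_subset h2)
  have h2 : outwardNormal K' (oppFacet K a) = baryNormal hc'.basis a' := by
    rw [ha', hc'.outwardNormal_eq]
  have h3 {L : Finset (SpaceTime d)} (hL : IsCell L) (c : L) :
      baryNormal hL.basis c = -NormedSpace.normalize (baryGrad hL.basis c) := rfl
  rw [h2, hc.outwardNormal_eq, h3, h3, ← hs, NormedSpace.normalize_smul_of_neg hs0]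

/-- The cells which have `S` as a facet in `𝒬_K`. -/
noncomputable def cellsOf (M : SlabMesh d) (S : Finset (SpaceTime d)) :
    Finset (Finset (SpaceTime d)) := by
  classical exact M.cells.filter fun K => S ∈ lateralFacets K

lemma mem_cellsOf {K S : Finset (SpaceTime d)} :
    K ∈ M.cellsOf S ↔ K ∈ M.cells ∧ S ∈ lateralFacets K := by
  simp [cellsOf]

lemma lateral_subset {K S : Finset (SpaceTime d)} (h : S ∈ lateralFacets K) : S ∈ allFacets K :=
  Finset.mem_of_mem_filter _ h

lemma normalT_eq_neg {K K' S : Finset (SpaceTime d)} (hK : K ∈ M.cells)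
    (hK' : K' ∈ M.cells) (hne : K ≠ K') (hS : S ∈ allFacets K) (hS' : S ∈ allFacets K') :
    normalT K' S = -normalT K S := by
  rw [normalT, outwardNormal_eq_neg hK hK' hne hS hS']; rfl

lemma normalX_eq_neg {K K' S : Finset (SpaceTime d)} (hK : K ∈ M.cells)
    (hK' : K' ∈ M.cells) (hne : K ≠ K') (hS : S ∈ allFacets K) (hS' : S ∈ allFacets K') :
    normalX K' S = -normalX K S := by
  rw [normalX, outwardNormal_eq_neg hK hK' hne hS hS']
  ext i
  simp [normalX]

/-- A facet in `𝒬_K` is either a boundary facet or shared by exactly two cells. -/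
lemma boundary_or_pair {K S : Finset (SpaceTime d)} (hK : K ∈ M.cells)
    (hS : S ∈ lateralFacets K) :
    (M.IsBoundaryFacet K S ∧ M.cellsOf S = {K}) ∨
      ∃ K' ∈ M.cells, K ≠ K' ∧ S ∈ lateralFacets K' ∧
        (∀ L, ¬ M.IsBoundaryFacet L S) ∧ S ∉ M.neumann ∧
        ∀ F : Finset (SpaceTime d) → ℝ, ∑ L ∈ M.cellsOf S, F L = F K + F K' := by
  classical
  by_cases hb : ∀ K' ∈ M.cells, S ⊆ K' → K' = K
  · refine Or.inl ⟨⟨hK, hS, hb⟩, ?_⟩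
    ext L
    rw [mem_cellsOf, Finset.mem_singleton]
    constructor
    · rintro ⟨hL, hSL⟩
      exact hb L hL (Finset.mem_powersetCard.1 (lateral_subset hSL)).1
    · rintro rfl
      exact ⟨hK, hS⟩
  · push Not at hb
    obtain ⟨K', hK', hSK', hne⟩ := hb
    have hSa := lateral_subset hS
    obtain ⟨hSK, hcard⟩ := Finset.mem_powersetCard.1 hSa
    have hall {L : Finset (SpaceTime d)} (h : S ⊆ L) : S ∈ allFacets L :=
      Finset.mem_powersetCard.2 ⟨h, hcard⟩
    have hlat : S ∈ lateralFacets K' := by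
      refine Finset.mem_filter.2 ⟨hall hSK', ?_⟩
      rw [normalT_eq_neg hK hK' hne.symm hSa (hall hSK'), abs_neg]
      exact (Finset.mem_filter.1 hS).2
    have hnb : ∀ L, ¬ M.IsBoundaryFacet L S := fun L hL =>
      hne ((hL.2.2 K' hK' hSK').trans (hL.2.2 K hK hSK).symm)
    refine Or.inr ⟨K', hK', hne.symm, hlat, hnb, fun hN => ?_, fun F => ?_⟩
    · obtain ⟨L, hL, hSL, h⟩ := M.neumann_subset S hN
      exact hnb L ⟨hL, hSL, h⟩
    · have : M.cellsOf S = {K, K'} := by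
        ext L
        rw [mem_cellsOf, Finset.mem_insert, Finset.mem_singleton]
        constructor
        · rintro ⟨hL, hSL⟩
          by_contra hcon
          push Not at hcon
          have hSLa := lateral_subset hSL
          have h1 := outwardNormal_eq_neg hK hL hcon.1.symm hSa hSLa
          have h2 := outwardNormal_eq_neg hK' hL hcon.2.symm (hall hSK') hSLa
          have h3 := outwardNormal_eq_neg hK hK' hne.symm hSa (hall hSK')
          rw [h3, h1, neg_neg] at h2
          have h5 : (2 : ℝ) • outwardNormal K S = 0 := by
            rw [two_smul]
            nth_rewrite 1 [← h2]
            exact neg_add_cancel _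
          have h4 := (M.isCell hK).norm_outwardNormal hSa
          rw [(smul_eq_zero.1 h5).resolve_left two_ne_zero, norm_zero] at h4
          exact zero_ne_one h4
        · rintro (rfl | rfl)
          · exact ⟨hK, hS⟩
          · exact ⟨hK', hlat⟩
      rw [this, Finset.sum_pair hne.symm]

/-- The facets in `𝒬_K` of all cells. -/
noncomputable def laterals (M : SlabMesh d) : Finset (Finset (SpaceTime d)) := by
  classical exact M.cells.biUnion lateralFacets

lemma mem_laterals {S : Finset (SpaceTime d)} :
    S ∈ M.laterals ↔ ∃ K ∈ M.cells, S ∈ lateralFacets K := by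
  simp [laterals]

lemma sum_lateral_comm (M : SlabMesh d) (F : Finset (SpaceTime d) → Finset (SpaceTime d) → ℝ) :
    ∑ K ∈ M.cells, ∑ S ∈ lateralFacets K, F K S =
      ∑ S ∈ M.laterals, ∑ K ∈ M.cellsOf S, F K S := by
  refine Finset.sum_comm' fun K S => ?_
  rw [mem_cellsOf, mem_laterals]
  constructor
  · rintro ⟨h1, h2⟩
    exact ⟨⟨h1, h2⟩, K, h1, h2⟩
  · rintro ⟨h, -⟩
    exact h

end SlabMesh

/-! ### Horizontal facets and sections of cells -/

section Sections

variable {d : ℕ}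

lemma isClosed_cellSection (K : Finset (SpaceTime d)) (t : ℝ) : IsClosed (cellSection K t) :=
  (isCompact_hull K).isClosed.preimage (isometry_stPoint t).continuous

lemma isCompact_cellSection (K : Finset (SpaceTime d)) (t : ℝ) : IsCompact (cellSection K t) :=
  (isometry_stPoint t).isClosedEmbedding.isCompact_preimage (isCompact_hull K)

lemma stPoint_combo (s t c e : ℝ) (x z : Space d) :
    c • stPoint s x + e • stPoint t z = stPoint (c * s + e * t) (c • x + e • z) := by
  rw [stPoint_add, stPoint_smul, stPoint_smul]

lemma convex_cellSection (K : Finset (SpaceTime d)) (t : ℝ) : Convex ℝ (cellSection K t) := by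
  intro x hx z hz a c ha hc hac
  have := convex_hull K hx hz ha hc hac
  rw [stPoint_combo, ← add_mul, hac, one_mul] at this
  exact this

lemma integral_facetMeasure_section {S K : Finset (SpaceTime d)} {t : ℝ}
    (h : hull S = hull K ∩ {y | y 0 = t}) (f : SpaceTime d → ℝ) :
    ∫ y, f y ∂(facetMeasure S) = ∫ x in cellSection K t, f (stPoint t x) := by
  have hemb := (isometry_stPoint (d := d) t).isClosedEmbedding.measurableEmbedding
  have h1 := hemb.setIntegral_map (μ := volume) f (hull S)
  rw [← EuclideanSpace.euclideanHausdorffMeasure_eq_volume,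
    (isometry_stPoint (d := d) t).map_euclideanHausdorffMeasure,
    EuclideanSpace.euclideanHausdorffMeasure_eq_volume,
    Measure.restrict_restrict (isCompact_hull S).measurableSet, Set.inter_eq_left.2] at h1
  · rw [facetMeasure, h1]
    congr 2
    ext x
    simp [h, cellSection]
  · intro y hy
    rw [h] at hy
    exact ⟨spacePart y, by rw [← hy.2, stPoint_eta]⟩

namespace IsCell

variable {K : Finset (SpaceTime d)}

/-- If all vertices except `a` are at time `t`, then the time coordinate is an affine function of
the barycentric coordinate of `a`. -/
lemma time_eq_of_horizontal (hK : IsCell K) (a : K) {t : ℝ}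
    (ht : ∀ y ∈ oppFacet K a, y 0 = t) (w : SpaceTime d) :
    w 0 = (hK.basis.coord a).linear w * ((a : SpaceTime d) 0 - t) := by
  have := hK.nontrivial
  obtain ⟨c, hca⟩ := exists_ne a
  have hmem {k : K} (hk : k ≠ a) : (k : SpaceTime d) 0 = t :=
    ht _ (mem_oppFacet.2 ⟨fun h => hk (Subtype.ext h), k.2⟩)
  conv_lhs => rw [← sum_coord_linear_smul_edge hK.basis c w]
  rw [WithLp.ofLp_sum, Finset.sum_apply, Finset.sum_eq_single a]
  · simp [hmem hca]
  · intro k _ hk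
    simp [hmem hca, hmem hk]
  · simp

/-- A facet at an extremal time `t` of the cell has a vertical normal; the sign `s` is `1` at the
latest and `-1` at the earliest time. -/
lemma horizontal_facet (hK : IsCell K) (a : K) {s t : ℝ} (hs : s ^ 2 = 1)
    (hle : ∀ y ∈ K, s * y 0 ≤ s * t) (ht : ∀ y ∈ oppFacet K a, y 0 = t) :
    (a : SpaceTime d) 0 ≠ t ∧ outwardNormal K (oppFacet K a) = stPoint s 0 ∧
      hull (oppFacet K a) = hull K ∩ {y | y 0 = t} := by
  have := hK.nontrivial
  have hs0 : s ≠ 0 := by rintro rfl; norm_num at hs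
  have hw := hK.time_eq_of_horizontal a ht
  have hne : (a : SpaceTime d) 0 ≠ t := by
    intro h
    have := hw (stPoint 1 0)
    rw [h, sub_self, mul_zero] at this
    simp at this
  set τ : ℝ := s * t - s * (a : SpaceTime d) 0 with hτ
  have hτ0 : 0 < τ := by
    refine lt_of_le_of_ne (sub_nonneg.2 (hle a a.2)) fun h => hne ?_
    rw [hτ, ← mul_sub] at h
    have := (mul_eq_zero.1 h.symm).resolve_left hs0
    linarith
  have hlin (w : SpaceTime d) : (hK.basis.coord a).linear w = -(s * w 0) / τ := by
    rw [eq_div_iff hτ0.ne', hτ, hw w]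
    ring
  refine ⟨hne, ?_, ?_⟩
  · rw [hK.outwardNormal_eq]
    set κ := ‖baryGrad hK.basis a‖ with hκ
    have hκ0 : 0 < κ := norm_baryGrad_pos hK.basis a
    have h1 : baryNormal hK.basis a = (κ⁻¹ / τ) • stPoint s 0 := by
      refine ext_inner_right ℝ fun w => ?_
      rw [inner_baryNormal, hlin, real_inner_smul_left, inner_spaceTime]
      simp
      ring
    have h2 := norm_baryNormal hK.basis a
    have h3 : ‖(stPoint s 0 : SpaceTime d)‖ = 1 := by
      rw [← sq_eq_sq₀ (norm_nonneg _) zero_le_one, ← real_inner_self_eq_norm_sq, inner_stPoint]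
      simp [← sq, hs]
    rw [h1, norm_smul, h3, mul_one, Real.norm_of_nonneg (by positivity)] at h2
    rw [h1, h2, one_smul]
  · obtain ⟨c, hca⟩ := exists_ne a
    have hc0 : (c : SpaceTime d) 0 = t :=
      ht _ (mem_oppFacet.2 ⟨fun h => hca (Subtype.ext h), c.2⟩)
    rw [hK.hull_oppFacet, hK.hull_eq]
    ext y
    have h1 : hK.basis.coord a y = -(s * (y 0 - t)) / τ := by
      have h2 := coord_linear_sub hK.basis a y (hK.basis c)
      rw [hK.basis.coord_apply_ne hca.symm, sub_zero, hlin] at h2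
      rw [← h2, ← hc0]
      simp
    simp only [baryFacet, baryCell, Set.mem_ofPred_eq, Set.mem_inter_iff, h1]
    rw [and_comm]
    refine and_congr_right fun _ => ?_
    rw [div_eq_zero_iff]
    simp [hs0, hτ0.ne', sub_eq_zero]

/-- The section of a cell at an extremal time at which the cell has no facet is a null set: the
barycentric coordinates of two distinct vertices vanish on it. -/
lemma volume_cellSection_eq_zero (hK : IsCell K) {s t : ℝ} (hs : s ^ 2 = 1)
    (hle : ∀ y ∈ K, s * y 0 ≤ s * t) (hno : ∀ S ∈ allFacets K, ¬ ∀ y ∈ S, y 0 = t) :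
    volume (cellSection K t) = 0 := by
  have := hK.nontrivial
  have hs0 : s ≠ 0 := by rintro rfl; norm_num at hs
  have hoff (a : K) : ∃ c : K, c ≠ a ∧ (c : SpaceTime d) 0 ≠ t := by
    have := hno _ (hK.oppFacet_mem a)
    push Not at this
    obtain ⟨y, hy, hyt⟩ := this
    obtain ⟨h1, h2⟩ := mem_oppFacet.1 hy
    exact ⟨⟨y, h2⟩, fun h => h1 (by rw [← h]), hyt⟩
  obtain ⟨a, -, hat⟩ := hoff (Classical.arbitrary K)
  obtain ⟨c, hca, hct⟩ := hoff a
  have hzero : ∀ x ∈ cellSection K t, hK.basis.coord a (stPoint t x) = 0 := by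
    intro x hx
    have hx : stPoint t x ∈ hull K := hx
    rw [hK.hull_eq] at hx
    have h1 := congrArg (fun y : SpaceTime d => y 0)
      (hK.basis.linear_combination_coord_eq_self (stPoint t x))
    simp only [WithLp.ofLp_sum, Finset.sum_apply] at h1
    have h2 := hK.basis.sum_coord_apply_eq_one (stPoint t x)
    have h3 : ∑ k, hK.basis.coord k (stPoint t x) * (s * t - s * (k : SpaceTime d) 0) = 0 := by
      simp only [mul_sub, Finset.sum_sub_distrib, ← Finset.sum_mul, h2, one_mul]
      have h4 : ∑ k, hK.basis.coord k (stPoint t x) * (s * (k : SpaceTime d) 0) = s * t := by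
        simp only [mul_left_comm _ s, ← Finset.mul_sum]
        congr 1
      rw [h4, sub_self]
    rw [Finset.sum_eq_zero_iff_of_nonneg
      fun k _ => mul_nonneg (hx k) (sub_nonneg.2 (hle k k.2))] at h3
    refine (mul_eq_zero.1 (h3 a (Finset.mem_univ a))).resolve_right fun h => hat ?_
    rw [← mul_sub] at h
    have := (mul_eq_zero.1 h).resolve_left hs0
    linarith
  set P : AffineSubspace ℝ (Space d) :=
    { carrier := {x | hK.basis.coord a (stPoint t x) = 0}
      smul_vsub_vadd_mem' := by
        intro e p₁ p₂ p₃ h1 h2 h3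
        simp only [Set.mem_ofPred_eq] at h1 h2 h3 ⊢
        have : stPoint t (e • (p₁ -ᵥ p₂) +ᵥ p₃) =
            stPoint t p₃ + e • (stPoint t p₁ - stPoint t p₂) := by
          ext i
          refine Fin.cases ?_ (fun i => ?_) i <;> simp [add_comm]
        rw [this, coord_add, map_smul, coord_linear_sub, h1, h2, h3]
        simp } with hP
  refine measure_mono_null (t := (P : Set (Space d))) hzero
    (Measure.addHaar_affineSubspace volume P fun htop => ?_)
  have hall (x : Space d) : hK.basis.coord a (stPoint t x) = 0 := by
    have : x ∈ P := htop ▸ AffineSubspace.mem_top ℝ _ x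
    exact this
  have hlin (w : SpaceTime d) : (hK.basis.coord a).linear w =
      w 0 * (hK.basis.coord a).linear (stPoint 1 0) := by
    have h1 : w = w 0 • stPoint 1 0 + (stPoint t (spacePart w) - stPoint t 0) := by
      ext i
      refine Fin.cases ?_ (fun i => ?_) i <;> simp
    conv_lhs => rw [h1]
    rw [map_add, map_smul, coord_linear_sub, hall, hall, sub_self, add_zero, smul_eq_mul]
  have h1 : (hK.basis.coord a).linear (hK.basis c - stPoint t (spacePart (hK.basis c))) = 0 := by
    rw [coord_linear_sub, hall, hK.basis.coord_apply_ne hca.symm, sub_zero]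
  rw [hlin] at h1
  have h2 : (hK.basis.coord a).linear (stPoint 1 0) = 0 := by
    refine (mul_eq_zero.1 h1).resolve_left fun h => hct ?_
    simpa [sub_eq_zero] using h
  have h3 := coord_linear_sub hK.basis a (hK.basis a) (hK.basis c)
  rw [hlin, h2, mul_zero, hK.basis.coord_apply_eq, hK.basis.coord_apply_ne hca.symm] at h3
  norm_num at h3

open Classical in
/-- The integral over the facets of a cell at an extremal time `t` is the integral over its
section. -/
lemma sum_integral_horizontal (hK : IsCell K) {s t : ℝ} (hs : s ^ 2 = 1)
    (hle : ∀ y ∈ K, s * y 0 ≤ s * t) (f : SpaceTime d → ℝ) :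
    ∑ S ∈ allFacets K, (if ∀ y ∈ S, y 0 = t then ∫ y, f y ∂(facetMeasure S) else 0) =
      ∫ x in cellSection K t, f (stPoint t x) := by
  by_cases h : ∃ S ∈ allFacets K, ∀ y ∈ S, y 0 = t
  · obtain ⟨S, hS, hSt⟩ := h
    obtain ⟨a, rfl⟩ := hK.exists_eq_oppFacet hS
    obtain ⟨hat, -, hhull⟩ := hK.horizontal_facet a hs hle hSt
    rw [Finset.sum_eq_single_of_mem _ hS, if_pos hSt, integral_facetMeasure_section hhull]
    intro S' hS' hne
    refine if_neg fun h' => hne ?_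
    obtain ⟨c, rfl⟩ := hK.exists_eq_oppFacet hS'
    by_contra hac
    refine hat (h' a (mem_oppFacet.2 ⟨fun h => hac ?_, a.2⟩))
    rw [h]
  · push Not at h
    have h0 : ∀ S ∈ allFacets K, ¬ ∀ y ∈ S, y 0 = t := fun S hS h' => by
      obtain ⟨y, hy, hyt⟩ := h S hS
      exact hyt (h' y hy)
    rw [Finset.sum_eq_zero fun S hS => if_neg (h0 S hS), Measure.restrict_eq_zero.2
      (hK.volume_cellSection_eq_zero hs hle h0), integral_zero_measure]

end IsCell

end Sections

/-! ### Sections of the mesh and traces at the time levels -/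

section Tiling

variable {d : ℕ}

/-- A point in the interior of the section of a cell at an extremal time enters the interior of the
cell when it is moved in time. -/
lemma IsCell.eventually_stPoint_mem_interior {K : Finset (SpaceTime d)} (hK : IsCell K) {s t : ℝ}
    (hs : s ^ 2 = 1) (hle : ∀ y ∈ hull K, s * y 0 ≤ s * t) {x : Space d}
    (hx : x ∈ interior (cellSection K t)) :
    ∀ᶠ ε : ℝ in 𝓝[>] 0, stPoint (t - s * ε) x ∈ interior (hull K) := by
  set p := vertexCentroid K with hp
  have hpint : p ∈ interior (hull K) := by
    rw [hK.hull_eq, interior_baryCell]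
    exact fun a => hK.coord_centroid_pos a
  have hpt : 0 < s * t - s * p 0 := by
    have hcont : Continuous fun δ : ℝ => p + δ • (stPoint s 0 : SpaceTime d) := by fun_prop
    have h0 : ∀ᶠ δ : ℝ in 𝓝[>] 0, p + δ • (stPoint s 0 : SpaceTime d) ∈ interior (hull K) := by
      refine Filter.Eventually.filter_mono nhdsWithin_le_nhds
        (hcont.continuousAt.eventually_mem (isOpen_interior.mem_nhds ?_))
      simpa using hpint
    obtain ⟨δ, h1, h2⟩ := (h0.and self_mem_nhdsWithin).exists
    have h2 : 0 < δ := h2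
    have h3 := hle _ (interior_subset h1)
    simp at h3
    nlinarith
  set τ := s * t - s * p 0 with hτ
  have hcont : ContinuousAt (fun ε : ℝ => x + (ε / τ / (1 - ε / τ)) • (x - spacePart p)) 0 := by
    have h0 : ContinuousAt (fun ε : ℝ => ε / τ / (1 - ε / τ)) 0 :=
      ContinuousAt.div (by fun_prop) (by fun_prop) (by simp)
    fun_prop
  have h1 : ∀ᶠ ε : ℝ in 𝓝[>] 0,
      x + (ε / τ / (1 - ε / τ)) • (x - spacePart p) ∈ cellSection K t := by
    refine Filter.Eventually.filter_mono nhdsWithin_le_nhds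
      (hcont.eventually_mem (mem_interior_iff_mem_nhds.1 ?_))
    simpa using hx
  filter_upwards [h1, Ioo_mem_nhdsGT hpt] with ε h2 hε
  have hη : 0 < ε / τ := div_pos hε.1 hpt
  have hη1 : 0 < 1 - ε / τ := by
    rw [sub_pos, div_lt_one hpt]; exact hε.2
  have h3 := (convex_hull K).combo_interior_self_mem_interior hpint h2 hη hη1.le
    (add_sub_cancel _ _)
  convert h3 using 1
  conv_rhs => rw [← stPoint_eta p]
  rw [stPoint_combo]
  congr 1
  · have h4 : t - p 0 = s * τ := by
      rw [hτ]; linear_combination (-(t - p 0)) * hs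
    have : ε / τ * p 0 + (1 - ε / τ) * t = t - ε / τ * (t - p 0) := by ring
    rw [this, h4]
    field_simp
  · generalize ε / τ = η at hη1
    ext i
    simp
    field_simp
    ring

lemma ae_mem_interior_cellSection (K : Finset (SpaceTime d)) (t : ℝ) :
    ∀ᵐ x ∂(volume.restrict (cellSection K t)), x ∈ interior (cellSection K t) := by
  rw [ae_restrict_iff' (isClosed_cellSection K t).measurableSet]
  have h := (convex_cellSection K t).addHaar_frontier volume
  filter_upwards [compl_mem_ae_iff.2 h] with x hx hxK
  by_contra hni
  exact hx ⟨subset_closure hxK, hni⟩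

namespace SlabMesh

variable {M : SlabMesh d} {Ω : ℝ → Set (Space d)} {t₀ t₁ : ℝ}

lemma Triangulates.time_mem (h : M.Triangulates Ω t₀ t₁) {K : Finset (SpaceTime d)}
    (hK : K ∈ M.cells) {y : SpaceTime d} (hy : y ∈ hull K) : y 0 ∈ Set.Icc t₀ t₁ := by
  have : y ∈ ⋃ K ∈ M.cells, hull K := Set.mem_biUnion hK hy
  rw [h.cover] at this
  exact this.1

lemma Triangulates.le_top (h : M.Triangulates Ω t₀ t₁) {K : Finset (SpaceTime d)}
    (hK : K ∈ M.cells) : ∀ y ∈ hull K, (1 : ℝ) * y 0 ≤ 1 * t₁ := fun y hy => by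
  have := (h.time_mem hK hy).2; linarith

lemma Triangulates.le_bottom (h : M.Triangulates Ω t₀ t₁) {K : Finset (SpaceTime d)}
    (hK : K ∈ M.cells) : ∀ y ∈ hull K, (-1 : ℝ) * y 0 ≤ -1 * t₀ := fun y hy => by
  have := (h.time_mem hK hy).1; linarith

lemma Triangulates.iUnion_cellSection (h : M.Triangulates Ω t₀ t₁) {t : ℝ}
    (ht : t ∈ Set.Icc t₀ t₁) : ⋃ K ∈ M.cells, cellSection K t = closure (Ω t) := by
  ext x
  have := Set.ext_iff.1 h.cover (stPoint t x)
  simp only [Set.mem_iUnion, Set.mem_ofPred_eq, stPoint_apply_zero, spacePart_stPoint] at this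
  simp only [Set.mem_iUnion, cellSection, Set.mem_ofPred_eq]
  rw [this]
  simp [ht.1, ht.2]

lemma aedisjoint_cellSection {s t : ℝ} (hs : s ^ 2 = 1)
    (hle : ∀ K ∈ M.cells, ∀ y ∈ hull K, s * y 0 ≤ s * t) {K K' : Finset (SpaceTime d)}
    (hK : K ∈ M.cells) (hK' : K' ∈ M.cells) (hne : K ≠ K') :
    AEDisjoint volume (cellSection K t) (cellSection K' t) := by
  have h1 := (convex_cellSection K t).addHaar_frontier volume
  have h2 := (convex_cellSection K' t).addHaar_frontier volume
  refine measure_mono_null (fun x hx => ?_) (measure_union_null h1 h2)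
  by_contra hcon
  rw [Set.mem_union, not_or] at hcon
  have e1 : x ∈ interior (cellSection K t) := by
    by_contra hni; exact hcon.1 ⟨subset_closure hx.1, hni⟩
  have e2 : x ∈ interior (cellSection K' t) := by
    by_contra hni; exact hcon.2 ⟨subset_closure hx.2, hni⟩
  obtain ⟨ε, h3, h4⟩ := (((M.isCell hK).eventually_stPoint_mem_interior hs (hle K hK) e1).and
    ((M.isCell hK').eventually_stPoint_mem_interior hs (hle K' hK') e2)).exists
  exact Set.disjoint_left.1 (interior_inter_hull hK hK' hne) h3 (interior_subset h4)

end SlabMesh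

lemma IsPolyhedralDomain.ae_eq_closure {Ω : Set (Space d)} (h : IsPolyhedralDomain Ω) :
    Ω =ᵐ[volume] closure Ω := by
  obtain ⟨H, hH, hsub⟩ := h.frontier_subset
  have hnull : volume (frontier Ω) = 0 := by
    refine measure_mono_null hsub ((measure_biUnion_null_iff H.countable_toSet).2 fun P hP => ?_)
    exact Measure.addHaar_affineSubspace volume P (hH P hP)
  exact (closure_ae_eq_of_null_frontier hnull).symm

namespace SlabMesh

variable {M : SlabMesh d} {Ω : ℝ → Set (Space d)} {t₀ t₁ : ℝ}

/-- The sections of the cells tile the domain at the times where the slab begins and ends. -/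
lemma Triangulates.restrict_eq_sum (h : M.Triangulates Ω t₀ t₁) {s t : ℝ} (hs : s ^ 2 = 1)
    (hle : ∀ K ∈ M.cells, ∀ y ∈ hull K, s * y 0 ≤ s * t) (ht : t ∈ Set.Icc t₀ t₁)
    (hΩ : IsPolyhedralDomain (Ω t)) :
    volume.restrict (Ω t) = Measure.sum fun K : M.cells => volume.restrict (cellSection K t) := by
  have hU : ⋃ K ∈ M.cells, cellSection K t = ⋃ K : M.cells, cellSection (K : Finset _) t := by
    ext; simp
  rw [Measure.restrict_congr_set hΩ.ae_eq_closure, ← h.iUnion_cellSection ht, hU]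
  refine Measure.restrict_iUnion_ae ?_ ?_
  · intro K K' hne
    exact aedisjoint_cellSection hs hle K.2 K'.2 fun h => hne (Subtype.ext h)
  · intro K
    exact (isClosed_cellSection K.1 t).measurableSet.nullMeasurableSet

lemma velocity_eq {K : Finset (SpaceTime d)} (hK : K ∈ M.cells) (u : VelocityPair d)
    {y : SpaceTime d} (hy : y ∈ interior (hull K)) : M.velocity u y = u.cell K y := by
  classical
  have hex : ∃ K ∈ M.cells, y ∈ interior (hull K) := ⟨K, hK, hy⟩
  rw [velocity, dif_pos hex]
  have h1 := hex.choose_spec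
  congr 1
  by_contra hne
  exact Set.disjoint_left.1 (interior_inter_hull h1.1 hK hne) h1.2 (interior_subset hy)

lemma Triangulates.traceBelow_eq (h : M.Triangulates Ω t₀ t₁) {K : Finset (SpaceTime d)}
    (hK : K ∈ M.cells) {u : VelocityPair d} (hu : Continuous (u.cell K)) {x : Space d}
    (hx : x ∈ interior (cellSection K t₁)) :
    M.traceBelow t₁ u x = u.cell K (stPoint t₁ x) := by
  refine Tendsto.limUnder_eq ?_
  have hcont : Continuous fun ε : ℝ => u.cell K (stPoint (t₁ - ε) x) :=
    hu.comp (continuous_stPoint.comp (f := fun ε : ℝ => (t₁ - ε, x)) (by fun_prop))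
  have hlim := hcont.tendsto 0
  rw [sub_zero] at hlim
  refine (hlim.mono_left nhdsWithin_le_nhds).congr' ?_
  filter_upwards [(M.isCell hK).eventually_stPoint_mem_interior (by norm_num) (h.le_top hK) hx]
    with ε hε
  rw [one_mul] at hε
  exact (velocity_eq hK u hε).symm

lemma Triangulates.traceBelow_ae_eq (h : M.Triangulates Ω t₀ t₁) {K : Finset (SpaceTime d)}
    (hK : K ∈ M.cells) {u : VelocityPair d} (hu : Continuous (u.cell K)) :
    M.traceBelow t₁ u =ᵐ[volume.restrict (cellSection K t₁)]
      fun x => u.cell K (stPoint t₁ x) := by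
  filter_upwards [ae_mem_interior_cellSection K t₁] with x hx
  exact h.traceBelow_eq hK hu hx

lemma memLp_cellSection {K : Finset (SpaceTime d)} {v : SpaceTime d → Space d} (hv : Continuous v)
    (t : ℝ) : MemLp (fun x => v (stPoint t x)) 2 (volume.restrict (cellSection K t)) := by
  have hc : Continuous fun x => v (stPoint t x) := hv.comp (isometry_stPoint t).continuous
  rw [memLp_two_iff_integrable_sq_norm hc.aestronglyMeasurable]
  exact (hc.norm.pow 2).continuousOn.integrableOn_compact (isCompact_cellSection K t)

lemma Triangulates.memLp_of_sections (h : M.Triangulates Ω t₀ t₁) {s t : ℝ} (hs : s ^ 2 = 1)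
    (hle : ∀ K ∈ M.cells, ∀ y ∈ hull K, s * y 0 ≤ s * t) (ht : t ∈ Set.Icc t₀ t₁)
    (hΩ : IsPolyhedralDomain (Ω t)) (f : Space d → Space d) :
    MemLp f 2 (volume.restrict (Ω t)) ↔
      ∀ K ∈ M.cells, MemLp f 2 (volume.restrict (cellSection K t)) := by
  have hres := h.restrict_eq_sum hs hle ht hΩ
  have hmeas : AEStronglyMeasurable f (volume.restrict (Ω t)) ↔
      ∀ K : M.cells, AEStronglyMeasurable f (volume.restrict (cellSection K t)) := by
    rw [hres, aestronglyMeasurable_sum_measure_iff]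
  have hint : Integrable (fun x => ‖f x‖ ^ 2) (volume.restrict (Ω t)) ↔
      ∀ K : M.cells, Integrable (fun x => ‖f x‖ ^ 2) (volume.restrict (cellSection K t)) := by
    rw [hres, Measure.sum_fintype, integrable_finsetSum_measure]
    simp
  constructor
  · intro hf K hK
    have h1 := hf.aestronglyMeasurable
    rw [memLp_two_iff_integrable_sq_norm (hmeas.1 h1 ⟨K, hK⟩)]
    exact hint.1 ((memLp_two_iff_integrable_sq_norm h1).1 hf) ⟨K, hK⟩
  · intro hf
    have h1 := hmeas.2 fun K => (hf K K.2).aestronglyMeasurable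
    rw [memLp_two_iff_integrable_sq_norm h1]
    exact hint.2 fun K => (memLp_two_iff_integrable_sq_norm
      (hf K K.2).aestronglyMeasurable).1 (hf K K.2)

lemma Triangulates.integral_eq_sum (h : M.Triangulates Ω t₀ t₁) {s t : ℝ} (hs : s ^ 2 = 1)
    (hle : ∀ K ∈ M.cells, ∀ y ∈ hull K, s * y 0 ≤ s * t) (ht : t ∈ Set.Icc t₀ t₁)
    (hΩ : IsPolyhedralDomain (Ω t)) {f : Space d → ℝ}
    (hf : IntegrableOn f (Ω t)) :
    ∫ x in Ω t, f x = ∑ K ∈ M.cells, ∫ x in cellSection K t, f x := by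
  have hres := h.restrict_eq_sum hs hle ht hΩ
  rw [IntegrableOn, hres] at hf
  rw [hres, integral_sum_measure hf, tsum_fintype,
    Finset.sum_coe_sort M.cells fun K => ∫ x in cellSection K t, f x]

end SlabMesh

end Tiling

/-! ### Polynomial functions on space-time -/

section Polynomials

variable {d : ℕ}

lemma hasFDerivAt_mvPolynomial (P : MvPolynomial (Fin (d + 1)) ℝ) (y : SpaceTime d) :
    HasFDerivAt (fun y : SpaceTime d => MvPolynomial.eval (fun i => y i) P)
      (∑ i, MvPolynomial.eval (fun i => y i) (MvPolynomial.pderiv i P) •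
        (EuclideanSpace.proj i : SpaceTime d →L[ℝ] ℝ)) y := by
  induction P using MvPolynomial.induction_on with
  | C a =>
    simp only [MvPolynomial.eval_C, MvPolynomial.pderiv_C, map_zero, zero_smul,
      Finset.sum_const_zero]
    exact hasFDerivAt_const a y
  | add p q hp hq =>
    simp only [map_add, add_smul, Finset.sum_add_distrib]
    exact hp.add hq
  | mul_X p n hp =>
    simp only [map_mul, MvPolynomial.eval_X]
    have h1 : HasFDerivAt (fun y : SpaceTime d => y n)
        (EuclideanSpace.proj n : SpaceTime d →L[ℝ] ℝ) y :=
      (EuclideanSpace.proj n : SpaceTime d →L[ℝ] ℝ).hasFDerivAt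
    refine (hp.mul h1).congr_fderiv (ContinuousLinearMap.ext fun w => ?_)
    simp only [MvPolynomial.pderiv_mul, map_add, map_mul, MvPolynomial.eval_X,
      MvPolynomial.pderiv_X, _root_.sum_apply, _root_.add_apply, _root_.smul_apply, smul_eq_mul,
      add_mul, Finset.sum_add_distrib, Finset.mul_sum, PiLp.proj_apply]
    rw [add_comm]
    congr 1
    · exact Finset.sum_congr rfl fun i _ => by ring
    · rw [Finset.sum_eq_single n]
      · simp
      · intro i _ hi
        simp [hi.symm]
      · simp

lemma totalDegree_pderiv_le (P : MvPolynomial (Fin (d + 1)) ℝ) (i : Fin (d + 1)) :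
    (MvPolynomial.pderiv i P).totalDegree ≤ P.totalDegree - 1 := by
  classical
  refine Finset.sup_le fun m hm => ?_
  rw [MvPolynomial.mem_support_iff, MvPolynomial.coeff_pderiv] at hm
  have h1 := MvPolynomial.le_totalDegree
    (MvPolynomial.mem_support_iff.2 (left_ne_zero_of_mul hm))
  have h2 : ((m + Finsupp.single i 1).sum fun _ e => e) = (m.sum fun _ e => e) + 1 := by
    rw [Finsupp.sum_add_index' (by simp) (by simp), Finsupp.sum_single_index rfl]
  omega

namespace IsPolyFun

variable {l : ℕ} {p q : SpaceTime d → ℝ}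

lemma contDiff (hq : IsPolyFun l q) : ContDiff ℝ ⊤ q := by
  obtain ⟨P, -, hP⟩ := hq
  have : q = fun y => MvPolynomial.eval (fun i => y i) P := funext hP
  rw [this]
  clear this hP
  induction P using MvPolynomial.induction_on with
  | C a => simpa using contDiff_const
  | add p q hp hq => simpa using hp.add hq
  | mul_X p n hp =>
    simp only [map_mul, MvPolynomial.eval_X]
    exact hp.mul (by fun_prop)

lemma mono {m : ℕ} (hq : IsPolyFun l q) (h : l ≤ m) : IsPolyFun m q := by
  obtain ⟨P, h1, hP⟩ := hq
  exact ⟨P, h1.trans h, hP⟩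

lemma zero : IsPolyFun l (fun _ : SpaceTime d => 0) := ⟨0, by simp, by simp⟩

lemma add (hp : IsPolyFun l p) (hq : IsPolyFun l q) : IsPolyFun l (fun y => p y + q y) := by
  obtain ⟨P, hP, hP'⟩ := hp
  obtain ⟨Q, hQ, hQ'⟩ := hq
  exact ⟨P + Q, (MvPolynomial.totalDegree_add P Q).trans (max_le hP hQ), fun y => by
    simp only [hP', hQ', map_add]⟩

lemma const_mul (c : ℝ) (hp : IsPolyFun l p) : IsPolyFun l (fun y => c * p y) := by
  obtain ⟨P, hP, hP'⟩ := hp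
  refine ⟨MvPolynomial.C c * P, ?_, fun y => by
    simp only [hP', map_mul, MvPolynomial.eval_C]⟩
  refine (MvPolynomial.totalDegree_mul _ _).trans ?_
  rw [MvPolynomial.totalDegree_C, zero_add]
  exact hP

lemma sub (hp : IsPolyFun l p) (hq : IsPolyFun l q) : IsPolyFun l (fun y => p y - q y) := by
  simpa [sub_eq_add_neg] using hp.add (hq.const_mul (-1))

lemma sum {ι : Type*} (s : Finset ι) {f : ι → SpaceTime d → ℝ}
    (h : ∀ i ∈ s, IsPolyFun l (f i)) : IsPolyFun l (fun y => ∑ i ∈ s, f i y) := by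
  classical
  induction s using Finset.induction_on with
  | empty => simpa using zero
  | insert a s ha ih =>
    simp only [Finset.sum_insert ha]
    exact (h a (by simp)).add (ih fun i hi => h i (by simp [hi]))

lemma fderiv_apply (hq : IsPolyFun l q) (w : SpaceTime d) :
    IsPolyFun (l - 1) (fun y => fderiv ℝ q y w) := by
  obtain ⟨P, hP, hP'⟩ := hq
  have hq : q = fun y => MvPolynomial.eval (fun i => y i) P := funext hP'
  have : (fun y => fderiv ℝ q y w) = fun y =>
      ∑ i, w i * MvPolynomial.eval (fun i => y i) (MvPolynomial.pderiv i P) := by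
    funext y
    rw [hq, (hasFDerivAt_mvPolynomial P y).fderiv]
    simp [mul_comm]
  rw [this]
  exact sum _ fun i _ => const_mul _
    ⟨_, (totalDegree_pderiv_le P i).trans (Nat.sub_le_sub_right hP 1), fun _ => rfl⟩

/-- The restriction of a polynomial function to a line. -/
lemma exists_polynomial_line (hq : IsPolyFun l q) (y e : SpaceTime d) :
    ∃ p : Polynomial ℝ, p.natDegree ≤ l ∧ ∀ t : ℝ, q (y + t • e) = p.eval t := by
  obtain ⟨P, hP, hP'⟩ := hq
  refine ⟨MvPolynomial.aeval (fun i => Polynomial.C (y i) + Polynomial.C (e i) * Polynomial.X) P,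
    ?_, fun t => ?_⟩
  · have := MvPolynomial.aeval_natDegree_le (n := 1) P hP
      (fun i => Polynomial.C (y i) + Polynomial.C (e i) * Polynomial.X) fun i => by
        compute_degree
    simpa using this
  · rw [hP']
    clear hP hP'
    induction P using MvPolynomial.induction_on with
    | C a => simp
    | add p q hp hq => simp only [map_add, Polynomial.eval_add, hp, hq]
    | mul_X p n hp =>
      rw [map_mul, map_mul, Polynomial.eval_mul, hp, MvPolynomial.eval_X, MvPolynomial.aeval_X]
      simp [mul_comm t]

end IsPolyFun

lemma fderiv_coord {v : SpaceTime d → Space d} {y : SpaceTime d} (hv : DifferentiableAt ℝ v y)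
    (w : SpaceTime d) (i : Fin d) : fderiv ℝ v y w i = fderiv ℝ (fun y => v y i) y w := by
  have h := ((EuclideanSpace.proj i : Space d →L[ℝ] ℝ).hasFDerivAt (x := v y)).comp y
    hv.hasFDerivAt
  have h2 : HasFDerivAt (fun y => v y i)
    ((EuclideanSpace.proj i : Space d →L[ℝ] ℝ).comp (fderiv ℝ v y)) y := h
  rw [h2.fderiv]
  rfl

namespace IsVecPoly

variable {l : ℕ} {v : SpaceTime d → Space d}

lemma contDiff (hv : IsVecPoly l v) : ContDiff ℝ ⊤ v :=
  contDiff_euclidean.2 fun i => (hv i).contDiff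

lemma continuous (hv : IsVecPoly l v) : Continuous v := hv.contDiff.continuous

lemma fderiv_coord (hv : IsVecPoly l v) (y w : SpaceTime d) (i : Fin d) :
    fderiv ℝ v y w i = fderiv ℝ (fun y => v y i) y w :=
  _root_.fderiv_coord (hv.contDiff.differentiable (by simp) y) w i

lemma isPolyFun_spaceDeriv (hv : IsVecPoly l v) (ξ : Space d) (i : Fin d) :
    IsPolyFun (l - 1) (fun y => spaceDeriv v y ξ i) := by
  simp only [spaceDeriv, hv.fderiv_coord]
  exact (hv i).fderiv_apply _

lemma isPolyFun_spaceDiv (hv : IsVecPoly l v) : IsPolyFun (l - 1) (spaceDiv v) :=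
  IsPolyFun.sum _ fun j _ => hv.isPolyFun_spaceDeriv _ j

lemma isPolyFun_inner (hv : IsVecPoly l v) (ξ : Space d) :
    IsPolyFun l (fun y => inner ℝ (v y) ξ) := by
  simp only [PiLp.inner_apply]
  exact IsPolyFun.sum _ fun j _ => by simpa using (hv j).const_mul (ξ j)

lemma sub {v' : SpaceTime d → Space d} (hv : IsVecPoly l v) (hv' : IsVecPoly l v') :
    IsVecPoly l (fun y => v y - v' y) := fun i => (hv i).sub (hv' i)

lemma zero : IsVecPoly l (fun _ : SpaceTime d => (0 : Space d)) := fun _ => IsPolyFun.zero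

@[fun_prop]
lemma continuous_fderiv (hv : IsVecPoly l v) : Continuous (fderiv ℝ v) :=
  hv.contDiff.continuous_fderiv (by simp)

end IsVecPoly

lemma stPoint_zero_eq_sum (ξ : Space d) :
    stPoint 0 ξ = ∑ j, ξ j • stPoint 0 (EuclideanSpace.single j (1 : ℝ)) := by
  ext i
  rw [WithLp.ofLp_sum, Finset.sum_apply]
  refine Fin.cases ?_ (fun i => ?_) i
  · simp
  · simp

lemma spaceDeriv_eq_sum (v : SpaceTime d → Space d) (y : SpaceTime d) (ξ : Space d) :
    spaceDeriv v y ξ = ∑ j, ξ j • spaceDeriv v y (EuclideanSpace.single j 1) := by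
  rw [spaceDeriv, stPoint_zero_eq_sum, map_sum]
  simp [spaceDeriv]

end Polynomials

/-! ### Solutions are divergence-free and `H(div)`-conforming -/

namespace SlabMesh

variable {d : ℕ} {M : SlabMesh d} {k : ℕ} {ν α t₀ t₁ : ℝ} {um : Space d → Space d}
  {w u : VelocityPair d} {p : PressurePair d}

lemma SolvesPicardStep.bForm_eq_zero
    (h : M.SolvesPicardStep k ν α t₀ t₁ (fun _ => 0) (fun _ => 0) um w u p)
    {q : PressurePair d} (hq : M.MemQ k q) : M.bForm q u = 0 := by
  have hV : M.MemV k ⟨fun _ _ => 0, fun _ _ => 0⟩ :=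
    ⟨fun _ _ => IsVecPoly.zero, fun _ _ _ _ => IsVecPoly.zero, fun _ _ _ _ _ _ => rfl⟩
  have := h.equation ⟨fun _ _ => 0, fun _ _ => 0⟩ q hV hq
  have hsd : ∀ (y : SpaceTime d) (ξ : Space d),
      spaceDeriv (fun _ : SpaceTime d => (0 : Space d)) y ξ = 0 := fun y ξ => by
    simp [spaceDeriv]
  have htd : ∀ y : SpaceTime d, timeDeriv (fun _ : SpaceTime d => (0 : Space d)) y = 0 :=
    fun y => by simp [timeDeriv]
  have hdiv : ∀ y : SpaceTime d, spaceDiv (fun _ : SpaceTime d => (0 : Space d)) y = 0 :=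
    fun y => by simp [spaceDiv, hsd]
  simp [tForm, aForm, bForm, rhsForm, gradDot, hsd, htd, hdiv] at this
  rw [bForm]
  linarith

lemma integrable_jump {u : VelocityPair d} (hu : M.MemV k u) {K S : Finset (SpaceTime d)}
    (hK : K ∈ M.cells) (hS : S ∈ lateralFacets K) {g : SpaceTime d → ℝ} (hg : Continuous g) :
    Integrable (fun y => inner ℝ (u.cell K y - u.facet S y) (normalX K S) * g y)
      (facetMeasure S) := by
  have h1 := (hu.cell K hK).continuous
  have h2 := (hu.facet K hK S hS).continuous
  exact (M.isCell hK).integrable_facetMeasure (lateral_subset hS) (by fun_prop)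

theorem SolvesPicardStep.divFreeConforming
    (h : M.SolvesPicardStep k ν α t₀ t₁ (fun _ => 0) (fun _ => 0) um w u p) :
    M.DivFreeConforming u := by
  have hu := h.memV
  -- The divergence itself is an admissible pressure, because its degree is at most `k - 1`.
  have hdiv : ∀ K ∈ M.cells, ∀ y ∈ hull K, spaceDiv (u.cell K) y = 0 := by
    have hq : M.MemQ k ⟨fun K => spaceDiv (u.cell K), fun _ _ => 0⟩ :=
      ⟨fun K hK => (hu.cell K hK).isPolyFun_spaceDiv, fun _ _ _ _ => IsPolyFun.zero⟩
    have h1 := h.bForm_eq_zero hq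
    simp only [bForm, mul_zero, integral_zero, Finset.sum_const_zero, add_zero, neg_eq_zero,
      ← sq] at h1
    rw [Finset.sum_eq_zero_iff_of_nonneg
      fun K _ => integral_nonneg fun y => sq_nonneg _] at h1
    exact fun K hK => (M.isCell hK).eq_zero_of_integral_sq
      (hu.cell K hK).isPolyFun_spaceDiv.contDiff.continuous (h1 K hK)
  -- So is the jump of the normal component over a facet, as a facet pressure.
  set J : Finset (SpaceTime d) → SpaceTime d → ℝ := fun S y =>
    ∑ K ∈ M.cellsOf S, inner ℝ (u.cell K y - u.facet S y) (normalX K S) with hJ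
  have hJp : ∀ S, IsPolyFun k (J S) := fun S => IsPolyFun.sum _ fun K hK => by
    obtain ⟨hK, hS⟩ := mem_cellsOf.1 hK
    exact ((hu.cell K hK).sub (hu.facet K hK S hS)).isPolyFun_inner _
  have hJ0 : ∀ K ∈ M.cells, ∀ S ∈ lateralFacets K, ∀ y ∈ hull S, J S y = 0 := by
    have hq : M.MemQ k ⟨fun _ _ => 0, J⟩ :=
      ⟨fun _ _ => IsPolyFun.zero, fun _ _ S _ => hJp S⟩
    have h1 := h.bForm_eq_zero hq
    simp only [bForm, zero_mul, integral_zero, Finset.sum_const_zero, neg_zero, zero_add] at h1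
    rw [M.sum_lateral_comm] at h1
    have h2 : ∀ S ∈ M.laterals, ∑ K ∈ M.cellsOf S,
        ∫ y, inner ℝ (u.cell K y - u.facet S y) (normalX K S) * J S y ∂(facetMeasure S) =
        ∫ y, J S y ^ 2 ∂(facetMeasure S) := by
      intro S _
      rw [← integral_finsetSum]
      · simp only [hJ, ← Finset.sum_mul, sq]
      · intro K hK
        obtain ⟨hK, hS⟩ := mem_cellsOf.1 hK
        exact integrable_jump hu hK hS (hJp S).contDiff.continuous
    rw [Finset.sum_congr rfl h2, Finset.sum_eq_zero_iff_of_nonneg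
      fun S _ => integral_nonneg fun y => sq_nonneg _] at h1
    exact fun K hK S hS => (M.isCell hK).eq_zero_of_integral_sq_facet (lateral_subset hS)
      (hJp S).contDiff.continuous (h1 S (mem_laterals.2 ⟨K, hK, hS⟩))
  refine ⟨hdiv, fun K hK K' hK' hne S hS hS' y hy => ?_, fun K S hb y hy => ?_⟩
  · rcases boundary_or_pair hK hS with ⟨hb, -⟩ | ⟨L, hL, hKL, hSL, -, -, hsum⟩
    · exact absurd (hb.2.2 K' hK' (Finset.mem_powersetCard.1 (lateral_subset hS')).1) hne.symm
    · have hLK' : L = K' := by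
        have h1 := hsum fun L' => if L' = K' then 1 else 0
        rw [Finset.sum_ite_eq', if_pos (mem_cellsOf.2 ⟨hK', hS'⟩), if_neg hne, zero_add] at h1
        by_contra hcon
        rw [if_neg hcon] at h1
        exact one_ne_zero h1
      subst hLK'
      have h1 := hJ0 K hK S hS y hy
      rw [hJ] at h1
      simp only [hsum, inner_sub_left] at h1
      rw [normalX_eq_neg hK hL hKL (lateral_subset hS) (lateral_subset hSL)] at h1 ⊢
      simp only [inner_neg_right] at h1 ⊢
      linarith
  · rcases boundary_or_pair hb.1 hb.2.1 with ⟨-, hc⟩ | ⟨-, -, -, -, hnb, -⟩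
    · have h1 := hJ0 K hb.1 S hb.2.1 y hy
      rw [hJ] at h1
      simp only [hc, Finset.sum_singleton, inner_sub_left] at h1
      linarith
    · exact absurd hb (hnb K)

end SlabMesh

/-! ### Coercivity of the diffusive form -/

section Coercivity

variable {d : ℕ}

lemma gradDot_self (u : SpaceTime d → Space d) (y : SpaceTime d) :
    gradDot u u y = ∑ j, ‖spaceDeriv u y (EuclideanSpace.single j 1)‖ ^ 2 := by
  simp [gradDot]

lemma gradDot_self_nonneg (u : SpaceTime d → Space d) (y : SpaceTime d) : 0 ≤ gradDot u u y := by
  rw [gradDot_self]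
  exact Finset.sum_nonneg fun _ _ => sq_nonneg _

lemma norm_spaceDeriv_sq_le (u : SpaceTime d → Space d) (y : SpaceTime d) {ξ : Space d}
    (hξ : ‖ξ‖ ≤ 1) : ‖spaceDeriv u y ξ‖ ^ 2 ≤ gradDot u u y := by
  rw [gradDot_self, spaceDeriv_eq_sum]
  have h1 : ‖∑ j, ξ j • spaceDeriv u y (EuclideanSpace.single j 1)‖ ≤
      ∑ j, |ξ j| * ‖spaceDeriv u y (EuclideanSpace.single j 1)‖ :=
    (norm_sum_le _ _).trans (le_of_eq (by simp [norm_smul]))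
  have h2 := Finset.sum_mul_sq_le_sq_mul_sq Finset.univ (fun j => |ξ j|)
    (fun j => ‖spaceDeriv u y (EuclideanSpace.single j 1)‖)
  have h3 : ∑ j, |ξ j| ^ 2 ≤ 1 := by
    have := EuclideanSpace.norm_sq_eq ξ
    simp only [Real.norm_eq_abs] at this
    rw [← this]
    nlinarith [norm_nonneg ξ]
  have h4 : 0 ≤ ∑ j, ‖spaceDeriv u y (EuclideanSpace.single j 1)‖ ^ 2 :=
    Finset.sum_nonneg fun _ _ => sq_nonneg _
  calc _ ≤ (∑ j, |ξ j| * ‖spaceDeriv u y (EuclideanSpace.single j 1)‖) ^ 2 :=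
        pow_le_pow_left₀ (norm_nonneg _) h1 2
    _ ≤ _ := h2
    _ ≤ _ := by nlinarith

lemma IsVecPoly.continuous_spaceDeriv {l : ℕ} {v : SpaceTime d → Space d} (hv : IsVecPoly l v)
    {ξ : SpaceTime d → Space d} (hξ : Continuous ξ) :
    Continuous fun y => spaceDeriv v y (ξ y) := by
  have h : Continuous fun y => (stPoint 0 (ξ y) : SpaceTime d) :=
    continuous_stPoint.comp (f := fun y => ((0 : ℝ), ξ y)) (by fun_prop)
  exact hv.continuous_fderiv.clm_apply h

lemma IsVecPoly.continuous_gradDot {l : ℕ} {v : SpaceTime d → Space d} (hv : IsVecPoly l v) :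
    Continuous (gradDot v v) :=
  continuous_finsetSum _ fun _ _ => (hv.continuous_spaceDeriv continuous_const).inner
    (hv.continuous_spaceDeriv continuous_const)

/-- The discrete trace inequality for the gradient of a vector-valued polynomial. -/
lemma IsCell.trace_gradDot {K : Finset (SpaceTime d)} (hK : IsCell K) {k : ℕ} {C : ℝ} (hC0 : 0 < C)
    (hC : ∀ p : Polynomial ℝ, p.natDegree ≤ k →
      p.eval 0 ^ 2 ≤ C * ∫ t in (0 : ℝ)..1, p.eval t ^ 2)
    {c : SpaceTime d} {r σ : ℝ} (hr : 0 < r) (hball : Metric.closedBall c r ⊆ hull K)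
    (hσ : cellSize K ≤ σ * r) {v : SpaceTime d → Space d} (hv : IsVecPoly k v)
    {S : Finset (SpaceTime d)} (hS : S ∈ allFacets K) :
    cellSize K * ∫ y, gradDot v v y ∂(facetMeasure S) ≤
      C * (d + 2) * σ * ∫ y in hull K, gradDot v v y := by
  have hp (i j : Fin d) :=
    (hv.isPolyFun_spaceDeriv (EuclideanSpace.single j 1) i).mono (Nat.sub_le k 1)
  have hexp : gradDot v v = fun y => ∑ j, ∑ i,
      spaceDeriv v y (EuclideanSpace.single j 1) i ^ 2 := by
    funext y
    simp only [gradDot_self, EuclideanSpace.norm_sq_eq, Real.norm_eq_abs, sq_abs]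
  have hc (i j : Fin d) : Continuous fun y => spaceDeriv v y (EuclideanSpace.single j 1) i ^ 2 :=
    (hp i j).contDiff.continuous.pow 2
  have e1 : ∫ y, gradDot v v y ∂(facetMeasure S) = ∑ j, ∑ i,
      ∫ y, spaceDeriv v y (EuclideanSpace.single j 1) i ^ 2 ∂(facetMeasure S) := by
    rw [hexp, integral_finsetSum _ fun j _ => integrable_finsetSum _ fun i _ =>
      hK.integrable_facetMeasure hS (hc i j)]
    exact Finset.sum_congr rfl fun j _ => integral_finsetSum _ fun i _ =>
      hK.integrable_facetMeasure hS (hc i j)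
  have hint (i j : Fin d) : IntegrableOn
      (fun y => spaceDeriv v y (EuclideanSpace.single j 1) i ^ 2) (hull K) :=
    (hc i j).continuousOn.integrableOn_compact (isCompact_hull K)
  have e2 : ∫ y in hull K, gradDot v v y = ∑ j, ∑ i,
      ∫ y in hull K, spaceDeriv v y (EuclideanSpace.single j 1) i ^ 2 := by
    rw [hexp, integral_finsetSum _ fun j _ => integrable_finsetSum _ fun i _ => hint i j]
    exact Finset.sum_congr rfl fun j _ => integral_finsetSum _ fun i _ => hint i j
  rw [e1, e2]
  simp only [Finset.mul_sum]
  exact Finset.sum_le_sum fun j _ => Finset.sum_le_sum fun i _ =>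
    hK.trace_inequality hC0 hC hr hball hσ (hp i j).contDiff.continuous
      (hp i j).exists_polynomial_line hS

namespace SlabMesh

/-- For a large penalty parameter, the consistency terms of the diffusive form are absorbed by the
penalty terms and, through the discrete trace inequality, by the volume terms. -/
theorem aForm_self_nonneg {M : SlabMesh d} {k : ℕ} {C σ ν α : ℝ} (hC0 : 0 < C)
    (hC : ∀ p : Polynomial ℝ, p.natDegree ≤ k →
      p.eval 0 ^ 2 ≤ C * ∫ t in (0 : ℝ)..1, p.eval t ^ 2)
    (hM : M.ShapeRegular σ) (hν : 0 < ν) (hα0 : 0 < α) (hα : C * (d + 2) ^ 2 * |σ| ≤ α)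
    {u : VelocityPair d} (hu : M.MemV k u) : 0 ≤ M.aForm ν α u u := by
  rw [aForm, ← Finset.sum_add_distrib, ← Finset.sum_sub_distrib]
  refine Finset.sum_nonneg fun K hK => ?_
  have hc := M.isCell hK
  have hh := hc.cellSize_pos
  set h := cellSize K with hhdef
  obtain ⟨c, r, hr, hball, hσ⟩ := hM K hK
  have huK := hu.cell K hK
  set G : ℝ := ∫ y in hull K, gradDot (u.cell K) (u.cell K) y with hG
  have hG0 : 0 ≤ G := integral_nonneg fun y => gradDot_self_nonneg _ y
  have hfacet : ∀ S ∈ lateralFacets K,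
      (∫ y, ν * (inner ℝ (u.cell K y - u.facet S y) (spaceDeriv (u.cell K) y (normalX K S))
        + inner ℝ (spaceDeriv (u.cell K) y (normalX K S)) (u.cell K y - u.facet S y))
      ∂(facetMeasure S)) ≤ (∫ y, ν * α / h *
        inner ℝ (u.cell K y - u.facet S y) (u.cell K y - u.facet S y) ∂(facetMeasure S)) +
        ν / α * (C * (d + 2) * |σ| * G) := by
    intro S hS
    have hSa := lateral_subset hS
    have huS := hu.facet K hK S hS
    have hcont : Continuous fun y => u.cell K y - u.facet S y :=
      huK.continuous.sub huS.continuous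
    have hcontn : Continuous fun y => spaceDeriv (u.cell K) y (normalX K S) :=
      huK.continuous_spaceDeriv continuous_const
    have hpt : ∀ y, ν * (inner ℝ (u.cell K y - u.facet S y)
          (spaceDeriv (u.cell K) y (normalX K S))
        + inner ℝ (spaceDeriv (u.cell K) y (normalX K S)) (u.cell K y - u.facet S y)) ≤
        ν * α / h * inner ℝ (u.cell K y - u.facet S y) (u.cell K y - u.facet S y) +
        ν / α * (h * gradDot (u.cell K) (u.cell K) y) := by
      intro y
      set a := u.cell K y - u.facet S y
      set e := spaceDeriv (u.cell K) y (normalX K S) with he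
      have h1 : ‖e‖ ^ 2 ≤ gradDot (u.cell K) (u.cell K) y :=
        norm_spaceDeriv_sq_le _ y (hc.norm_normalX_le hSa)
      have h2 : inner ℝ a e ≤ ‖a‖ * ‖e‖ := real_inner_le_norm a e
      rw [real_inner_comm a e, real_inner_self_eq_norm_sq]
      have h3 : 2 * (‖a‖ * ‖e‖) ≤ α / h * ‖a‖ ^ 2 + h / α * ‖e‖ ^ 2 := by
        have h4 := sq_nonneg (α * ‖a‖ - h * ‖e‖)
        have h5 : α / h * ‖a‖ ^ 2 + h / α * ‖e‖ ^ 2 - 2 * (‖a‖ * ‖e‖) =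
            (α * ‖a‖ - h * ‖e‖) ^ 2 / (α * h) := by
          field_simp
          ring
        have h6 : 0 ≤ (α * ‖a‖ - h * ‖e‖) ^ 2 / (α * h) := by positivity
        linarith
      have h7 : h / α * ‖e‖ ^ 2 ≤ h / α * gradDot (u.cell K) (u.cell K) y :=
        mul_le_mul_of_nonneg_left h1 (by positivity)
      have h8 : inner ℝ a e + inner ℝ a e ≤
          α / h * ‖a‖ ^ 2 + h / α * gradDot (u.cell K) (u.cell K) y := by linarith
      have h9 := mul_le_mul_of_nonneg_left h8 hν.le
      calc _ ≤ _ := h9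
        _ = _ := by ring
    have hi1 := hc.integrable_facetMeasure hSa
      (f := fun y => ν * α / h * inner ℝ (u.cell K y - u.facet S y) (u.cell K y - u.facet S y))
      (by fun_prop)
    have hi2 := hc.integrable_facetMeasure hSa
      (f := fun y => ν / α * (h * gradDot (u.cell K) (u.cell K) y))
      (continuous_const.mul (continuous_const.mul huK.continuous_gradDot))
    refine (integral_mono (hc.integrable_facetMeasure hSa (by fun_prop)) (hi1.add hi2) hpt).trans ?_
    simp only [Pi.add_apply]
    rw [integral_add hi1 hi2, integral_const_mul (ν / α), integral_const_mul h]
    have htr := hc.trace_gradDot hC0 hC hr hball hσ huK hSa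
    have h10 : C * (d + 2) * σ * G ≤ C * (d + 2) * |σ| * G :=
      mul_le_mul_of_nonneg_right (mul_le_mul_of_nonneg_left (le_abs_self σ) (by positivity)) hG0
    have h11 := mul_le_mul_of_nonneg_left (htr.trans h10) (div_pos hν hα0).le
    linarith
  have hsum := Finset.sum_le_sum hfacet
  rw [Finset.sum_add_distrib, Finset.sum_const, nsmul_eq_mul] at hsum
  have hcard : ((lateralFacets K).card : ℝ) ≤ d + 2 := by
    have h1 : (lateralFacets K).card ≤ (allFacets K).card := Finset.card_filter_le _ _
    have h2 : (allFacets K).card = d + 2 := by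
      rw [allFacets, Finset.card_powersetCard, hc.card_eq]
      simp [Nat.choose_succ_self_right]
    rw [h2] at h1
    exact_mod_cast h1
  have hlast : ((lateralFacets K).card : ℝ) * (ν / α * (C * (d + 2) * |σ| * G)) ≤ ν * G := by
    have h0 : 0 ≤ ν / α * (C * (d + 2) * |σ| * G) := by positivity
    calc _ ≤ ((d : ℝ) + 2) * (ν / α * (C * (d + 2) * |σ| * G)) :=
          mul_le_mul_of_nonneg_right hcard h0
      _ = (ν * G) * ((C * (d + 2) ^ 2 * |σ|) / α) := by ring
      _ ≤ (ν * G) * 1 := mul_le_mul_of_nonneg_left ((div_le_one hα0).2 hα) (by positivity)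
      _ = ν * G := mul_one _
  rw [integral_const_mul]
  linarith

end SlabMesh

end Coercivity

/-! ### The energy balance of the convective form -/

section Convection

variable {d : ℕ}

/-- The upwind flux tested with the jump: half the flux of the cell energy is turned into half the
flux of the facet energy and a nonnegative jump term. -/
lemma inner_upwindFlux_ge (u ubar w : Space d) (nt : ℝ) (n : Space d) :
    -((nt + inner ℝ w n) * (‖ubar‖ ^ 2 / 2)) ≤
      inner ℝ (upwindFlux u ubar w nt n) (u - ubar) - (nt + inner ℝ w n) * (‖u‖ ^ 2 / 2) := by
  rw [upwindFlux]
  set β := nt + inner ℝ w n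
  have h := norm_sub_sq_real u ubar
  have h0 := sq_nonneg ‖u - ubar‖
  have huu := real_inner_self_eq_norm_sq u
  have hbb := real_inner_self_eq_norm_sq ubar
  have hub := real_inner_comm u ubar
  split_ifs with hβ
  · rw [one_smul, add_sub_cancel, real_inner_smul_left, inner_sub_right, hub, hbb]
    nlinarith
  · push Not at hβ
    rw [zero_smul, add_zero, real_inner_smul_left, inner_sub_right, huu]
    nlinarith

lemma continuous_upwindFlux {X : Type*} [TopologicalSpace X] {u ubar w : X → Space d}
    (hu : Continuous u) (hubar : Continuous ubar) (hw : Continuous w) (nt : ℝ) (n : Space d) :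
    Continuous fun y => upwindFlux (u y) (ubar y) (w y) nt n := by
  -- The jump of the switch is compensated by the zero of the factor in front of it.
  have h : (fun y => upwindFlux (u y) (ubar y) (w y) nt n) = fun y =>
      (nt + inner ℝ (w y) n) • u y + min (nt + inner ℝ (w y) n) 0 • (ubar y - u y) := by
    funext y
    rw [upwindFlux, smul_add, smul_smul]
    split_ifs with hβ
    · rw [min_eq_left hβ.le, mul_one]
    · rw [min_eq_right (not_lt.1 hβ), mul_zero]
  rw [h]
  fun_prop

lemma fderiv_half_norm_sq {u : SpaceTime d → Space d} {y : SpaceTime d}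
    (hu : DifferentiableAt ℝ u y) (v : SpaceTime d) :
    fderiv ℝ (fun y => ‖u y‖ ^ 2 / 2) y v = inner ℝ (u y) (fderiv ℝ u y v) := by
  have h1 : (fun y => ‖u y‖ ^ 2 / 2) = fun y => (1 / 2 : ℝ) * ‖u y‖ ^ 2 := by
    funext y
    ring
  rw [h1, (hu.hasFDerivAt.norm_sq.const_mul (1 / 2 : ℝ)).fderiv]
  simp

/-- The divergence theorem for the space-time field `(1, w) |u|² / 2` with divergence-free `w`. -/
lemma IsCell.integral_convection {K : Finset (SpaceTime d)} (hK : IsCell K) {k : ℕ}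
    {u w : SpaceTime d → Space d} (hu : IsVecPoly k u) (hw : IsVecPoly k w)
    (hdiv : ∀ y ∈ hull K, spaceDiv w y = 0) :
    ∫ y in hull K, (inner ℝ (u y) (timeDeriv u y) + inner ℝ (u y) (spaceDeriv u y (w y))) =
      ∑ S ∈ allFacets K, ∫ y, (normalT K S + inner ℝ (w y) (normalX K S)) * (‖u y‖ ^ 2 / 2)
        ∂(facetMeasure S) := by
  set φ : SpaceTime d → ℝ := fun y => ‖u y‖ ^ 2 / 2 with hφ
  have hφc : ContDiff ℝ 1 φ := by
    have := hu.contDiff.of_le (m := 1) le_top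
    exact (this.norm_sq ℝ).div_const 2
  have hwc (j : Fin d) : ContDiff ℝ 1 fun y => w y j := (hw j).contDiff.of_le le_top
  have hud (y : SpaceTime d) : DifferentiableAt ℝ u y := hu.contDiff.differentiable (by simp) y
  set e : Fin d → SpaceTime d := fun j => stPoint 0 (EuclideanSpace.single j 1) with he
  have hpt : ∀ y ∈ hull K, inner ℝ (u y) (timeDeriv u y) + inner ℝ (u y) (spaceDeriv u y (w y)) =
      fderiv ℝ φ y (stPoint 1 0) + ∑ j, fderiv ℝ (fun y => w y j * φ y) y (e j) := by
    intro y hy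
    have h1 (j : Fin d) : fderiv ℝ (fun y => w y j * φ y) y (e j) =
        w y j * fderiv ℝ φ y (e j) + φ y * (spaceDeriv w y (EuclideanSpace.single j 1) j) := by
      rw [fderiv_fun_mul ((hwc j).differentiable one_ne_zero y) (hφc.differentiable one_ne_zero y),
        spaceDeriv, hw.fderiv_coord]
      rfl
    simp only [h1, Finset.sum_add_distrib, ← Finset.mul_sum]
    have h2 : ∑ j, spaceDeriv w y (EuclideanSpace.single j 1) j = 0 := hdiv y hy
    rw [h2, mul_zero, add_zero, spaceDeriv_eq_sum, inner_sum, fderiv_half_norm_sq (hud y)]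
    congr 1
    refine Finset.sum_congr rfl fun j _ => ?_
    rw [fderiv_half_norm_sq (hud y), real_inner_smul_right]
    rfl
  have hi (f : SpaceTime d → ℝ) (hf : ContDiff ℝ 1 f) (v : SpaceTime d) :
      IntegrableOn (fun y => fderiv ℝ f y v) (hull K) :=
    ((hf.continuous_fderiv one_ne_zero).clm_apply continuous_const).continuousOn
      |>.integrableOn_compact (isCompact_hull K)
  rw [setIntegral_congr_fun (isCompact_hull K).measurableSet hpt,
    integral_add (hi φ hφc _) (integrable_finsetSum _ fun j _ => hi _ ((hwc j).mul hφc) _),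
    integral_finsetSum _ fun j _ => hi _ ((hwc j).mul hφc) _, hK.integral_fderiv hφc]
  simp only [hK.integral_fderiv ((hwc _).mul hφc)]
  rw [Finset.sum_comm, ← Finset.sum_add_distrib]
  refine Finset.sum_congr rfl fun S hS => ?_
  have hif (f : SpaceTime d → ℝ) (hf : Continuous f) := hK.integrable_facetMeasure hS hf
  have hwj (j : Fin d) : Continuous fun y => w y j * φ y :=
    (hwc j).continuous.mul hφc.continuous
  rw [← integral_const_mul]
  simp only [← integral_const_mul]
  rw [← integral_finsetSum _ fun j _ => (hif _ (hwj j)).const_mul _,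
    ← integral_add ((hif _ hφc.continuous).const_mul _)
      (integrable_finsetSum _ fun j _ => (hif _ (hwj j)).const_mul _)]
  refine integral_congr_ae (Eventually.of_forall fun y => ?_)
  simp only [he, normalT_eq]
  simp only [inner_zero_right, mul_one, add_zero, mul_zero, zero_add, add_mul]
  congr 1
  rw [PiLp.inner_apply, Finset.sum_mul]
  refine Finset.sum_congr rfl fun j _ => ?_
  rw [EuclideanSpace.inner_single_right]
  simp
  ring

/-- The facets of a cell split into those in `𝒬_K` and those at the beginning and at the end of the
slab, where the normal is `(-1, 0)` and `(1, 0)`. -/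
lemma IsCell.sum_facets_eq {M : SlabMesh d} {Ω : ℝ → Set (Space d)} {t₀ t₁ : ℝ}
    (hM : M.Triangulates Ω t₀ t₁) {K : Finset (SpaceTime d)} (hKM : K ∈ M.cells)
    {w : SpaceTime d → Space d} {φ : SpaceTime d → ℝ} :
    ∑ S ∈ allFacets K, ∫ y, (normalT K S + inner ℝ (w y) (normalX K S)) * φ y
        ∂(facetMeasure S) =
      ∑ S ∈ lateralFacets K, ∫ y, (normalT K S + inner ℝ (w y) (normalX K S)) * φ y
        ∂(facetMeasure S) + (∫ x in cellSection K t₁, φ (stPoint t₁ x)) -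
          ∫ x in cellSection K t₀, φ (stPoint t₀ x) := by
  classical
  have hK := M.isCell hKM
  have htop : ∀ y ∈ K, (1 : ℝ) * y 0 ≤ 1 * t₁ := fun y hy => hM.le_top hKM y (subset_hull hy)
  have hbot : ∀ y ∈ K, (-1 : ℝ) * y 0 ≤ -1 * t₀ := fun y hy =>
    hM.le_bottom hKM y (subset_hull hy)
  rw [← hK.sum_integral_horizontal (by norm_num) htop,
    ← hK.sum_integral_horizontal (by norm_num) hbot, lateralFacets, Finset.sum_filter,
    ← Finset.sum_add_distrib, ← Finset.sum_sub_distrib]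
  refine Finset.sum_congr rfl fun S hS => ?_
  obtain ⟨a, rfl⟩ := hK.exists_eq_oppFacet hS
  set S := oppFacet K a
  have hT : (∀ y ∈ S, y 0 = t₁) → normalT K S = 1 ∧ normalX K S = 0 := fun h => by
    have h1 := (hK.horizontal_facet a (by norm_num) htop h).2.1
    rw [normalT, normalX, h1]
    simp
  have hB : (∀ y ∈ S, y 0 = t₀) → normalT K S = -1 ∧ normalX K S = 0 := fun h => by
    have h1 := (hK.horizontal_facet a (by norm_num) hbot h).2.1
    rw [normalT, normalX, h1]
    simp
  by_cases hn : |normalT K S| = 1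
  · rw [if_neg (not_not.2 hn)]
    rcases hM.horizontal K hKM S hS hn with h | h
    · obtain ⟨h1, h2⟩ := hB h
      have h3 : ¬ ∀ y ∈ S, y 0 = t₁ := fun h' => by
        have := (hT h').1
        rw [h1] at this
        norm_num at this
      rw [if_pos h, if_neg h3, h1, h2]
      simp [integral_neg]
    · obtain ⟨h1, h2⟩ := hT h
      have h3 : ¬ ∀ y ∈ S, y 0 = t₀ := fun h' => by
        have := (hB h').1
        rw [h1] at this
        norm_num at this
      rw [if_pos h, if_neg h3, h1, h2]
      simp
  · have h1 : ¬ ∀ y ∈ S, y 0 = t₁ := fun h => hn (by rw [(hT h).1]; norm_num)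
    have h2 : ¬ ∀ y ∈ S, y 0 = t₀ := fun h => hn (by rw [(hB h).1]; norm_num)
    rw [if_pos hn, if_neg h1, if_neg h2]
    ring

namespace SlabMesh

variable {M : SlabMesh d}

open Classical in
/-- The fluxes of the facet energy through a facet add up to something nonpositive: they cancel
between two neighbours, vanish on the Dirichlet boundary, and on the Neumann boundary they are
dominated by the outflow term. -/
lemma facet_energy_nonneg {k : ℕ} {u w : VelocityPair d} (hu : M.MemV k u) (hw : M.MemV k w)
    (hdf : M.DivFreeConforming w) {S : Finset (SpaceTime d)} (hS : S ∈ M.laterals) :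
    0 ≤ ∑ K ∈ M.cellsOf S,
      ((∫ y, -((normalT K S + inner ℝ (w.cell K y) (normalX K S)) * (‖u.facet S y‖ ^ 2 / 2))
        ∂(facetMeasure S)) +
      if S ∈ M.neumann then
        ∫ y in {y | 0 ≤ normalT K S + inner ℝ (w.facet S y) (normalX K S)},
          (normalT K S + inner ℝ (w.facet S y) (normalX K S)) *
            inner ℝ (u.facet S y) (u.facet S y) ∂(facetMeasure S) else 0) := by
  obtain ⟨K, hK, hSK⟩ := mem_laterals.1 hS
  have hc := M.isCell hK
  have hSa := lateral_subset hSK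
  have hSm := (isCompact_hull S).measurableSet
  have huS := (hu.facet K hK S hSK).continuous
  have hwS := (hw.facet K hK S hSK).continuous
  have hwK := (hw.cell K hK).continuous
  rcases boundary_or_pair hK hSK with ⟨hb, hcells⟩ | ⟨L, hL, hKL, hSL, -, hN, hsum⟩
  · rw [hcells, Finset.sum_singleton]
    by_cases hN : S ∈ M.neumann
    · rw [if_pos hN]
      have hmeas : MeasurableSet
          {y : SpaceTime d | 0 ≤ normalT K S + inner ℝ (w.facet S y) (normalX K S)} :=
        (isClosed_le continuous_const (by fun_prop)).measurableSet
      have hmax : ∀ y, {y : SpaceTime d |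
          0 ≤ normalT K S + inner ℝ (w.facet S y) (normalX K S)}.indicator
          (fun y => (normalT K S + inner ℝ (w.facet S y) (normalX K S)) *
            inner ℝ (u.facet S y) (u.facet S y)) y =
          max (normalT K S + inner ℝ (w.facet S y) (normalX K S)) 0 * ‖u.facet S y‖ ^ 2 := by
        intro y
        by_cases h : 0 ≤ normalT K S + inner ℝ (w.facet S y) (normalX K S)
        · rw [Set.indicator_of_mem (by exact h), max_eq_left h, real_inner_self_eq_norm_sq]
        · rw [Set.indicator_of_notMem (by exact h), max_eq_right (not_le.1 h).le, zero_mul]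
      rw [← integral_indicator hmeas]
      simp only [hmax]
      rw [← integral_add (hc.integrable_facetMeasure hSa (by fun_prop))
        (hc.integrable_facetMeasure hSa (by fun_prop))]
      refine setIntegral_nonneg hSm fun y hy => ?_
      rw [hdf.boundary K S hb y hy]
      set β := normalT K S + inner ℝ (w.facet S y) (normalX K S)
      have h1 := le_max_left β 0
      have h2 := le_max_right β 0
      have h3 := sq_nonneg ‖u.facet S y‖
      nlinarith
    · rw [if_neg hN, add_zero]
      refine (setIntegral_eq_zero_of_forall_eq_zero fun y hy => ?_).ge
      rw [hu.dirichlet K S hb hN y hy]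
      simp
  · have hcL := M.isCell hL
    have hwL := (hw.cell L hL).continuous
    have hSLa := lateral_subset hSL
    simp only [if_neg hN, add_zero]
    rw [hsum, ← integral_add (hc.integrable_facetMeasure hSa (by fun_prop))
        (hcL.integrable_facetMeasure hSLa (by fun_prop))]
    refine (setIntegral_eq_zero_of_forall_eq_zero fun y hy => ?_).ge
    have h1 := hdf.interior K hK L hL hKL S hSK hSL y hy
    have h2 := normalT_eq_neg hK hL hKL hSa hSLa
    rw [h2]
    linear_combination (-(‖u.facet S y‖ ^ 2 / 2)) * h1

/-- The convective form dissipates energy up to the energies at the two ends of the slab. -/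
theorem tForm_self_ge {Ω : ℝ → Set (Space d)} {t₀ t₁ : ℝ} (hM : M.Triangulates Ω t₀ t₁) {k : ℕ}
    {u w : VelocityPair d} (hu : M.MemV k u) (hw : M.MemV k w) (hdf : M.DivFreeConforming w) :
    ∑ K ∈ M.cells, ((∫ x in cellSection K t₁, ‖u.cell K (stPoint t₁ x)‖ ^ 2 / 2) +
      ∫ x in cellSection K t₀, ‖u.cell K (stPoint t₀ x)‖ ^ 2 / 2) ≤ M.tForm t₁ u w u := by
  classical
  have hvol : ∀ K ∈ M.cells, ∫ y in hull K,
      (inner ℝ (u.cell K y) (timeDeriv (u.cell K) y)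
        + inner ℝ (u.cell K y) (spaceDeriv (u.cell K) y (w.cell K y))) =
      ∑ S ∈ lateralFacets K, ∫ y, (normalT K S + inner ℝ (w.cell K y) (normalX K S)) *
        (‖u.cell K y‖ ^ 2 / 2) ∂(facetMeasure S) +
        (∫ x in cellSection K t₁, ‖u.cell K (stPoint t₁ x)‖ ^ 2 / 2) -
          ∫ x in cellSection K t₀, ‖u.cell K (stPoint t₀ x)‖ ^ 2 / 2 := fun K hK => by
    rw [(M.isCell hK).integral_convection (hu.cell K hK) (hw.cell K hK) (hdf.divFree K hK),
      IsCell.sum_facets_eq hM hK]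
  have hflux : ∀ K ∈ M.cells, ∀ S ∈ lateralFacets K,
      (∫ y, -((normalT K S + inner ℝ (w.cell K y) (normalX K S)) * (‖u.facet S y‖ ^ 2 / 2))
        ∂(facetMeasure S)) ≤
      (∫ y, inner ℝ (upwindFlux (u.cell K y) (u.facet S y) (w.cell K y) (normalT K S)
        (normalX K S)) (u.cell K y - u.facet S y) ∂(facetMeasure S)) -
      ∫ y, (normalT K S + inner ℝ (w.cell K y) (normalX K S)) * (‖u.cell K y‖ ^ 2 / 2)
        ∂(facetMeasure S) := fun K hK S hS => by
    have hc := M.isCell hK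
    have hSa := lateral_subset hS
    have h1 := (hu.cell K hK).continuous
    have h2 := (hu.facet K hK S hS).continuous
    have h3 := (hw.cell K hK).continuous
    have h4 := continuous_upwindFlux h1 h2 h3 (normalT K S) (normalX K S)
    have i1 := hc.integrable_facetMeasure hSa
      (f := fun y => inner ℝ (upwindFlux (u.cell K y) (u.facet S y) (w.cell K y) (normalT K S)
        (normalX K S)) (u.cell K y - u.facet S y)) (h4.inner (h1.sub h2))
    have i2 := hc.integrable_facetMeasure hSa
      (f := fun y => (normalT K S + inner ℝ (w.cell K y) (normalX K S)) * (‖u.cell K y‖ ^ 2 / 2))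
      (by fun_prop)
    rw [← integral_sub i1 i2]
    exact integral_mono (hc.integrable_facetMeasure hSa (by fun_prop)) (i1.sub i2)
      fun y => inner_upwindFlux_ge _ _ _ _ _
  have hfac := Finset.sum_nonneg fun S hS => facet_energy_nonneg hu hw hdf (S := S) hS
  rw [← M.sum_lateral_comm] at hfac
  simp only [Finset.sum_add_distrib] at hfac
  have hflux' := Finset.sum_le_sum fun K hK => Finset.sum_le_sum (hflux K hK)
  simp only [Finset.sum_sub_distrib] at hflux'
  have hsec : ∀ K ∈ M.cells, ∫ x in cellSection K t₁,
      inner ℝ (u.cell K (stPoint t₁ x)) (u.cell K (stPoint t₁ x)) =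
      2 * ∫ x in cellSection K t₁, ‖u.cell K (stPoint t₁ x)‖ ^ 2 / 2 := fun K _ => by
    rw [← integral_const_mul]
    congr 1
    funext x
    rw [real_inner_self_eq_norm_sq]
    ring
  rw [tForm, Finset.sum_congr rfl hvol, Finset.sum_congr rfl hsec]
  simp only [Finset.sum_filter, Finset.sum_sub_distrib, Finset.sum_add_distrib, ← Finset.mul_sum]
  linarith

end SlabMesh

end Convection

/-! ### The energy estimate -/

section Energy

variable {d : ℕ}

namespace SlabMesh

variable {M : SlabMesh d} {Ω : ℝ → Set (Space d)} {t₀ t₁ : ℝ}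

lemma Triangulates.memLp_traceBelow (h : M.Triangulates Ω t₀ t₁) (ht : t₀ ≤ t₁)
    (hΩ : IsPolyhedralDomain (Ω t₁)) {k : ℕ} {u : VelocityPair d} (hu : M.MemV k u) :
    MemLp (M.traceBelow t₁ u) 2 (volume.restrict (Ω t₁)) := by
  rw [h.memLp_of_sections (by norm_num) (fun K hK => h.le_top hK) (Set.right_mem_Icc.2 ht) hΩ]
  intro K hK
  have hc := (hu.cell K hK).continuous
  exact (memLp_cellSection hc t₁).ae_eq (h.traceBelow_ae_eq hK hc).symm

lemma Triangulates.integral_traceBelow (h : M.Triangulates Ω t₀ t₁) (ht : t₀ ≤ t₁)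
    (hΩ : IsPolyhedralDomain (Ω t₁)) {k : ℕ} {u : VelocityPair d} (hu : M.MemV k u) :
    ∫ x in Ω t₁, ‖M.traceBelow t₁ u x‖ ^ 2 =
      ∑ K ∈ M.cells, ∫ x in cellSection K t₁, ‖u.cell K (stPoint t₁ x)‖ ^ 2 := by
  have hmem := h.memLp_traceBelow ht hΩ hu
  rw [h.integral_eq_sum (by norm_num) (fun K hK => h.le_top hK) (Set.right_mem_Icc.2 ht) hΩ
    ((memLp_two_iff_integrable_sq_norm hmem.aestronglyMeasurable).1 hmem)]
  refine Finset.sum_congr rfl fun K hK => integral_congr_ae ?_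
  filter_upwards [h.traceBelow_ae_eq hK (hu.cell K hK).continuous] with x hx
  rw [hx]

/-- The energy estimate for one Picard step with an admissible convecting velocity, from testing
with the solution itself. -/
theorem SolvesPicardStep.energy_le (h : M.Triangulates Ω t₀ t₁) (ht : t₀ ≤ t₁)
    (hΩ₀ : IsPolyhedralDomain (Ω t₀)) (hΩ₁ : IsPolyhedralDomain (Ω t₁)) {k : ℕ} {C σ ν α : ℝ}
    (hC0 : 0 < C) (hC : ∀ p : Polynomial ℝ, p.natDegree ≤ k →
      p.eval 0 ^ 2 ≤ C * ∫ t in (0 : ℝ)..1, p.eval t ^ 2)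
    (hσ : M.ShapeRegular σ) (hν : 0 < ν) (hα0 : 0 < α) (hα : C * (d + 2) ^ 2 * |σ| ≤ α)
    {um : Space d → Space d} (hum : MemLp um 2 (volume.restrict (Ω t₀)))
    {w u : VelocityPair d} {p : PressurePair d} (hw : M.MemV k w) (hdf : M.DivFreeConforming w)
    (hs : M.SolvesPicardStep k ν α t₀ t₁ (fun _ => 0) (fun _ => 0) um w u p) :
    ∫ x in Ω t₁, ‖M.traceBelow t₁ u x‖ ^ 2 ≤ ∫ x in Ω t₀, ‖um x‖ ^ 2 := by
  have hu := hs.memV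
  have heq := hs.equation u p hu hs.memQ
  have ha := aForm_self_nonneg hC0 hC hσ hν hα0 hα hu
  have htf := tForm_self_ge h hu hw hdf
  have hum' := (h.memLp_of_sections (s := -1) (by norm_num) (fun K hK => h.le_bottom hK)
    (Set.left_mem_Icc.2 ht) hΩ₀ um).1 hum
  have hrhs : M.rhsForm t₀ (fun _ => 0) (fun _ => 0) um u ≤
      ∑ K ∈ M.cells, ((∫ x in cellSection K t₀, ‖um x‖ ^ 2 / 2) +
        ∫ x in cellSection K t₀, ‖u.cell K (stPoint t₀ x)‖ ^ 2 / 2) := by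
    simp only [rhsForm, inner_zero_left, integral_zero, Finset.sum_const_zero, sub_zero, zero_add]
    refine Finset.sum_le_sum fun K hK => ?_
    have h1 := hum' K hK
    have h2 : MemLp (fun x => u.cell K (stPoint t₀ x)) 2 (volume.restrict (cellSection K t₀)) :=
      memLp_cellSection (hu.cell K hK).continuous t₀
    have i1 := ((memLp_two_iff_integrable_sq_norm h1.aestronglyMeasurable).1 h1).div_const 2
    have i2 := ((memLp_two_iff_integrable_sq_norm h2.aestronglyMeasurable).1 h2).div_const 2
    rw [← integral_add i1 i2]
    have hpt : ∀ x, |inner ℝ (um x) (u.cell K (stPoint t₀ x))| ≤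
        ‖um x‖ ^ 2 / 2 + ‖u.cell K (stPoint t₀ x)‖ ^ 2 / 2 := fun x => by
      have := abs_real_inner_le_norm (um x) (u.cell K (stPoint t₀ x))
      nlinarith [sq_nonneg (‖um x‖ - ‖u.cell K (stPoint t₀ x)‖)]
    refine integral_mono ((i1.add i2).mono' ?_ (Eventually.of_forall hpt)) (i1.add i2)
      fun x => (le_abs_self _).trans (hpt x)
    exact h1.aestronglyMeasurable.inner h2.aestronglyMeasurable
  rw [h.integral_traceBelow ht hΩ₁ hu, h.integral_eq_sum (s := -1) (by norm_num)
    (fun K hK => h.le_bottom hK) (Set.left_mem_Icc.2 ht) hΩ₀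
    ((memLp_two_iff_integrable_sq_norm hum.aestronglyMeasurable).1 hum)]
  simp only [integral_div, Finset.sum_add_distrib, ← Finset.sum_div] at htf hrhs
  linarith

end SlabMesh

namespace SpaceTimeMesh

variable {𝒯 : SpaceTimeMesh d}

lemma level_le (𝒯 : SpaceTimeMesh d) {n n' : ℕ} (h : n ≤ n') (hN : n' ≤ 𝒯.N) :
    𝒯.level n ≤ 𝒯.level n' := by
  induction n', h using Nat.le_induction with
  | base => exact le_rfl
  | succ m _ ih => exact (ih (by omega)).trans (𝒯.level_lt m (by omega)).le

lemma polyhedral_level (𝒯 : SpaceTimeMesh d) {n : ℕ} (hn : n ≤ 𝒯.N) :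
    IsPolyhedralDomain (𝒯.Ω (𝒯.level n)) := by
  refine 𝒯.polyhedral _ ⟨?_, ?_⟩
  · rw [← 𝒯.level_zero]; exact 𝒯.level_le (Nat.zero_le n) hn
  · rw [← 𝒯.level_last]; exact 𝒯.level_le hn le_rfl

namespace IsPicardRun

variable {k : ℕ} {ν α : ℝ} {u₀ : Space d → Space d} {m : ℕ → ℕ} {u : ℕ → ℕ → VelocityPair d}
  {p : ℕ → ℕ → PressurePair d}

lemma memV (h : 𝒯.IsPicardRun k ν α (fun _ => 0) (fun _ => 0) u₀ m u p) {n i : ℕ} (hn : n < 𝒯.N)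
    (hi : i ≤ m n) : (𝒯.slab n).MemV k (u n i) := by
  cases i with
  | zero => exact h.guess n hn
  | succ i => exact (h.step n hn i hi).memV

lemma divFreeConforming (h : 𝒯.IsPicardRun k ν α (fun _ => 0) (fun _ => 0) u₀ m u p) {n i : ℕ}
    (hn : n < 𝒯.N) (hi : i ≤ m n) (h0 : 0 < i ∨ (𝒯.slab n).DivFreeConforming (u n 0)) :
    (𝒯.slab n).DivFreeConforming (u n i) := by
  cases i with
  | zero => exact h0.resolve_left (lt_irrefl 0)
  | succ i => exact (h.step n hn i hi).divFreeConforming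

lemma memLp_incoming (h : 𝒯.IsPicardRun k ν α (fun _ => 0) (fun _ => 0) u₀ m u p)
    (hu₀ : MemLp u₀ 2 (volume.restrict (𝒯.Ω (𝒯.level 0)))) {n : ℕ} (hn : n ≤ 𝒯.N) :
    MemLp (𝒯.incoming u₀ m u n) 2 (volume.restrict (𝒯.Ω (𝒯.level n))) := by
  cases n with
  | zero => exact hu₀
  | succ n =>
    exact (𝒯.triangulates n hn).memLp_traceBelow (𝒯.level_lt n hn).le
      (𝒯.polyhedral_level hn) (h.memV hn le_rfl)

end IsPicardRun

end SpaceTimeMesh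

end Energy

theorem mainTheorem2 (d : ℕ) (hd : d = 2 ∨ d = 3) (k : ℕ) (hk : 1 ≤ k) (σ : ℝ) :
    ∃ α₀ : ℝ, 0 < α₀ ∧ ∀ α : ℝ, α₀ ≤ α → ∀ ν : ℝ, 0 < ν →
      ∀ 𝒯 : SpaceTimeMesh d, (∀ n < 𝒯.N, (𝒯.slab n).ShapeRegular σ) →
      ∀ u₀ : Space d → Space d,
        MeasureTheory.MemLp u₀ 2 (MeasureTheory.volume.restrict (𝒯.Ω (𝒯.level 0))) →
      ∀ (m : ℕ → ℕ) (u : ℕ → ℕ → VelocityPair d) (p : ℕ → ℕ → PressurePair d),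
        𝒯.IsPicardRun k ν α (fun _ => 0) (fun _ => 0) u₀ m u p →
        (∀ n < 𝒯.N, ∀ i < m n, (0 < i ∨ (𝒯.slab n).DivFreeConforming (u n 0)) →
          𝒯.energy (n + 1) ((𝒯.slab n).traceBelow (𝒯.level (n + 1)) (u n (i + 1)))
            ≤ 𝒯.energy n (𝒯.incoming u₀ m u n)) ∧
        ((∀ n < 𝒯.N, 1 < m n ∨ (𝒯.slab n).DivFreeConforming (u n 0)) →
          ∀ n n' : ℕ, n ≤ n' → n' ≤ 𝒯.N →
            𝒯.energy n' (𝒯.incoming u₀ m u n') ≤ 𝒯.energy n (𝒯.incoming u₀ m u n)) := by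
  obtain ⟨C, hC0, hC⟩ := exists_sq_eval_zero_le k
  have hpos : 0 ≤ C * ((d : ℝ) + 2) ^ 2 * |σ| := by positivity
  refine ⟨C * ((d : ℝ) + 2) ^ 2 * |σ| + 1, by linarith, ?_⟩
  intro α hα ν hν 𝒯 hσ u₀ hu₀ m u p hrun
  have hstep : ∀ n < 𝒯.N, ∀ i < m n, (0 < i ∨ (𝒯.slab n).DivFreeConforming (u n 0)) →
      𝒯.energy (n + 1) ((𝒯.slab n).traceBelow (𝒯.level (n + 1)) (u n (i + 1)))
        ≤ 𝒯.energy n (𝒯.incoming u₀ m u n) := fun n hn i hi h0 =>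
    (hrun.step n hn i hi).energy_le (𝒯.triangulates n hn) (𝒯.level_lt n hn).le
      (𝒯.polyhedral_level hn.le) (𝒯.polyhedral_level hn) hC0 hC (hσ n hn) hν
      (by linarith) (by linarith) (hrun.memLp_incoming hu₀ hn.le)
      (hrun.memV hn hi.le) (hrun.divFreeConforming hn hi.le h0)
  refine ⟨hstep, fun hadm n n' hnn' hN => ?_⟩
  induction n', hnn' using Nat.le_induction with
  | base => exact le_rfl
  | succ l _ ih =>
    have hl : l < 𝒯.N := hN
    have hm := hrun.pos l hl
    have h1 := hstep l hl (m l - 1) (by omega) ((hadm l hl).imp_left fun h => by omega)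
    rw [Nat.sub_add_cancel hm] at h1
    exact h1.trans (ih hl.le)
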